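/- **Setting.** Let $X$ be a locally compact, $\sigma$-compact Hausdorff space with a positive Radon measure $\mu$, and let $\mathcal H$ be a separable complex Hilbert space (inner product linear in the first slot). Let $\Psi=\{\psi_x\}_{x\in X}\subset\mathcal H$ be a continuous tight frame with bound $A>0$, i.e. $x\mapsto\psi_x$ is weakly continuous and $\int_X|\langle f,\psi_x\rangle|^2\,d\mu(x)=A\|f\|^2$ for all $f\in\mathcal H$. Put $V_\Psi f(x)=\langle f,\psi_x\rangle$ and $K_\Psi(x,y)=A^{-1}\langle\psi_y,\psi_x\rangle$. An *admissible weight* is a measurable $m:X\times X\to\mathbb R$ with $1\le m(x,y)\le m(x,w)m(w,y)$, $m(x,y)=m(y,x)$ and $\sup_x m(x,x)<\infty$. $\mathcal A_m$ is the space of measurable kernels $K:X\times X\to\mathbb C$ with $$\|K\|_{\mathcal A_m}=\max\Big\{\operatorname*{ess\,sup}_{x}\int_X|K(x,y)|m(x,y)\,d\mu(y),\ \operatorname*{ess\,sup}_{y}\int_X|K(x,y)|m(x,y)\,d\mu(x)\Big\}<\infty,$$ and $K(G)(x)=\int_XK(x,y)G(y)\,d\mu(y)$. Let $m$ be admissible,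 $z\in X$ and $v=m(\cdot,z)$. Let $Y$ be a nontrivial Banach space of (classes of) functions on $X$, continuously embedded in $L^1_{loc}(X,\mu)$ and *solid*: if $G\in L^1_{loc}$, $H\in Y$ and $|G|\le|H|$ a.e., then $G\in Y$ and $\|G\|_Y\le\|H\|_Y$. Assume that * $K(F)\in Y$ and $\|K(F)\|_Y\le\|K\|_{\mathcal A_m}\|F\|_Y$ for all $K\in\mathcal A_m$, $F\in Y$; * $K_\Psi\in\mathcal A_m$, and $K_\Psi(F)/v\in L^\infty$ for all $F\in Y$. Let $\mathcal H^1_v=\{f\in\mathcal H:\|f\|_{\mathcal H^1_v}:=\int_X|V_\Psi f|\,v\,d\mu<\infty\}$, let $(\mathcal H^1_v)^*$ be its anti-dual (bounded conjugate-linear functionals), extend $V_\Psi$ to it by $V_\Psi f(x)=f(\psi_x)$, and let $$\mathrm{Co}(\Psi,Y)=\{f\in(\mathcal H^1_v)^*:V_\Psi f\in Y\},\qquad\|f\|_{\mathrm{Co}Y}=\|V_\Psi f\|_Y.$$ A *moderate admissible covering* of $X$ is a countable family $\mathcal U=\{U_i\}_{i\in I}$ of measurable relatively compact sets with non-void interior,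 with $\bigcup_iU_i=X$, $\sup_i\#\{j:U_i\cap U_j\ne\emptyset\}<\infty$, $\inf_i\mu(U_i)>0$, and a constant $\tilde C$ with $\mu(U_i)\le\tilde C\mu(U_j)$ whenever $U_i\cap U_j\neq\emptyset$. For $\Gamma:X\times X\to\mathbb C$ with $|\Gamma|=1$ put $Q_y=\bigcup_{i:\,y\in U_i}U_i$ and $$\mathrm{osc}_{\mathcal U,\Gamma}(x,y)=A^{-1}\sup_{w\in Q_y}|\langle\psi_x,\psi_y-\Gamma(y,w)\psi_w\rangle|.$$ A *BK-space* is a solid Banach space of complex sequences indexed by $I$ in which convergence implies componentwise convergence. A family $(g_i)_{i\in I}$ in a Banach space $B$ is an *atomic decomposition* for $B$ (with respect to a given topology on $B$) if there are a BK-space $B^\sharp$ and $\lambda_i\in B'$ (bounded linear functionals) such that: $(\lambda_i(f))_i\in B^\sharp$ and $\|(\lambda_i(f))_i\|_{B^\sharp}\le C_1\|f\|$ for all $f\in B$; for each $(c_i)_i\in B^\sharp$ the sum $\sum_ic_ig_i$ converges unconditionally in that topology to an element of $B$ of norm at most $C_2\|(c_i)_i\|_{B^\sharp}$; and $f=\sum_i\lambda_i(f)g_i$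 for all $f\in B$. A family $(\tilde g_i)_{i\in I}$ in $B'$ is a *Banach frame* for $B$ if there are a BK-space $B^\flat$, a bounded linear $\Omega:B^\flat\to B$ and constants $0<C_1\le C_2<\infty$ such that, for all $f\in B$, $(\tilde g_i(f))_i\in B^\flat$, $C_1\|f\|\le\|(\tilde g_i(f))_i\|_{B^\flat}\le C_2\|f\|$ and $f=\Omega((\tilde g_i(f))_i)$. **Theorem.** In this setting, suppose there are $\Gamma:X\times X\to\mathbb C$ with $|\Gamma|=1$, a moderate admissible covering $\mathcal U=\{U_i\}_{i\in I}$ and a finite constant $C_{m,\mathcal U}\ge\sup_i\sup_{x,y\in U_i}m(x,y)$ such that $\mathrm{osc}_{\mathcal U,\Gamma}\in\mathcal A_m$ and $$\|\mathrm{osc}_{\mathcal U,\Gamma}\|_{\mathcal A_m}\Big(\|K_\Psi\|_{\mathcal A_m}+\max\big\{C_{m,\mathcal U}\|K_\Psi\|_{\mathcal A_m},\ \|K_\Psi\|_{\mathcal A_m}+\|\mathrm{osc}_{\mathcal U,\Gamma}\|_{\mathcal A_m}\big\}\Big)<1.$$ Then $\psi_x\in\mathcal H^1_v$ for all $x\in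 X$, $\mathrm{Co}(\Psi,Y)$ is a Banach space, and for every choice of points $x_i\in U_i$ $(i\in I)$: * the functionals $h\mapsto\langle\psi_{x_i},h\rangle$ on $\mathcal H^1_v$ belong to $\mathrm{Co}(\Psi,Y)$, and the family $\{\psi_{x_i}\}_{i\in I}$, so understood, is an atomic decomposition for $\mathrm{Co}(\Psi,Y)$, with respect to the weak-$*$ topology of $(\mathcal H^1_v)^*$; * the functionals $f\mapsto V_\Psi f(x_i)=f(\psi_{x_i})$ are bounded on $\mathrm{Co}(\Psi,Y)$, and the family $\{\psi_{x_i}\}_{i\in I}$, so understood, is a Banach frame for $\mathrm{Co}(\Psi,Y)$. -/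

import Mathlib

open MeasureTheory Set
open scoped ENNReal ComplexConjugate

universe u v w

noncomputable section

namespace GenCoorbit

/-! ### Solid Banach spaces of functions, and BK-spaces -/

/-- A nontrivial solid Banach space of (a.e. classes of) functions on `X`, continuously embedded
in `L¹_loc(X, μ)`.  The elements are identified with classes of functions through the injective
linear map `emb`. -/
structure SolidBanachSpace {X : Type u} [TopologicalSpace X] [MeasurableSpace X]
    (μ : Measure X) : Type (max u (w + 1)) where
  carrier : Type w
  [normedAddCommGroup : NormedAddCommGroup carrier]
  [normedSpace : NormedSpace ℂ carrier]
  [completeSpace : CompleteSpace carrier]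
  [nontrivial : Nontrivial carrier]
  emb : carrier →ₗ[ℂ] (X →ₘ[μ] ℂ)
  emb_injective : Function.Injective emb
  locallyIntegrable : ∀ F, LocallyIntegrable (emb F) μ
  continuous_emb : ∀ s : Set X, IsCompact s →
    ∃ C : ℝ, ∀ F, ∫ x in s, ‖emb F x‖ ∂μ ≤ C * ‖F‖
  solid : ∀ (G : X →ₘ[μ] ℂ) (F : carrier), LocallyIntegrable G μ →
    (∀ᵐ x ∂μ, ‖G x‖ ≤ ‖emb F x‖) → ∃ G' : carrier, emb G' = G ∧ ‖G'‖ ≤ ‖F‖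

attribute [instance] SolidBanachSpace.normedAddCommGroup SolidBanachSpace.normedSpace
  SolidBanachSpace.completeSpace SolidBanachSpace.nontrivial

/-- A BK-space over `I`: a solid Banach space of complex sequences indexed by `I` in which
convergence implies componentwise convergence.  The elements are identified with sequences
through the injective linear map `coord`. -/
structure BKSpace (I : Type u) : Type (u + 1) where
  carrier : Type u
  [normedAddCommGroup : NormedAddCommGroup carrier]
  [normedSpace : NormedSpace ℂ carrier]
  [completeSpace : CompleteSpace carrier]
  coord : carrier →ₗ[ℂ] (I → ℂ)
  coord_injective : Function.Injective coord
  continuous_coord : ∀ i, Continuous fun a => coord a i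
  solid : ∀ (b : I → ℂ) (a : carrier), (∀ i, ‖b i‖ ≤ ‖coord a i‖) →
    ∃ b' : carrier, coord b' = b ∧ ‖b'‖ ≤ ‖a‖

attribute [instance] BKSpace.normedAddCommGroup BKSpace.normedSpace BKSpace.completeSpace

/-! ### Atomic decompositions and Banach frames -/

/-- `g` is an atomic decomposition for `B`; the sums converge unconditionally with respect to the
topology `τ` on `B`. -/
def IsAtomicDecomposition {I : Type u} {B : Type v} [SeminormedAddCommGroup B] [NormedSpace ℂ B]
    (τ : TopologicalSpace B) (g : I → B) : Prop :=
  ∃ (S : BKSpace I) (coeff : I → (B →L[ℂ] ℂ)),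
    (∃ C₁ : ℝ, 0 < C₁ ∧ ∀ f : B, ∃ a : S.carrier,
      S.coord a = (fun i => coeff i f) ∧ ‖a‖ ≤ C₁ * ‖f‖) ∧
    (∃ C₂ : ℝ, 0 < C₂ ∧ ∀ a : S.carrier, ∃ f : B,
      @HasSum B I _ τ (fun i => S.coord a i • g i) f (SummationFilter.unconditional I) ∧
        ‖f‖ ≤ C₂ * ‖a‖) ∧
    (∀ f : B,
      @HasSum B I _ τ (fun i => coeff i f • g i) f (SummationFilter.unconditional I))

/-- The family `g` of bounded functionals is a Banach frame for `B`. -/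
def IsBanachFrame {I : Type u} {B : Type v} [SeminormedAddCommGroup B] [NormedSpace ℂ B]
    (g : I → (B →L[ℂ] ℂ)) : Prop :=
  ∃ (S : BKSpace I) (Ω : S.carrier →L[ℂ] B) (C₁ C₂ : ℝ), 0 < C₁ ∧ C₁ ≤ C₂ ∧
    ∀ f : B, ∃ a : S.carrier, S.coord a = (fun i => g i f) ∧
      C₁ * ‖f‖ ≤ ‖a‖ ∧ ‖a‖ ≤ C₂ * ‖f‖ ∧ Ω a = f

section Kernels

variable {X : Type u} [MeasurableSpace X]

/-- Admissible weights on `X × X`. -/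
structure IsAdmissibleWeight (m : X → X → ℝ) : Prop where
  measurable : Measurable (Function.uncurry m)
  one_le : ∀ x y, 1 ≤ m x y
  le_mul : ∀ x y z, m x y ≤ m x z * m z y
  symm : ∀ x y, m x y = m y x
  diag_le : ∃ C : ℝ, 0 < C ∧ ∀ x, m x x ≤ C

/-- The norm `‖K‖_{A_m} = ‖K m‖_{A_1}`, as an extended nonnegative real. -/
def kernelNorm (μ : Measure X) (m : X → X → ℝ) (K : X → X → ℂ) : ℝ≥0∞ :=
  max (essSup (fun x => ∫⁻ y, ‖K x y * (m x y : ℂ)‖ₑ ∂μ) μ)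
    (essSup (fun y => ∫⁻ x, ‖K x y * (m x y : ℂ)‖ₑ ∂μ) μ)

/-- Membership in the weighted kernel algebra `A_m`. -/
def MemKernelAlgebra (μ : Measure X) (m : X → X → ℝ) (K : X → X → ℂ) : Prop :=
  AEStronglyMeasurable (Function.uncurry K) (μ.prod μ) ∧ kernelNorm μ m K < ∞

/-- `K(G)(x) = ∫ K(x,y) G(y) dμ(y)`. -/
def kernelApply (μ : Measure X) (K : X → X → ℂ) (G : X → ℂ) (x : X) : ℂ :=
  ∫ y, K x y * G y ∂μ

/-- `A_m(Y) ⊆ Y` and `‖K(F)‖_Y ≤ ‖K‖_{A_m} ‖F‖_Y` for `K ∈ A_m`, `F ∈ Y`.  That `K(F)` is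
defined means that the integral converges absolutely for almost every `x`. -/
def SolidBanachSpace.IsKernelModule [TopologicalSpace X] {μ : Measure X}
    (Y : SolidBanachSpace.{u, w} μ) (m : X → X → ℝ) : Prop :=
  ∀ K : X → X → ℂ, MemKernelAlgebra μ m K → ∀ F : Y.carrier, ∃ G : Y.carrier,
    (∀ᵐ x ∂μ, Integrable (fun y => K x y * Y.emb F y) μ) ∧
    Y.emb G =ᵐ[μ] kernelApply μ K (Y.emb F) ∧
    ‖G‖ ≤ (kernelNorm μ m K).toReal * ‖F‖

end Kernels

section Coverings

variable {X : Type u} [TopologicalSpace X] [MeasurableSpace X] {I : Type v}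

/-- Admissible coverings by (measurable) relatively compact sets with non-void interior. -/
structure IsAdmissibleCovering (U : I → Set X) : Prop where
  countable : Countable I
  measurableSet : ∀ i, MeasurableSet (U i)
  relativelyCompact : ∀ i, IsCompact (closure (U i))
  interior_nonempty : ∀ i, (interior (U i)).Nonempty
  covers : ⋃ i, U i = univ
  overlap : ∃ N : ℕ, ∀ i, {j | (U i ∩ U j).Nonempty}.encard ≤ N

/-- Moderate admissible coverings. -/
structure IsModerateAdmissibleCovering (μ : Measure X) (U : I → Set X) : Prop
    extends IsAdmissibleCovering U where
  lower : ∃ D : ℝ, 0 < D ∧ ∀ i, ENNReal.ofReal D ≤ μ (U i)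
  comparable : ∃ C : ℝ, ∀ i j, (U i ∩ U j).Nonempty → μ (U i) ≤ ENNReal.ofReal C * μ (U j)

/-- `Q_y`, the union of the covering sets that contain `y`. -/
def coverNhd (U : I → Set X) (y : X) : Set X := ⋃ (i : I) (_ : y ∈ U i), U i

end Coverings

section Frames

variable {X : Type u} {H : Type v} [NormedAddCommGroup H] [InnerProductSpace ℂ H]

/-- `V_Ψ f (x) = ⟨f, ψ_x⟩` for `f ∈ H`; Mathlib's inner product is linear in the second slot. -/
def transform (ψ : X → H) (f : H) (x : X) : ℂ := inner ℂ (ψ x) f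

/-- `ψ` is a weakly continuous tight frame with frame bound `A`. -/
structure IsContinuousTightFrame [TopologicalSpace X] [MeasurableSpace X]
    (μ : Measure X) (A : ℝ) (ψ : X → H) : Prop where
  bound_pos : 0 < A
  weaklyContinuous : ∀ f : H, Continuous fun x => transform ψ f x
  tight : ∀ f : H, ∫⁻ x, ‖transform ψ f x‖ₑ ^ 2 ∂μ = ENNReal.ofReal (A * ‖f‖ ^ 2)

/-- `K_Ψ(x,y) = A⁻¹ ⟨ψ_y, ψ_x⟩`. -/
def frameKernel (A : ℝ) (ψ : X → H) (x y : X) : ℂ := (A : ℂ)⁻¹ * transform ψ (ψ y) x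

/-- The `Γ`-oscillation `A⁻¹ sup_{z ∈ Q_y} |⟨ψ_x, ψ_y - Γ(y,z) ψ_z⟩|`.  For a weakly continuous
frame and an admissible covering the supremum is that of a nonempty bounded set, since `Q_y` is
relatively compact and contains `y`. -/
def osc {I : Type w} (A : ℝ) (ψ : X → H) (U : I → Set X) (Γ : X → X → ℂ) (x y : X) : ℝ :=
  A⁻¹ * ⨆ z : coverNhd U y, ‖transform ψ (ψ y - Γ y z • ψ z) x‖

/-! ### The spaces `H¹_v`, its anti-dual, and the coorbit spaces -/

/-- `H¹_v = {f ∈ H : V_Ψ f ∈ L¹_v}`. -/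
def H1 [MeasurableSpace X] (μ : Measure X) (ψ : X → H) (v : X → ℝ) : Submodule ℂ H where
  carrier := {f | Integrable (fun x => transform ψ f x * (v x : ℂ)) μ}
  add_mem' {f g} hf hg := by
    have h := Integrable.add hf hg
    refine h.congr (Filter.Eventually.of_forall fun x => ?_)
    simp [transform, add_mul]
  zero_mem' := by simp [transform]
  smul_mem' c f hf := by
    have h := Integrable.const_mul hf c
    refine h.congr (Filter.Eventually.of_forall fun x => ?_)
    simp [transform, mul_assoc]

/-- `‖f‖_{H¹_v} = ‖V_Ψ f‖_{L¹_v}`. -/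
def H1norm [MeasurableSpace X] (μ : Measure X) (ψ : X → H) (v : X → ℝ) (f : H) : ℝ :=
  ∫ x, ‖transform ψ f x‖ * v x ∂μ

/-- The anti-dual `(H¹_v)*`: the conjugate-linear functionals on `H¹_v` that are bounded for the
norm of `H¹_v`. -/
def antidual [MeasurableSpace X] (μ : Measure X) (ψ : X → H) (v : X → ℝ) :
    Submodule ℂ (H1 μ ψ v →ₛₗ[starRingEnd ℂ] ℂ) where
  carrier := {f | ∃ C : ℝ, ∀ h : H1 μ ψ v, ‖f h‖ ≤ C * H1norm μ ψ v h}
  add_mem' := by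
    rintro f g ⟨C, hC⟩ ⟨D, hD⟩
    refine ⟨C + D, fun h => ?_⟩
    rw [add_mul]
    exact (norm_add_le _ _).trans (add_le_add (hC h) (hD h))
  zero_mem' := ⟨0, fun h => by simp⟩
  smul_mem' := by
    rintro c f ⟨C, hC⟩
    refine ⟨‖c‖ * C, fun h => ?_⟩
    rw [LinearMap.smul_apply, norm_smul, mul_assoc]
    exact mul_le_mul_of_nonneg_left (hC h) (norm_nonneg c)

open Classical in
/-- The extension of `V_Ψ` to the anti-dual: `V_Ψ f (x) = f(ψ_x)`.  It is meaningful at the points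
`x` with `ψ_x ∈ H¹_v` and set to `0` at the others. -/
def extTransform [MeasurableSpace X] (μ : Measure X) (ψ : X → H) (v : X → ℝ)
    (f : antidual μ ψ v) (x : X) : ℂ :=
  if h : ψ x ∈ H1 μ ψ v then f.1 ⟨ψ x, h⟩ else 0

theorem extTransform_add [MeasurableSpace X] (μ : Measure X) (ψ : X → H) (v : X → ℝ)
    (f g : antidual μ ψ v) (x : X) :
    extTransform μ ψ v (f + g) x = extTransform μ ψ v f x + extTransform μ ψ v g x := by
  unfold extTransform
  split_ifs <;> simp

theorem extTransform_smul [MeasurableSpace X] (μ : Measure X) (ψ : X → H) (v : X → ℝ)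
    (c : ℂ) (f : antidual μ ψ v) (x : X) :
    extTransform μ ψ v (c • f) x = c * extTransform μ ψ v f x := by
  unfold extTransform
  split_ifs <;> simp

variable [TopologicalSpace X] [MeasurableSpace X]

/-- The coorbit space `Co(Ψ, Y) = {f ∈ (H¹_v)* : V_Ψ f ∈ Y}`. -/
def Co {μ : Measure X} (ψ : X → H) (v : X → ℝ) (Y : SolidBanachSpace.{u, w} μ) :
    Submodule ℂ (antidual μ ψ v) where
  carrier := {f | ∃ F : Y.carrier, Y.emb F =ᵐ[μ] extTransform μ ψ v f}
  add_mem' := by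
    rintro f g ⟨F, hF⟩ ⟨G, hG⟩
    refine ⟨F + G, ?_⟩
    rw [map_add]
    filter_upwards [AEEqFun.coeFn_add (Y.emb F) (Y.emb G), hF, hG] with x h1 h2 h3
    rw [h1, Pi.add_apply, h2, h3, extTransform_add]
  zero_mem' := by
    refine ⟨0, ?_⟩
    rw [map_zero]
    filter_upwards [AEEqFun.coeFn_zero (α := X) (μ := μ) (β := ℂ)] with x h1
    rw [h1]
    have := extTransform_smul μ ψ v 0 0 x
    rw [zero_smul, zero_mul] at this
    rw [this]; rfl
  smul_mem' := by
    rintro c f ⟨F, hF⟩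
    refine ⟨c • F, ?_⟩
    rw [map_smul]
    filter_upwards [AEEqFun.coeFn_smul c (Y.emb F), hF] with x h1 h2
    rw [h1, Pi.smul_apply, h2, extTransform_smul, smul_eq_mul]

/-- The element `V_Ψ f` of `Y`, for `f ∈ Co(Ψ, Y)`. -/
def Co.toY {μ : Measure X} (ψ : X → H) (v : X → ℝ) (Y : SolidBanachSpace.{u, w} μ) :
    Co ψ v Y →ₗ[ℂ] Y.carrier where
  toFun f := f.2.choose
  map_add' f g := by
    apply Y.emb_injective
    rw [map_add]
    apply AEEqFun.ext
    filter_upwards [AEEqFun.coeFn_add (Y.emb f.2.choose) (Y.emb g.2.choose),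
      f.2.choose_spec, g.2.choose_spec, (f + g).2.choose_spec] with x h1 h2 h3 h4
    rw [h1, Pi.add_apply, h2, h3, h4, Submodule.coe_add, extTransform_add]
  map_smul' c f := by
    apply Y.emb_injective
    rw [map_smul]
    apply AEEqFun.ext
    filter_upwards [AEEqFun.coeFn_smul (RingHom.id ℂ c) (Y.emb f.2.choose),
      f.2.choose_spec, (c • f).2.choose_spec] with x h1 h2 h4
    rw [h1, Pi.smul_apply, h2, h4, Submodule.coe_smul, extTransform_smul]
    rfl

/-- `‖f‖_{Co Y} = ‖V_Ψ f‖_Y`; this is a seminorm on `Co(Ψ, Y)` without any assumption. -/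
instance Co.instSeminormedAddCommGroup {μ : Measure X} (ψ : X → H) (v : X → ℝ)
    (Y : SolidBanachSpace.{u, w} μ) : SeminormedAddCommGroup (Co ψ v Y) :=
  SeminormedAddCommGroup.induced _ _ (Co.toY ψ v Y)

instance Co.instNormedSpace {μ : Measure X} (ψ : X → H) (v : X → ℝ)
    (Y : SolidBanachSpace.{u, w} μ) : NormedSpace ℂ (Co ψ v Y) :=
  NormedSpace.induced ℂ _ _ (Co.toY ψ v Y)

/-- The weak-* topology of `(H¹_v)*`, restricted to `Co(Ψ, Y)`: pointwise convergence on `H¹_v`. -/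
abbrev Co.weakStar {μ : Measure X} (ψ : X → H) (v : X → ℝ) (Y : SolidBanachSpace.{u, w} μ) :
    TopologicalSpace (Co ψ v Y) :=
  TopologicalSpace.induced (fun (f : Co ψ v Y) (h : H1 μ ψ v) => (f.1.1 h : ℂ))
    Pi.topologicalSpace

end Frames

end GenCoorbit

end

namespace GenCoorbit

open Filter Topology

/-! ### Tight frames in the Hilbert space: measurability and the reproducing kernel. -/

section FrameBasics

/-! Write R for `frameKernel` and V for the transform. Polarising tightness gives ∫ conj(Vf) Vg =
A⟨f,g⟩ in Mathlib's convention, so R reproduces V on the Hilbert space. Functionals in the anti-dual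
of H¹_v are given by densities in L^∞_{1/v} (`antidual_exists_repr`). The pairing f(h) = A⁻¹ ∫
conj(Vh) Vf and the identity R(Vf) = Vf therefore extend to them (`antidual_apply_eq`,
`kernelApply_extTransform`). Hence V identifies Co(Ψ,Y) isometrically with the closed subspace {F ∈
Y : R F = F} (`coEquiv`). Completeness follows, and the discretization is carried out in that
subspace.

Refine the covering to disjoint measurable pieces X_i ⊆ U_i and, for y in X_i, replace R(x,y) by
γ(y) R(x,x_i). For γ(y) = Γ(y,x_i) the error kernel E(x,y) = R(x,y) − γ(y) R(x,x_i) is bounded by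
the oscillation. Nothing makes Γ measurable, so γ takes values in a countable dense set of phases.
This costs ε(|R| + osc), which the strict smallness hypothesis absorbs (`exists_phase_small`). The
outcome is ‖E‖ < 1 and ‖R‖‖E‖ < 1.

If R F = F, then F − E F = ∑ (∫_{X_i} γF) R(·,x_i). So 1 − E preserves the subspace and is inverted
there by a Neumann series; this is the atomic decomposition. Dually, the function equal to conj γ(y)
F(x_i) on X_i is F − E*F. Applying R and inverting 1 − R E* recovers F from its samples; this is the
Banach frame.

The sequence norms are the Y-norms of ∑ |a_i| χ_{U_i} for samples and of ∑ |a_i| μ(U_i)⁻¹ χ_{U_i}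
for coefficients. Bounds for the samples, the atoms and the synthesis rest on |R(x,w)| ≤ |R(x,y)| +
osc(x,y) for y, w in one U_i (`norm_frameKernel_le`): a discrete object is dominated by the kernel
|R| + osc of A_m, and solidity does the rest.

In `IsAtomicDecomposition` the arrow `→L` refers to the topology `τ`, so the coefficient functionals
must be weak-* continuous; their norm bound is contained in the estimate of the sequence norm. They
are realised as evaluations at vectors of H¹_v by solving the transposed equation in L¹
(`exists_integrable_sub_eq`, `exists_H1_coefficient`). -/

theorem countable_of_orthonormal {ι : Type*} {H : Type*} [NormedAddCommGroup H]
    [InnerProductSpace ℂ H] [TopologicalSpace.SeparableSpace H] {e : ι → H}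
    (he : Orthonormal ℂ e) : Countable ι := by
  -- Orthonormal vectors are at distance √2, so the balls of radius 1/2 about them are disjoint.
  refine Pairwise.countable_of_isOpen_disjoint (s := fun i => Metric.ball (e i) (1 / 2)) ?_
    (fun i => Metric.isOpen_ball) (fun i => ⟨e i, Metric.mem_ball_self (by norm_num)⟩)
  intro i j hij
  refine Metric.ball_disjoint_ball ?_
  have h1 : ‖e i - e j‖ ^ 2 = 2 := by
    rw [@norm_sub_sq ℂ, he.1 i, he.1 j, he.2 hij]
    norm_num
  rw [dist_eq_norm]
  nlinarith [norm_nonneg (e i - e j)]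

/-- Separability makes a Hilbert basis countable, so ψ is a pointwise limit of measurable partial
sums along a countably generated filter. Weak measurability thus becomes strong measurability. -/
theorem stronglyMeasurable_of_inner {X : Type*} [MeasurableSpace X] {H : Type*}
    [NormedAddCommGroup H] [InnerProductSpace ℂ H] [CompleteSpace H]
    [TopologicalSpace.SeparableSpace H] {ψ : X → H}
    (h : ∀ f : H, StronglyMeasurable fun x => (inner ℂ f (ψ x) : ℂ)) : StronglyMeasurable ψ := by
  obtain ⟨s, b, -⟩ := exists_hilbertBasis ℂ H
  have : Countable s := countable_of_orthonormal b.orthonormal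
  refine stronglyMeasurable_of_tendsto (u := (atTop : Filter (Finset s)))
    (f := fun t x => ∑ i ∈ t, (inner ℂ (b i) (ψ x) : ℂ) • b i) (fun t => ?_) ?_
  · exact Finset.stronglyMeasurable_fun_sum t fun i _ => (h (b i)).smul_const (b i)
  · rw [tendsto_pi_nhds]
    intro x
    have := b.hasSum_repr (ψ x)
    simp only [HilbertBasis.repr_apply_apply] at this
    exact this

variable {X : Type u} {H : Type v} [NormedAddCommGroup H] [InnerProductSpace ℂ H]

theorem transform_add (ψ : X → H) (f g : H) (x : X) :
    transform ψ (f + g) x = transform ψ f x + transform ψ g x := by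
  simp [transform]

theorem transform_smul (ψ : X → H) (c : ℂ) (f : H) (x : X) :
    transform ψ (c • f) x = c * transform ψ f x := by
  simp [transform]

theorem frameKernel_swap (A : ℝ) (ψ : X → H) (x y : X) :
    frameKernel A ψ y x = conj (frameKernel A ψ x y) := by
  simp [frameKernel, transform, inner_conj_symm]

theorem norm_frameKernel_swap (A : ℝ) (ψ : X → H) (x y : X) :
    ‖frameKernel A ψ y x‖ = ‖frameKernel A ψ x y‖ := by
  rw [frameKernel_swap, RCLike.norm_conj]

theorem transform_eq_frameKernel {A : ℝ} (hA : 0 < A) (ψ : X → H) (x y : X) :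
    transform ψ (ψ y) x = A * frameKernel A ψ x y := by
  have : (A : ℂ) ≠ 0 := by exact_mod_cast hA.ne'
  rw [frameKernel, mul_inv_cancel_left₀ this]

theorem conj_transform_frame {A : ℝ} (hA : 0 < A) (ψ : X → H) (x y : X) :
    conj (transform ψ (ψ x) y) = A * frameKernel A ψ x y := by
  rw [← transform_eq_frameKernel hA]
  simp [transform, inner_conj_symm]

variable [TopologicalSpace X] [MeasurableSpace X] [BorelSpace X] {μ : Measure X} {A : ℝ}
  {ψ : X → H}

namespace IsContinuousTightFrame

theorem stronglyMeasurable_transform (hψ : IsContinuousTightFrame μ A ψ) (f : H) :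
    StronglyMeasurable (transform ψ f) :=
  (hψ.weaklyContinuous f).measurable.stronglyMeasurable

theorem stronglyMeasurable [CompleteSpace H] [TopologicalSpace.SeparableSpace H]
    (hψ : IsContinuousTightFrame μ A ψ) : StronglyMeasurable ψ := by
  refine stronglyMeasurable_of_inner fun f => ?_
  have := (hψ.stronglyMeasurable_transform f)
  have h2 : (fun x => (inner ℂ f (ψ x) : ℂ)) = fun x => conj (transform ψ f x) := by
    ext x; simp [transform, inner_conj_symm]
  rw [h2]
  exact Complex.continuous_conj.comp_stronglyMeasurable this

theorem stronglyMeasurable_frameKernel [CompleteSpace H] [TopologicalSpace.SeparableSpace H]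
    (hψ : IsContinuousTightFrame μ A ψ) :
    StronglyMeasurable (Function.uncurry (frameKernel A ψ)) := by
  unfold frameKernel transform
  have h1 : StronglyMeasurable fun p : X × X => ψ p.1 :=
    hψ.stronglyMeasurable.comp_measurable measurable_fst
  have h2 : StronglyMeasurable fun p : X × X => ψ p.2 :=
    hψ.stronglyMeasurable.comp_measurable measurable_snd
  exact (h1.inner h2).const_mul _

theorem memLp_transform (hψ : IsContinuousTightFrame μ A ψ) (f : H) :
    MemLp (transform ψ f) 2 μ := by
  refine ⟨(hψ.stronglyMeasurable_transform f).aestronglyMeasurable, ?_⟩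
  rw [eLpNorm_lt_top_iff_lintegral_rpow_enorm_lt_top (by norm_num) (by norm_num)]
  have := hψ.tight f
  simp only [ENNReal.toReal_ofNat, ENNReal.rpow_ofNat]
  rw [this]; exact ENNReal.ofReal_lt_top

theorem integral_normSq_transform (hψ : IsContinuousTightFrame μ A ψ) (f : H) :
    ∫ x, ‖transform ψ f x‖ ^ 2 ∂μ = A * ‖f‖ ^ 2 := by
  have hm : AEStronglyMeasurable (fun x => ‖transform ψ f x‖ ^ 2) μ :=
    ((hψ.stronglyMeasurable_transform f).norm.pow 2).aestronglyMeasurable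
  rw [integral_eq_lintegral_of_nonneg_ae (ae_of_all _ fun x => by positivity) hm]
  have : ∀ x, ENNReal.ofReal (‖transform ψ f x‖ ^ 2) = ‖transform ψ f x‖ₑ ^ 2 := fun x => by
    rw [ENNReal.ofReal_pow (norm_nonneg _), ofReal_norm]
  simp only [this, hψ.tight f]
  exact ENNReal.toReal_ofReal (mul_nonneg hψ.bound_pos.le (sq_nonneg _))

/-- The transform as a linear map into `L²`. -/
noncomputable def toL2 (hψ : IsContinuousTightFrame μ A ψ) : H →ₗ[ℂ] Lp ℂ 2 μ where
  toFun f := (hψ.memLp_transform f).toLp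
  map_add' f g := by
    rw [← MemLp.toLp_add]
    congr 1; ext x; exact transform_add ψ f g x
  map_smul' c f := by
    rw [RingHom.id_apply, ← MemLp.toLp_const_smul]
    congr 1; ext x; exact transform_smul ψ c f x

theorem inner_toL2 (hψ : IsContinuousTightFrame μ A ψ) (f g : H) :
    (inner ℂ (hψ.toL2 f) (hψ.toL2 g) : ℂ) = ∫ x, conj (transform ψ f x) * transform ψ g x ∂μ := by
  rw [L2.inner_def]
  refine integral_congr_ae ?_
  filter_upwards [(hψ.memLp_transform f).coeFn_toLp, (hψ.memLp_transform g).coeFn_toLp]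
    with x h1 h2
  change (inner ℂ ((hψ.memLp_transform f).toLp _ x) ((hψ.memLp_transform g).toLp _ x) : ℂ) = _
  rw [h1, h2]
  simp [mul_comm]

/-- A^{-1/2} V is a linear isometry into L², hence preserves inner products. -/
theorem integral_conj_mul (hψ : IsContinuousTightFrame μ A ψ) (f g : H) :
    ∫ x, conj (transform ψ f x) * transform ψ g x ∂μ = A * inner ℂ f g := by
  have key : ∀ f : H, ‖hψ.toL2 f‖ ^ 2 = A * ‖f‖ ^ 2 := fun f => by
    have h := hψ.inner_toL2 f f
    rw [inner_self_eq_norm_sq_to_K] at h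
    have h2 : ∀ x, conj (transform ψ f x) * transform ψ f x
        = ((‖transform ψ f x‖ ^ 2 : ℝ) : ℂ) := fun x => by
      rw [mul_comm, Complex.mul_conj, Complex.normSq_eq_norm_sq]
    simp only [h2] at h
    rw [integral_complex_ofReal, hψ.integral_normSq_transform] at h
    exact Complex.ofReal_injective (by simpa using h)
  have hs : ((Real.sqrt A : ℝ) : ℂ) ^ 2 = A := by
    exact_mod_cast Real.sq_sqrt hψ.bound_pos.le
  have hs0 : ((Real.sqrt A : ℝ) : ℂ) ≠ 0 := by
    exact_mod_cast (Real.sqrt_pos.2 hψ.bound_pos).ne'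
  let L : H →ₗᵢ[ℂ] Lp ℂ 2 μ :=
    { toLinearMap := ((Real.sqrt A : ℝ) : ℂ)⁻¹ • hψ.toL2
      norm_map' := fun f => by
        rw [LinearMap.smul_apply, norm_smul]
        have h := key f
        have : ‖hψ.toL2 f‖ = Real.sqrt A * ‖f‖ := by
          rw [← Real.sqrt_sq (norm_nonneg (hψ.toL2 f)), h, Real.sqrt_mul hψ.bound_pos.le,
            Real.sqrt_sq (norm_nonneg f)]
        rw [this]
        have hp := Real.sqrt_pos.2 hψ.bound_pos
        rw [norm_inv, Complex.norm_real, Real.norm_of_nonneg hp.le, inv_mul_cancel_left₀ hp.ne'] }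
  have h := L.inner_map_map f g
  change inner ℂ (((Real.sqrt A : ℝ) : ℂ)⁻¹ • hψ.toL2 f)
    (((Real.sqrt A : ℝ) : ℂ)⁻¹ • hψ.toL2 g) = _ at h
  rw [inner_smul_left, inner_smul_right, hψ.inner_toL2, map_inv₀, Complex.conj_ofReal] at h
  rw [← h, ← hs]
  field_simp

/-- The reproducing formula for elements of the Hilbert space. -/
theorem integral_frameKernel_mul (hψ : IsContinuousTightFrame μ A ψ) (h : H) (x : X) :
    ∫ y, frameKernel A ψ x y * transform ψ h y ∂μ = transform ψ h x := by
  have hA : (A : ℂ) ≠ 0 := by exact_mod_cast hψ.bound_pos.ne'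
  have h1 := hψ.integral_conj_mul (ψ x) h
  simp only [conj_transform_frame hψ.bound_pos, mul_assoc] at h1
  rw [integral_const_mul] at h1
  exact mul_left_cancel₀ hA h1

theorem eq_zero_of_transform_ae_eq_zero (hψ : IsContinuousTightFrame μ A ψ) {f : H}
    (hf : transform ψ f =ᵐ[μ] 0) : f = 0 := by
  have h := hψ.integral_normSq_transform f
  rw [integral_congr_ae (g := fun _ => (0 : ℝ))] at h
  · simp only [integral_zero] at h
    have := (mul_eq_zero.1 h.symm).resolve_left hψ.bound_pos.ne'
    simpa using this
  · filter_upwards [hf] with x hx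
    simp [hx]

end IsContinuousTightFrame

end FrameBasics

/-! ### The dual of L¹ over a σ-finite measure. -/

section L1Dual

variable {X : Type*} [MeasurableSpace X] {μ : Measure X}

theorem exists_pos_memLp_two [SigmaFinite μ] :
    ∃ φ : X → ℝ, (∀ x, 0 < φ x) ∧ Measurable φ ∧ MemLp (fun x => (φ x : ℂ)) 2 μ := by
  obtain ⟨g, hg, hgm, hgi⟩ := exists_pos_lintegral_lt_of_sigmaFinite μ (one_ne_zero (α := ℝ≥0∞))
  have hm : Measurable fun x => Real.sqrt (g x) := hgm.coe_nnreal_real.sqrt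
  refine ⟨fun x => Real.sqrt (g x), fun x => Real.sqrt_pos.2 (hg x), hm,
    (Complex.measurable_ofReal.comp hm).aestronglyMeasurable, ?_⟩
  rw [eLpNorm_lt_top_iff_lintegral_rpow_enorm_lt_top (by norm_num) (by norm_num)]
  refine lt_of_le_of_lt (le_of_eq ?_) (hgi.trans ENNReal.one_lt_top)
  refine lintegral_congr fun x => ?_
  have : ‖((Real.sqrt (g x) : ℝ) : ℂ)‖ₑ = ENNReal.ofReal (Real.sqrt (g x)) := by
    rw [← ofReal_norm, Complex.norm_real, Real.norm_of_nonneg (Real.sqrt_nonneg _)]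
  rw [this, ENNReal.toReal_ofNat, ENNReal.rpow_ofNat, ← ENNReal.ofReal_pow (Real.sqrt_nonneg _),
    Real.sq_sqrt (g x).coe_nonneg, ENNReal.ofReal_coe_nnreal]

/-- Bounded functionals on `L¹` of a `σ`-finite measure are given by bounded functions. -/
theorem exists_bounded_repr_of_dual_L1 [SigmaFinite μ] (Λ : Lp ℂ 1 μ →L[ℂ] ℂ) :
    ∃ b : X → ℂ, StronglyMeasurable b ∧ (∀ᵐ x ∂μ, ‖b x‖ ≤ ‖Λ‖) ∧
      ∀ (u : X → ℂ) (hu : Integrable u μ), Λ (hu.toL1 u) = ∫ x, u x * b x ∂μ := by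
  obtain ⟨φ, hφ, hφm, hφ2⟩ := exists_pos_memLp_two (μ := μ)
  have hφc : Measurable fun x => (φ x : ℂ) := Complex.measurable_ofReal.comp hφm
  -- Multiplication by φ ∈ L² carries L² into L¹, so Λ pulls back to L², where Riesz representation
  -- applies. The density of Λ is then k / φ.
  let ℓ : Lp ℂ 2 μ →L[ℂ] ℂ := Λ.comp ((ContinuousLinearMap.mul ℂ ℂ).holderL μ 2 2 1 hφ2.toLp)
  let g : Lp ℂ 2 μ := (InnerProductSpace.toDual ℂ (Lp ℂ 2 μ)).symm ℓ
  let k : X → ℂ := fun x => conj (g x)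
  have hkm : StronglyMeasurable k :=
    Complex.continuous_conj.comp_stronglyMeasurable (Lp.stronglyMeasurable g)
  have hk2 : MemLp k 2 μ := (Lp.memLp g).star
  have hint : ∀ u : X → ℂ, MemLp u 2 μ → Integrable (fun x => u x * φ x) μ := fun u hu =>
    hu.integrable_mul hφ2
  have hrep : ∀ (u : X → ℂ) (hu : MemLp u 2 μ),
      Λ ((hint u hu).toL1 _) = ∫ x, u x * k x ∂μ := by
    intro u hu
    have h1 : ℓ hu.toLp = inner ℂ g hu.toLp := by
      rw [InnerProductSpace.toDual_symm_apply]
    have h2 : ℓ hu.toLp = Λ ((hint u hu).toL1 _) := by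
      change Λ _ = _
      congr 1
      apply Lp.ext
      filter_upwards [(ContinuousLinearMap.mul ℂ ℂ).coeFn_holder (r := 1) hφ2.toLp hu.toLp,
        hφ2.coeFn_toLp, hu.coeFn_toLp, (hint u hu).coeFn_toL1] with x e1 e2 e3 e4
      change ((ContinuousLinearMap.mul ℂ ℂ).holder 1 hφ2.toLp hu.toLp : X → ℂ) x = _
      rw [e1, e2, e3, e4]
      simp [mul_comm]
    rw [← h2, h1, L2.inner_def]
    refine integral_congr_ae ?_
    filter_upwards [hu.coeFn_toLp] with x e
    rw [e]; simp [k]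
  have hnorm : ∀ (u : X → ℂ) (hu : MemLp u 2 μ),
      ‖∫ x, u x * k x ∂μ‖ ≤ ‖Λ‖ * ∫ x, ‖u x‖ * φ x ∂μ := by
    intro u hu
    rw [← hrep u hu]
    refine (Λ.le_opNorm _).trans (le_of_eq ?_)
    rw [L1.norm_eq_integral_norm]
    congr 1
    refine integral_congr_ae ?_
    filter_upwards [(hint u hu).coeFn_toL1] with x e
    rw [e, norm_mul, Complex.norm_real, Real.norm_of_nonneg (hφ x).le]
  -- the bound for `k`
  have hbd : ∀ᵐ x ∂μ, ‖k x‖ ≤ ‖Λ‖ * φ x := by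
    let E : Set X := {x | ‖Λ‖ * φ x < ‖k x‖}
    have hE : MeasurableSet E :=
      measurableSet_lt (hφm.const_mul _) hkm.norm.measurable
    -- Testing with conj k on the set E where the bound fails gives ∫_E |k|(|k| − ‖Λ‖φ) ≤ 0. The
    -- integrand is positive on E, so E is null.
    have hu2 : MemLp (E.indicator (fun x => conj (k x))) 2 μ := hk2.star.indicator hE
    have h1 := hnorm _ hu2
    have e1 : ∀ x, E.indicator (fun x => conj (k x)) x * k x
        = ((E.indicator (fun x => ‖k x‖ ^ 2) x : ℝ) : ℂ) := fun x => by
      by_cases hx : x ∈ E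
      · simp only [indicator_of_mem hx]
        rw [mul_comm, Complex.mul_conj, Complex.normSq_eq_norm_sq]
      · simp [indicator_of_notMem hx]
    have e2 : ∀ x, ‖E.indicator (fun x => conj (k x)) x‖ * φ x
        = E.indicator (fun x => ‖k x‖ * φ x) x := fun x => by
      by_cases hx : x ∈ E
      · simp [indicator_of_mem hx]
      · simp [indicator_of_notMem hx]
    simp only [e1, e2] at h1
    rw [integral_complex_ofReal, Complex.norm_real] at h1
    have i1 : Integrable (E.indicator fun x => ‖k x‖ ^ 2) μ := by
      have := hk2.norm.integrable_mul hk2.norm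
      refine (this.indicator hE).congr (ae_of_all _ fun x => ?_)
      simp only [pow_two]; rfl
    have i2 : Integrable (E.indicator fun x => ‖k x‖ * φ x) μ := by
      have := hk2.norm.integrable_mul hφ2.norm
      refine (this.indicator hE).congr (ae_of_all _ fun x => ?_)
      by_cases hx : x ∈ E
      · simp [indicator_of_mem hx, abs_of_pos (hφ x)]
      · simp [indicator_of_notMem hx]
    have h2 : ∫ x, E.indicator (fun x => ‖k x‖ * (‖k x‖ - ‖Λ‖ * φ x)) x ∂μ ≤ 0 := by
      have e3 : ∀ x, E.indicator (fun x => ‖k x‖ * (‖k x‖ - ‖Λ‖ * φ x)) x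
          = E.indicator (fun x => ‖k x‖ ^ 2) x
            - ‖Λ‖ * E.indicator (fun x => ‖k x‖ * φ x) x := fun x => by
        by_cases hx : x ∈ E
        · simp only [indicator_of_mem hx]; ring
        · simp [indicator_of_notMem hx]
      simp only [e3]
      rw [integral_sub i1 (i2.const_mul _), integral_const_mul]
      linarith [le_abs_self (∫ x, E.indicator (fun x => ‖k x‖ ^ 2) x ∂μ), Real.norm_eq_abs
        (∫ x, E.indicator (fun x => ‖k x‖ ^ 2) x ∂μ)]
    have hpos : ∀ x, 0 ≤ E.indicator (fun x => ‖k x‖ * (‖k x‖ - ‖Λ‖ * φ x)) x :=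
      indicator_nonneg fun x hx =>
        mul_nonneg (norm_nonneg _) (sub_nonneg.2 (le_of_lt hx))
    have i3 : Integrable (E.indicator fun x => ‖k x‖ * (‖k x‖ - ‖Λ‖ * φ x)) μ := by
      refine (i1.sub (i2.const_mul ‖Λ‖)).congr (ae_of_all _ fun x => ?_)
      by_cases hx : x ∈ E
      · simp only [Pi.sub_apply, indicator_of_mem hx]; ring
      · simp [indicator_of_notMem hx]
    have h3 := (integral_eq_zero_iff_of_nonneg hpos i3).1
      (le_antisymm h2 (integral_nonneg hpos))
    filter_upwards [h3] with x hx
    by_contra hcon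
    have hxE : x ∈ E := not_le.1 hcon
    rw [indicator_of_mem hxE] at hx
    have p1 : 0 < ‖k x‖ := lt_of_le_of_lt
      (mul_nonneg (norm_nonneg _) (hφ x).le) (not_le.1 hcon)
    exact absurd hx (mul_pos p1 (sub_pos.2 (not_le.1 hcon))).ne'
  have hbm : StronglyMeasurable fun x => k x / (φ x : ℂ) :=
    (hkm.measurable.div hφc).stronglyMeasurable
  have hbb : ∀ᵐ x ∂μ, ‖k x / (φ x : ℂ)‖ ≤ ‖Λ‖ := by
    filter_upwards [hbd] with x hx
    rw [norm_div, Complex.norm_real, Real.norm_of_nonneg (hφ x).le, div_le_iff₀ (hφ x)]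
    exact hx
  refine ⟨fun x => k x / φ x, hbm, hbb, fun u hu => ?_⟩
  -- approximation by functions dominated by multiples of `φ²`
  obtain ⟨w, hwm, hwu⟩ := hu.1
  have hw : Integrable w μ := hu.congr hwu
  have eq1 : hu.toL1 u = hw.toL1 w := (Integrable.toL1_eq_toL1_iff _ _ _ _).2 hwu
  have eq2 : ∫ x, u x * (k x / φ x) ∂μ = ∫ x, w x * (k x / φ x) ∂μ := by
    refine integral_congr_ae ?_
    filter_upwards [hwu] with x hx
    rw [hx]
  rw [eq1, eq2]
  -- On S n the quotient w / φ is at most nφ, hence in L², and the Riesz formula applies. Every x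
  -- lies in S n for large n because φ > 0.
  let S : ℕ → Set X := fun n => {x | ‖w x‖ ≤ n * φ x ^ 2}
  have hS : ∀ n, MeasurableSet (S n) := fun n =>
    measurableSet_le hwm.norm.measurable ((hφm.pow_const 2).const_mul _)
  let wn : ℕ → X → ℂ := fun n => (S n).indicator w
  have hwn : ∀ n, Integrable (wn n) μ := fun n => hw.indicator (hS n)
  have hlim : ∀ x, ∀ᶠ n in atTop, wn n x = w x := fun x => by
    obtain ⟨N, hN⟩ := exists_nat_ge (‖w x‖ / φ x ^ 2)
    filter_upwards [eventually_ge_atTop N] with n hn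
    refine indicator_of_mem ?_ _
    have h1 : ‖w x‖ / φ x ^ 2 ≤ n := hN.trans (by exact_mod_cast hn)
    exact (div_le_iff₀ (pow_pos (hφ x) 2)).1 h1
  have hle : ∀ n x, ‖wn n x‖ ≤ ‖w x‖ := fun n x => norm_indicator_le_norm_self w x
  have hun : ∀ n, MemLp (fun x => wn n x / φ x) 2 μ := fun n => by
    refine MemLp.of_le_mul (c := n) hφ2
      (((hwm.indicator (hS n)).measurable.div hφc).aestronglyMeasurable) (ae_of_all _ fun x => ?_)
    rw [norm_div, Complex.norm_real, Real.norm_of_nonneg (hφ x).le, div_le_iff₀ (hφ x)]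
    by_cases hx : x ∈ S n
    · simp only [wn, indicator_of_mem hx]
      have : ‖w x‖ ≤ n * φ x ^ 2 := hx
      linarith [this, sq (φ x)]
    · simp only [wn, indicator_of_notMem hx, norm_zero]
      have := hφ x
      positivity
  have hval : ∀ n, Λ ((hwn n).toL1 _) = ∫ x, wn n x * (k x / φ x) ∂μ := fun n => by
    have h1 := hrep _ (hun n)
    have h2 : (hint _ (hun n)).toL1 _ = (hwn n).toL1 _ := by
      rw [Integrable.toL1_eq_toL1_iff]
      refine ae_of_all _ fun x => ?_
      have : (φ x : ℂ) ≠ 0 := by exact_mod_cast (hφ x).ne'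
      simp only
      field_simp
    rw [← h2, h1]
    refine integral_congr_ae (ae_of_all _ fun x => ?_)
    simp only; ring
  have t1 : Tendsto (fun n => Λ ((hwn n).toL1 _)) atTop (𝓝 (Λ (hw.toL1 w))) := by
    refine (Λ.continuous.tendsto _).comp ?_
    rw [tendsto_iff_norm_sub_tendsto_zero]
    have e : ∀ n, ‖(hwn n).toL1 _ - hw.toL1 w‖ = ∫ x, ‖wn n x - w x‖ ∂μ := fun n => by
      rw [← Integrable.toL1_sub, L1.norm_eq_integral_norm]
      refine integral_congr_ae ?_
      filter_upwards [((hwn n).sub hw).coeFn_toL1] with x hx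
      rw [hx]; rfl
    simp only [e]
    have := tendsto_integral_of_dominated_convergence (μ := μ)
      (F := fun n x => ‖wn n x - w x‖) (f := fun _ => (0 : ℝ)) (fun x => 2 * ‖w x‖)
      (fun n => ((hwn n).sub hw).norm.aestronglyMeasurable) (hw.norm.const_mul 2)
      (fun n => ae_of_all _ fun x => ?_) (ae_of_all _ fun x => ?_)
    · simpa using this
    · rw [norm_norm]
      linarith [norm_sub_le (wn n x) (w x), hle n x]
    · refine tendsto_const_nhds.congr' ?_
      filter_upwards [hlim x] with n hn
      rw [hn]; simp
  have t2 : Tendsto (fun n => ∫ x, wn n x * (k x / φ x) ∂μ) atTop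
      (𝓝 (∫ x, w x * (k x / φ x) ∂μ)) := by
    refine tendsto_integral_of_dominated_convergence (fun x => ‖w x‖ * ‖Λ‖)
      (fun n => (hwn n).1.mul hbm.aestronglyMeasurable) (hw.norm.mul_const _)
      (fun n => ?_) (ae_of_all _ fun x => ?_)
    · filter_upwards [hbb] with x hx
      rw [norm_mul]
      exact mul_le_mul (hle n x) hx (norm_nonneg _) (norm_nonneg _)
    · refine tendsto_const_nhds.congr' ?_
      filter_upwards [hlim x] with n hn
      rw [hn]
  simp only [hval] at t1
  exact tendsto_nhds_unique t1 t2

end L1Dual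

/-! ### The weighted kernel algebra. -/

section KernelAlgebra

variable {X : Type u} [MeasurableSpace X] {μ : Measure X} {m : X → X → ℝ} {K L : X → X → ℂ}

theorem IsAdmissibleWeight.pos (hm : IsAdmissibleWeight m) (x y : X) : 0 < m x y :=
  one_pos.trans_le (hm.one_le x y)

theorem kernelNorm_mono (h₁ : ∀ᵐ x ∂μ, ∀ᵐ y ∂μ, ‖K x y‖ ≤ ‖L x y‖)
    (h₂ : ∀ᵐ y ∂μ, ∀ᵐ x ∂μ, ‖K x y‖ ≤ ‖L x y‖) : kernelNorm μ m K ≤ kernelNorm μ m L := by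
  have key : ∀ a b c : ℂ, ‖a‖ ≤ ‖b‖ → ‖a * c‖ₑ ≤ ‖b * c‖ₑ := fun a b c h => by
    rw [enorm_mul, enorm_mul]
    exact mul_le_mul_left (enorm_le_iff_norm_le.2 h) _
  refine max_le_max (essSup_mono_ae ?_) (essSup_mono_ae ?_)
  · filter_upwards [h₁] with x hx
    refine lintegral_mono_ae ?_
    filter_upwards [hx] with y hy using key _ _ _ hy
  · filter_upwards [h₂] with x hx
    refine lintegral_mono_ae ?_
    filter_upwards [hx] with y hy using key _ _ _ hy

theorem kernelNorm_swap (hm : IsAdmissibleWeight m) (K : X → X → ℂ) :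
    kernelNorm μ m (fun x y => K y x) = kernelNorm μ m K := by
  unfold kernelNorm
  rw [max_comm]
  simp only [hm.symm]

theorem kernelNorm_const_mul (c : ℂ) (K : X → X → ℂ) :
    kernelNorm μ m (fun x y => c * K x y) ≤ ‖c‖ₑ * kernelNorm μ m K := by
  unfold kernelNorm
  have h : ∀ x y, ‖c * K x y * (m x y : ℂ)‖ₑ = ‖c‖ₑ * ‖K x y * (m x y : ℂ)‖ₑ := fun x y => by
    rw [mul_assoc, enorm_mul]
  simp only [h, lintegral_const_mul' _ _ enorm_ne_top, ENNReal.essSup_const_mul]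
  exact max_le (mul_le_mul_right (le_max_left _ _) _) (mul_le_mul_right (le_max_right _ _) _)

theorem essSup_lintegral_add_le [SFinite μ] (hm : IsAdmissibleWeight m)
    (hK : AEStronglyMeasurable (Function.uncurry K) (μ.prod μ)) :
    essSup (fun x => ∫⁻ y, ‖(K x y + L x y) * (m x y : ℂ)‖ₑ ∂μ) μ
      ≤ essSup (fun x => ∫⁻ y, ‖K x y * (m x y : ℂ)‖ₑ ∂μ) μ
        + essSup (fun x => ∫⁻ y, ‖L x y * (m x y : ℂ)‖ₑ ∂μ) μ := by
  refine (essSup_mono_ae ?_).trans (ENNReal.essSup_add_le _ _)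
  filter_upwards [hK.prodMk_left] with x hx
  have hmx : Measurable fun y => (m x y : ℂ) :=
    Complex.measurable_ofReal.comp (hm.measurable.comp measurable_prodMk_left)
  have h1 : AEMeasurable (fun y => ‖K x y * (m x y : ℂ)‖ₑ) μ :=
    (hx.aemeasurable.mul hmx.aemeasurable).enorm
  rw [Pi.add_apply, ← lintegral_add_left' h1]
  refine lintegral_mono fun y => ?_
  rw [add_mul]
  exact enorm_add_le _ _

theorem kernelNorm_add_le [SFinite μ] (hm : IsAdmissibleWeight m)
    (hK : AEStronglyMeasurable (Function.uncurry K) (μ.prod μ)) :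
    kernelNorm μ m (fun x y => K x y + L x y) ≤ kernelNorm μ m K + kernelNorm μ m L := by
  have a1 := essSup_lintegral_add_le (L := L) hm hK
  have a2 := essSup_lintegral_add_le (K := fun x y => K y x) (L := fun x y => L y x) hm
    hK.prod_swap
  have e : ∀ N : X → X → ℂ, essSup (fun x => ∫⁻ y, ‖N y x * (m x y : ℂ)‖ₑ ∂μ) μ
      = essSup (fun y => ∫⁻ x, ‖N x y * (m x y : ℂ)‖ₑ ∂μ) μ := fun N => by
    congr 1; ext x
    refine lintegral_congr fun y => ?_
    rw [hm.symm x y]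
  rw [e K, e L, e fun x y => K x y + L x y] at a2
  exact max_le (a1.trans (add_le_add (le_max_left _ _) (le_max_left _ _)))
    (a2.trans (add_le_add (le_max_right _ _) (le_max_right _ _)))

theorem ae_lintegral_le_kernelNorm (K : X → X → ℂ) :
    ∀ᵐ y ∂μ, ∫⁻ x, ‖K x y * (m x y : ℂ)‖ₑ ∂μ ≤ kernelNorm μ m K := by
  have : ∀ᵐ y ∂μ, ∫⁻ x, ‖K x y * (m x y : ℂ)‖ₑ ∂μ
      ≤ essSup (fun y => ∫⁻ x, ‖K x y * (m x y : ℂ)‖ₑ ∂μ) μ := ENNReal.ae_le_essSup _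
  filter_upwards [this] with y hy using hy.trans (le_max_right _ _)

namespace MemKernelAlgebra

theorem add [SFinite μ] (hm : IsAdmissibleWeight m) (hK : MemKernelAlgebra μ m K)
    (hL : MemKernelAlgebra μ m L) : MemKernelAlgebra μ m (fun x y => K x y + L x y) :=
  ⟨hK.1.add hL.1, (kernelNorm_add_le hm hK.1).trans_lt (ENNReal.add_lt_top.2 ⟨hK.2, hL.2⟩)⟩

theorem const_mul (c : ℂ) (hK : MemKernelAlgebra μ m K) :
    MemKernelAlgebra μ m (fun x y => c * K x y) :=
  ⟨hK.1.const_mul c, (kernelNorm_const_mul c K).trans_lt (ENNReal.mul_lt_top enorm_lt_top hK.2)⟩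

theorem mono (hK : AEStronglyMeasurable (Function.uncurry K) (μ.prod μ))
    (hL : MemKernelAlgebra μ m L) (h₁ : ∀ᵐ x ∂μ, ∀ᵐ y ∂μ, ‖K x y‖ ≤ ‖L x y‖)
    (h₂ : ∀ᵐ y ∂μ, ∀ᵐ x ∂μ, ‖K x y‖ ≤ ‖L x y‖) : MemKernelAlgebra μ m K :=
  ⟨hK, (kernelNorm_mono h₁ h₂).trans_lt hL.2⟩

theorem norm (hK : MemKernelAlgebra μ m K) :
    MemKernelAlgebra μ m (fun x y => (‖K x y‖ : ℂ)) :=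
  mono (Complex.continuous_ofReal.comp_aestronglyMeasurable hK.1.norm) hK
    (ae_of_all _ fun x => ae_of_all _ fun y => by simp)
    (ae_of_all _ fun x => ae_of_all _ fun y => by simp)

theorem swap [SFinite μ] (hm : IsAdmissibleWeight m) (hK : MemKernelAlgebra μ m K) :
    MemKernelAlgebra μ m (fun x y => K y x) :=
  ⟨hK.1.prod_swap, by rw [kernelNorm_swap hm]; exact hK.2⟩

end MemKernelAlgebra

end KernelAlgebra

/-! ### Oscillation estimates, and membership of the frame vectors in H¹_v. -/

section Oscillation

variable {X : Type u} {H : Type v} [NormedAddCommGroup H] [InnerProductSpace ℂ H]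
  {I : Type w} {U : I → Set X}

theorem mem_coverNhd {i : I} {y w : X} (hy : y ∈ U i) (hw : w ∈ U i) : w ∈ coverNhd U y :=
  mem_iUnion₂.2 ⟨i, hy, hw⟩

theorem osc_nonneg {A : ℝ} (hA : 0 < A) (ψ : X → H) (U : I → Set X) (Γ : X → X → ℂ) (x y : X) :
    0 ≤ osc A ψ U Γ x y :=
  mul_nonneg (inv_nonneg.2 hA.le) (Real.iSup_nonneg fun _ => norm_nonneg _)

variable [TopologicalSpace X]

theorem IsAdmissibleCovering.finite_mem [MeasurableSpace X] (hU : IsAdmissibleCovering U) (y : X) :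
    {i | y ∈ U i}.Finite := by
  obtain ⟨N, hN⟩ := hU.overlap
  have hy : y ∈ ⋃ i, U i := hU.covers ▸ mem_univ y
  obtain ⟨i, hi⟩ := mem_iUnion.1 hy
  have h1 : {j | (U i ∩ U j).Nonempty}.Finite :=
    finite_of_encard_le_coe (hN i)
  exact h1.subset fun j hj => ⟨y, hi, hj⟩

theorem IsAdmissibleCovering.exists_mem [MeasurableSpace X] (hU : IsAdmissibleCovering U) (y : X) :
    ∃ i, y ∈ U i := by
  have hy : y ∈ ⋃ i, U i := hU.covers ▸ mem_univ y
  exact mem_iUnion.1 hy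

variable [MeasurableSpace X] {μ : Measure X} {A : ℝ} {ψ : X → H} {Γ : X → X → ℂ}

/-- Q_y lies in a finite union of compact closures, on which z ↦ ⟨ψ_z, ψ_x⟩ is continuous. Without
boundedness the real supremum in `osc` would default to 0 and dominate nothing. -/
theorem bddAbove_osc (hψ : IsContinuousTightFrame μ A ψ) (hU : IsAdmissibleCovering U)
    (hΓ : ∀ x y, ‖Γ x y‖ = 1) (x y : X) :
    BddAbove (range fun z : coverNhd U y => ‖transform ψ (ψ y - Γ y z • ψ z) x‖) := by
  have hc : IsCompact (⋃ i ∈ {i | y ∈ U i}, closure (U i)) :=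
    (hU.finite_mem y).isCompact_biUnion fun i _ => hU.relativelyCompact i
  obtain ⟨B, hB⟩ := hc.exists_bound_of_continuousOn (hψ.weaklyContinuous (ψ x)).continuousOn
  refine ⟨‖transform ψ (ψ y) x‖ + B, ?_⟩
  rintro _ ⟨⟨z, hz⟩, rfl⟩
  obtain ⟨i, hi, hzi⟩ := mem_iUnion₂.1 hz
  have h1 := hB z (mem_iUnion₂.2 ⟨i, hi, subset_closure hzi⟩)
  have h2 : ‖transform ψ (ψ z) x‖ = ‖transform ψ (ψ x) z‖ := norm_inner_symm _ _
  have h3 : transform ψ (ψ y - Γ y z • ψ z) x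
      = transform ψ (ψ y) x - Γ y z * transform ψ (ψ z) x := by
    simp [transform]
  simp only [h3]
  refine (norm_sub_le _ _).trans ?_
  rw [norm_mul, hΓ, one_mul, h2]
  linarith

theorem norm_sub_le_osc (hψ : IsContinuousTightFrame μ A ψ) (hU : IsAdmissibleCovering U)
    (hΓ : ∀ x y, ‖Γ x y‖ = 1) (x : X) {y w : X} (hw : w ∈ coverNhd U y) :
    ‖frameKernel A ψ x y - Γ y w * frameKernel A ψ x w‖ ≤ osc A ψ U Γ x y := by
  have h3 : frameKernel A ψ x y - Γ y w * frameKernel A ψ x w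
      = (A : ℂ)⁻¹ * transform ψ (ψ y - Γ y w • ψ w) x := by
    simp only [frameKernel, transform, inner_sub_right, inner_smul_right]
    ring
  have hA := hψ.bound_pos
  rw [h3, norm_mul, norm_inv, Complex.norm_real, Real.norm_of_nonneg hA.le, osc]
  exact mul_le_mul_of_nonneg_left
    (le_ciSup (bddAbove_osc hψ hU hΓ x y) (⟨w, hw⟩ : coverNhd U y)) (inv_nonneg.2 hA.le)

/-- The phase has modulus 1 and disappears from absolute values. The estimate transfers control of
the kernel from one point of U_i to any other; the gain is that y may be averaged over U_i while w
stays fixed. -/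
theorem norm_frameKernel_le (hψ : IsContinuousTightFrame μ A ψ) (hU : IsAdmissibleCovering U)
    (hΓ : ∀ x y, ‖Γ x y‖ = 1) (x : X) {i : I} {y w : X} (hy : y ∈ U i) (hw : w ∈ U i) :
    ‖frameKernel A ψ x w‖ ≤ ‖frameKernel A ψ x y‖ + osc A ψ U Γ x y := by
  have h1 := norm_sub_le_osc hψ hU hΓ x (mem_coverNhd hy hw)
  have h2 : ‖frameKernel A ψ x w‖ = ‖Γ y w * frameKernel A ψ x w‖ := by
    rw [norm_mul, hΓ, one_mul]
  have h3 := norm_sub_norm_le (Γ y w * frameKernel A ψ x w) (frameKernel A ψ x y)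
  rw [norm_sub_rev] at h3
  linarith

theorem IsModerateAdmissibleCovering.measure_ne_zero (hU : IsModerateAdmissibleCovering μ U)
    (i : I) : μ (U i) ≠ 0 := by
  obtain ⟨D, hD, h⟩ := hU.lower
  exact ((ENNReal.ofReal_pos.2 hD).trans_le (h i)).ne'

variable [BorelSpace X] [CompleteSpace H] [TopologicalSpace.SeparableSpace H]
  {m : X → X → ℝ} {z : X} {C : ℝ}

/-- Membership in A_m bounds the column integrals at almost every w only. Any x in U_i has such a w
in the same U_i, since μ(U_i) > 0. The oscillation compares R(·,x) with R(·,w), and m(y,z) ≤ m(y,w)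
C m(x,z) compares the weights. So the bound holds at every x. -/
theorem exists_H1norm_frame_le (hψ : IsContinuousTightFrame μ A ψ) (hm : IsAdmissibleWeight m)
    (z : X) (hK : MemKernelAlgebra μ m (frameKernel A ψ)) (hΓ : ∀ x y, ‖Γ x y‖ = 1)
    (hU : IsModerateAdmissibleCovering μ U)
    (hC : ∀ i, ∀ x ∈ U i, ∀ y ∈ U i, m x y ≤ C)
    (hosc : MemKernelAlgebra μ m (fun x y => (osc A ψ U Γ x y : ℂ))) :
    ∃ c : ℝ, 0 ≤ c ∧ ∀ x, ψ x ∈ H1 μ ψ (fun x => m x z) ∧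
      H1norm μ ψ (fun x => m x z) (ψ x) ≤ c * m x z := by
  set k := kernelNorm μ m (frameKernel A ψ) + kernelNorm μ m (fun x y => (osc A ψ U Γ x y : ℂ))
    with hk
  have hkt : k < ∞ := ENNReal.add_lt_top.2 ⟨hK.2, hosc.2⟩
  have hz : Measurable fun y => m y z := hm.measurable.comp (measurable_id.prodMk measurable_const)
  have key : ∀ x, ∫⁻ y, ‖transform ψ (ψ x) y * (m y z : ℂ)‖ₑ ∂μ
      ≤ ENNReal.ofReal (A * |C| * m x z) * k := by
    intro x
    obtain ⟨i, hi⟩ := hU.exists_mem x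
    obtain ⟨w, hw, h1, h2⟩ := Measure.exists_mem_of_measure_ne_zero_of_ae (hU.measure_ne_zero i)
      (ae_restrict_of_ae ((ae_lintegral_le_kernelNorm (m := m) _).and (ae_lintegral_le_kernelNorm (m := m) _)))
    have hmw : Measurable fun y => m y w :=
      hm.measurable.comp (measurable_id.prodMk measurable_const)
    have hmeas : Measurable fun y => ‖frameKernel A ψ y w * (m y w : ℂ)‖ₑ := by
      have e1 : Measurable fun y => frameKernel A ψ y w :=
        hψ.stronglyMeasurable_frameKernel.measurable.comp (measurable_id.prodMk measurable_const)
      exact (e1.mul (Complex.measurable_ofReal.comp hmw)).enorm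
    have pt : ∀ y, ‖transform ψ (ψ x) y * (m y z : ℂ)‖ₑ ≤ ENNReal.ofReal (A * |C| * m x z) *
        (‖frameKernel A ψ y w * (m y w : ℂ)‖ₑ + ‖(osc A ψ U Γ y w : ℂ) * (m y w : ℂ)‖ₑ) := by
      intro y
      have b1 : ‖transform ψ (ψ x) y‖ ≤ A * (‖frameKernel A ψ y w‖ + osc A ψ U Γ y w) := by
        rw [transform_eq_frameKernel hψ.bound_pos, norm_mul, Complex.norm_real,
          Real.norm_of_nonneg hψ.bound_pos.le]
        exact mul_le_mul_of_nonneg_left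
          (norm_frameKernel_le hψ hU.toIsAdmissibleCovering hΓ y hw hi) hψ.bound_pos.le
      have b2 : m y z ≤ m y w * (|C| * m x z) := by
        refine (hm.le_mul y z w).trans (mul_le_mul_of_nonneg_left ?_ (hm.pos y w).le)
        refine (hm.le_mul w z x).trans (mul_le_mul_of_nonneg_right ?_ (hm.pos x z).le)
        exact (hC i w hw x hi).trans (le_abs_self C)
      have o := osc_nonneg hψ.bound_pos ψ U Γ y w
      have hA := hψ.bound_pos
      have p1 := hm.pos y w
      have p2 := hm.pos x z
      rw [← ofReal_norm, ← ofReal_norm, ← ofReal_norm, ← ENNReal.ofReal_add (norm_nonneg _)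
        (norm_nonneg _), ← ENNReal.ofReal_mul (by positivity)]
      refine ENNReal.ofReal_le_ofReal ?_
      rw [norm_mul, norm_mul, norm_mul, Complex.norm_real, Complex.norm_real, Complex.norm_real,
        Real.norm_of_nonneg o, Real.norm_of_nonneg p1.le, Real.norm_of_nonneg (hm.pos y z).le]
      calc _ ≤ (A * (‖frameKernel A ψ y w‖ + osc A ψ U Γ y w)) * (m y w * (|C| * m x z)) :=
            mul_le_mul b1 b2 (hm.pos y z).le (by positivity)
        _ = _ := by ring
    refine (lintegral_mono pt).trans ?_
    rw [lintegral_const_mul' _ _ ENNReal.ofReal_ne_top, lintegral_add_left hmeas]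
    exact mul_le_mul_right (add_le_add h1 h2) _
  refine ⟨A * |C| * k.toReal, mul_nonneg (mul_nonneg hψ.bound_pos.le (abs_nonneg _))
    ENNReal.toReal_nonneg, fun x => ?_⟩
  have hmeas : StronglyMeasurable fun y => transform ψ (ψ x) y * (m y z : ℂ) :=
    (hψ.stronglyMeasurable_transform _).mul (Complex.measurable_ofReal.comp hz).stronglyMeasurable
  refine ⟨⟨hmeas.aestronglyMeasurable, (key x).trans_lt
    (ENNReal.mul_lt_top ENNReal.ofReal_lt_top hkt)⟩, ?_⟩
  have e : ∀ y, ‖transform ψ (ψ x) y‖ * m y z = ‖transform ψ (ψ x) y * (m y z : ℂ)‖ := fun y => by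
    rw [norm_mul, Complex.norm_real, Real.norm_of_nonneg (hm.pos y z).le]
  simp only [H1norm, e]
  rw [integral_norm_eq_lintegral_enorm hmeas.aestronglyMeasurable]
  refine (ENNReal.toReal_mono (ENNReal.mul_lt_top ENNReal.ofReal_lt_top hkt).ne (key x)).trans ?_
  rw [ENNReal.toReal_mul, ENNReal.toReal_ofReal (mul_nonneg (mul_nonneg hψ.bound_pos.le
    (abs_nonneg _)) (hm.pos x z).le)]
  exact le_of_eq (by ring)

end Oscillation

/-! ### Solid function spaces and the operators that kernels induce on them. -/

section Solid

variable {X : Type u} [TopologicalSpace X] [MeasurableSpace X] {μ : Measure X}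

namespace SolidBanachSpace

variable (Y : SolidBanachSpace.{u, w} μ)

theorem ext_of_ae {F G : Y.carrier} (h : Y.emb F =ᵐ[μ] Y.emb G) : F = G :=
  Y.emb_injective (AEEqFun.ext h)

theorem emb_add_ae (F G : Y.carrier) :
    Y.emb (F + G) =ᵐ[μ] fun x => Y.emb F x + Y.emb G x := by
  rw [map_add]; exact AEEqFun.coeFn_add _ _

theorem emb_sub_ae (F G : Y.carrier) :
    Y.emb (F - G) =ᵐ[μ] fun x => Y.emb F x - Y.emb G x := by
  rw [map_sub]; exact AEEqFun.coeFn_sub _ _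

theorem emb_smul_ae (c : ℂ) (F : Y.carrier) :
    Y.emb (c • F) =ᵐ[μ] fun x => c * Y.emb F x := by
  rw [map_smul]; exact AEEqFun.coeFn_smul _ _

theorem emb_zero_ae : Y.emb 0 =ᵐ[μ] fun _ => 0 := by
  rw [map_zero]; exact AEEqFun.coeFn_zero

theorem exists_of_ae_le [OpensMeasurableSpace X] {G : X → ℂ} (hG : AEStronglyMeasurable G μ)
    (F : Y.carrier) (h : ∀ᵐ x ∂μ, ‖G x‖ ≤ ‖Y.emb F x‖) :
    ∃ G' : Y.carrier, Y.emb G' =ᵐ[μ] G ∧ ‖G'‖ ≤ ‖F‖ := by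
  have h1 := AEEqFun.coeFn_mk G hG
  have h2 : ∀ᵐ x ∂μ, ‖AEEqFun.mk G hG x‖ ≤ ‖Y.emb F x‖ := by
    filter_upwards [h, h1] with x hx hx1
    rwa [hx1]
  obtain ⟨G', hG', hn⟩ := Y.solid (AEEqFun.mk G hG) F
    ((Y.locallyIntegrable F).mono (AEEqFun.aestronglyMeasurable _) h2) h2
  exact ⟨G', by rw [hG']; exact h1, hn⟩

theorem norm_le_of_ae_le [OpensMeasurableSpace X] {F G : Y.carrier}
    (h : ∀ᵐ x ∂μ, ‖Y.emb F x‖ ≤ ‖Y.emb G x‖) : ‖F‖ ≤ ‖G‖ := by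
  obtain ⟨G', h1, h2⟩ := Y.exists_of_ae_le (Y.emb F).aestronglyMeasurable G h
  rwa [Y.ext_of_ae h1] at h2

/-- The absolute value of an element of `Y`. -/
theorem exists_abs [OpensMeasurableSpace X] (F : Y.carrier) :
    ∃ G : Y.carrier, (Y.emb G =ᵐ[μ] fun x => (‖Y.emb F x‖ : ℂ)) ∧ ‖G‖ = ‖F‖ := by
  obtain ⟨G, h1, h2⟩ := Y.exists_of_ae_le (G := fun x => (‖Y.emb F x‖ : ℂ))
    (Complex.continuous_ofReal.comp_aestronglyMeasurable
      (Y.emb F).aestronglyMeasurable.norm) F (ae_of_all _ fun x => by simp)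
  refine ⟨G, h1, le_antisymm h2 (Y.norm_le_of_ae_le ?_)⟩
  filter_upwards [h1] with x hx
  rw [hx]; simp

/-- Closed conditions on the values pass to limits in `Y`. -/
theorem ae_mem_of_tendsto [SigmaCompactSpace X] {F : ℕ → Y.carrier}
    {G : Y.carrier} (h : Tendsto F atTop (𝓝 G)) {S : X → Set ℂ} (hS : ∀ x, IsClosed (S x))
    (hF : ∀ᶠ n in atTop, ∀ᵐ x ∂μ, Y.emb (F n) x ∈ S x) : ∀ᵐ x ∂μ, Y.emb G x ∈ S x := by
  -- On a compact set, convergence in Y is convergence in L¹, so a subsequence converges almost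
  -- everywhere and a closed condition survives. A countable exhaustion by compact sets covers X.
  have key : ∀ k : ℕ, ∀ᵐ x ∂μ.restrict (compactCovering X k), Y.emb G x ∈ S x := by
    intro k
    have hc := isCompact_compactCovering X k
    obtain ⟨C, hC⟩ := Y.continuous_emb _ hc
    have hlim : Tendsto (fun n => eLpNorm (fun x => Y.emb (F n) x - Y.emb G x) 1
        (μ.restrict (compactCovering X k))) atTop (𝓝 0) := by
      have h1 : ∀ n, eLpNorm (fun x => Y.emb (F n) x - Y.emb G x) 1
          (μ.restrict (compactCovering X k)) ≤ ENNReal.ofReal (C * ‖F n - G‖) := fun n => by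
        have e : eLpNorm (fun x => Y.emb (F n) x - Y.emb G x) 1
            (μ.restrict (compactCovering X k))
            = eLpNorm (Y.emb (F n - G)) 1 (μ.restrict (compactCovering X k)) :=
          eLpNorm_congr_ae (ae_restrict_of_ae (Y.emb_sub_ae (F n) G).symm)
        rw [e, eLpNorm_one_eq_lintegral_enorm,
          ← ofReal_integral_norm_eq_lintegral_enorm
            ((Y.locallyIntegrable (F n - G)).integrableOn_isCompact hc)]
        exact ENNReal.ofReal_le_ofReal (hC _)
      have h2 : Tendsto (fun n => ENNReal.ofReal (C * ‖F n - G‖)) atTop (𝓝 0) := by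
        have := ((tendsto_iff_norm_sub_tendsto_zero.1 h).const_mul C)
        rw [mul_zero] at this
        simpa using ENNReal.tendsto_ofReal this
      exact tendsto_of_tendsto_of_tendsto_of_le_of_le tendsto_const_nhds h2
        (fun _ => zero_le) h1
    have hmeas : TendstoInMeasure (μ.restrict (compactCovering X k))
        (fun n => (Y.emb (F n) : X → ℂ)) atTop (Y.emb G) :=
      tendstoInMeasure_of_tendsto_eLpNorm one_ne_zero
        (fun n => (Y.emb (F n)).aestronglyMeasurable.restrict)
        (Y.emb G).aestronglyMeasurable.restrict hlim
    obtain ⟨ns, hns, hae⟩ := hmeas.exists_seq_tendsto_ae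
    have hF' : ∀ᶠ n in atTop, ∀ᵐ x ∂μ.restrict (compactCovering X k), Y.emb (F (ns n)) x ∈ S x :=
      (hns.tendsto_atTop.eventually hF).mono fun n hn => ae_restrict_of_ae hn
    obtain ⟨N, hN⟩ := eventually_atTop.1 hF'
    have hall : ∀ᵐ x ∂μ.restrict (compactCovering X k), ∀ n, N ≤ n → Y.emb (F (ns n)) x ∈ S x :=
      ae_all_iff.2 fun n => by
        by_cases hn : N ≤ n
        · filter_upwards [hN n hn] with x hx _ using hx
        · exact ae_of_all _ fun x h => absurd h hn
    filter_upwards [hae, hall] with x h1 h2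
    exact (hS x).mem_of_tendsto h1 (eventually_atTop.2 ⟨N, h2⟩)
  have := (ae_restrict_iUnion_iff (μ := μ) (compactCovering X) fun x => Y.emb G x ∈ S x).2 key
  rwa [iUnion_compactCovering, Measure.restrict_univ] at this

end SolidBanachSpace

namespace SolidBanachSpace.IsKernelModule

variable {Y : SolidBanachSpace.{u, w} μ} {m : X → X → ℝ}

/-- The bounded operator on `Y` defined by a kernel in `A_m`. -/
noncomputable def op (hY : Y.IsKernelModule m) (K : X → X → ℂ) (hK : MemKernelAlgebra μ m K) :
    Y.carrier →L[ℂ] Y.carrier :=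
  LinearMap.mkContinuous
    { toFun := fun F => (hY K hK F).choose
      map_add' := fun F G => by
        apply Y.ext_of_ae
        obtain ⟨-, h1, -⟩ := (hY K hK (F + G)).choose_spec
        obtain ⟨i2, h2, -⟩ := (hY K hK F).choose_spec
        obtain ⟨i3, h3, -⟩ := (hY K hK G).choose_spec
        refine h1.trans (EventuallyEq.trans ?_ (Y.emb_add_ae _ _).symm)
        filter_upwards [h2, h3, i2, i3] with x e2 e3 j2 j3
        rw [e2, e3, kernelApply, kernelApply, kernelApply, ← integral_add j2 j3]
        refine integral_congr_ae ?_
        filter_upwards [Y.emb_add_ae F G] with y hy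
        rw [hy, mul_add]
      map_smul' := fun c F => by
        apply Y.ext_of_ae
        obtain ⟨-, h1, -⟩ := (hY K hK (c • F)).choose_spec
        obtain ⟨-, h2, -⟩ := (hY K hK F).choose_spec
        refine h1.trans (EventuallyEq.trans ?_ (Y.emb_smul_ae _ _).symm)
        filter_upwards [h2] with x e2
        rw [e2, kernelApply, kernelApply, RingHom.id_apply, ← integral_const_mul]
        refine integral_congr_ae ?_
        filter_upwards [Y.emb_smul_ae c F] with y hy
        rw [hy]; ring }
    (kernelNorm μ m K).toReal fun F => (hY K hK F).choose_spec.2.2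

variable {K : X → X → ℂ}

theorem ae_integrable (hY : Y.IsKernelModule m) (hK : MemKernelAlgebra μ m K)
    (F : Y.carrier) :
    ∀ᵐ x ∂μ, Integrable (fun y => K x y * Y.emb F y) μ :=
  (hY K hK F).choose_spec.1

theorem emb_op_ae (hY : Y.IsKernelModule m) (hK : MemKernelAlgebra μ m K)
    (F : Y.carrier) : Y.emb (hY.op K hK F) =ᵐ[μ] kernelApply μ K (Y.emb F) :=
  (hY K hK F).choose_spec.2.1

theorem norm_op_le (hY : Y.IsKernelModule m) (hK : MemKernelAlgebra μ m K)
    (F : Y.carrier) : ‖hY.op K hK F‖ ≤ (kernelNorm μ m K).toReal * ‖F‖ :=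
  (hY K hK F).choose_spec.2.2

end SolidBanachSpace.IsKernelModule

end Solid

/-! ### The anti-dual of H¹_v and its reproducing formula. -/

section Antidual

variable {X : Type u} {H : Type v} [NormedAddCommGroup H] [InnerProductSpace ℂ H]
  [MeasurableSpace X] {μ : Measure X} {A : ℝ} {ψ : X → H}

theorem H1.integrable {v : X → ℝ} (h : H1 μ ψ v) :
    Integrable (fun x => transform ψ h x * (v x : ℂ)) μ := h.2

/-- The embedding of `H¹_v` into `L¹`. -/
noncomputable def H1.toL1 (μ : Measure X) (ψ : X → H) (v : X → ℝ) :
    H1 μ ψ v →ₗ[ℂ] Lp ℂ 1 μ where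
  toFun h := (H1.integrable h).toL1 _
  map_add' f g := by
    rw [← Integrable.toL1_add, Integrable.toL1_eq_toL1_iff]
    exact ae_of_all _ fun x => by simp [transform_add, add_mul]
  map_smul' c f := by
    rw [RingHom.id_apply, ← Integrable.toL1_smul', Integrable.toL1_eq_toL1_iff]
    exact ae_of_all _ fun x => by simp [transform_smul, mul_assoc]

theorem H1.norm_toL1 {v : X → ℝ} (hv : ∀ x, 0 ≤ v x) (h : H1 μ ψ v) :
    ‖H1.toL1 μ ψ v h‖ = H1norm μ ψ v h := by
  rw [L1.norm_eq_integral_norm, H1norm]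
  refine integral_congr_ae ?_
  filter_upwards [Integrable.coeFn_toL1 (H1.integrable h)] with x hx
  change ‖Integrable.toL1 _ (H1.integrable h) x‖ = _
  rw [hx, norm_mul, Complex.norm_real, Real.norm_of_nonneg (hv x)]

theorem extTransform_eq {v : X → ℝ} (f : antidual μ ψ v) {x : X} (hx : ψ x ∈ H1 μ ψ v) :
    extTransform μ ψ v f x = f.1 ⟨ψ x, hx⟩ := by
  unfold extTransform
  rw [dif_pos hx]

theorem H1.integrable_norm_mul {v : X → ℝ} (hv : ∀ x, 0 ≤ v x) (h : H1 μ ψ v) :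
    Integrable (fun x => ‖transform ψ h x‖ * v x) μ := by
  refine (H1.integrable h).norm.congr (ae_of_all _ fun x => ?_)
  simp only [norm_mul, Complex.norm_real, Real.norm_of_nonneg (hv x)]

theorem H1.norm_integral_conj_mul_le {v : X → ℝ}
    (hv : ∀ x, 0 ≤ v x) (h : H1 μ ψ v) {G : X → ℂ} {c : ℝ}
    (hc : ∀ᵐ x ∂μ, ‖G x‖ ≤ c * v x) :
    ‖∫ x, conj (transform ψ h x) * G x ∂μ‖ ≤ c * H1norm μ ψ v h := by
  rw [H1norm, ← integral_const_mul]
  refine norm_integral_le_of_norm_le ((H1.integrable_norm_mul hv h).const_mul c) ?_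
  filter_upwards [hc] with x hx
  rw [norm_mul, RCLike.norm_conj]
  nlinarith [norm_nonneg (transform ψ h x), hx]

theorem exists_norm_extTransform_le {v : X → ℝ} {c : ℝ}
    (hH : ∀ x, ψ x ∈ H1 μ ψ v ∧ H1norm μ ψ v (ψ x) ≤ c * v x) (hv : ∀ x, 0 ≤ v x)
    (f : antidual μ ψ v) : ∃ d : ℝ, 0 ≤ d ∧ ∀ x, ‖extTransform μ ψ v f x‖ ≤ d * v x := by
  obtain ⟨C, hC⟩ := f.2
  refine ⟨|C| * |c|, by positivity, fun x => ?_⟩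
  rw [extTransform_eq f (hH x).1]
  have h0 : 0 ≤ H1norm μ ψ v (ψ x) :=
    integral_nonneg fun y => mul_nonneg (norm_nonneg _) (hv y)
  calc _ ≤ C * H1norm μ ψ v (ψ x) := hC ⟨ψ x, (hH x).1⟩
    _ ≤ |C| * (|c| * v x) := mul_le_mul (le_abs_self C)
        ((hH x).2.trans (mul_le_mul_of_nonneg_right (le_abs_self c) (hv x))) h0 (abs_nonneg C)
    _ = _ := by ring

variable [TopologicalSpace X]

theorem integral_conj_transform_frame (hψ : IsContinuousTightFrame μ A ψ) (G : X → ℂ) (x : X) :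
    ∫ y, conj (transform ψ (ψ x) y) * G y ∂μ = A * kernelApply μ (frameKernel A ψ) G x := by
  simp only [conj_transform_frame hψ.bound_pos, mul_assoc, kernelApply]
  rw [integral_const_mul]

variable [BorelSpace X]

theorem H1.toL1_injective (hψ : IsContinuousTightFrame μ A ψ) {v : X → ℝ} (hv : ∀ x, 0 < v x) :
    Function.Injective (H1.toL1 μ ψ v) := by
  rw [← LinearMap.ker_eq_bot, LinearMap.ker_eq_bot']
  intro h hh
  have h1 := Integrable.coeFn_toL1 (H1.integrable h)
  have h2 : (Integrable.toL1 _ (H1.integrable h) : Lp ℂ 1 μ) = 0 := hh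
  rw [h2] at h1
  apply Subtype.ext
  refine hψ.eq_zero_of_transform_ae_eq_zero ?_
  filter_upwards [h1, Lp.coeFn_zero ℂ 1 μ] with x e1 e2
  rw [e2] at e1
  have h3 : (v x : ℂ) ≠ 0 := by exact_mod_cast (hv x).ne'
  exact (mul_eq_zero.1 e1.symm).resolve_right h3

/-- Elements of the anti-dual are represented by functions in `L^∞_{1/v}`. -/
theorem antidual_exists_repr [SigmaFinite μ] (hψ : IsContinuousTightFrame μ A ψ) {v : X → ℝ}
    (hv : ∀ x, 0 < v x) (hvm : Measurable v) (f : antidual μ ψ v) :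
    ∃ G : X → ℂ, StronglyMeasurable G ∧ (∃ c : ℝ, 0 ≤ c ∧ ∀ᵐ x ∂μ, ‖G x‖ ≤ c * v x) ∧
      ∀ h : H1 μ ψ v, f.1 h = ∫ x, conj (transform ψ h x) * G x ∂μ := by
  obtain ⟨C, hC⟩ := f.2
  let J := H1.toL1 μ ψ v
  have hJ : Function.Injective J := H1.toL1_injective hψ hv
  let e := LinearEquiv.ofInjective J hJ
  -- Conjugation gives a linear functional, which is transported to the image of H¹_v in L¹ and
  -- extended to L¹ by Hahn–Banach.
  let fc : H1 μ ψ v →ₗ[ℂ] ℂ :=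
    { toFun := fun h => conj (f.1 h)
      map_add' := fun a b => by simp
      map_smul' := fun c a => by simp }
  let g : LinearMap.range J →L[ℂ] ℂ := LinearMap.mkContinuous (fc.comp e.symm.toLinearMap) C
    fun q => by
      have h1 : ‖fc (e.symm q)‖ ≤ C * H1norm μ ψ v (e.symm q) := by
        change ‖conj (f.1 (e.symm q))‖ ≤ _
        rw [RCLike.norm_conj]
        exact hC _
      have h2 : ‖J (e.symm q)‖ = H1norm μ ψ v (e.symm q) := H1.norm_toL1 (fun x => (hv x).le) _
      have h3 : J (e.symm q) = q := congrArg Subtype.val (e.apply_symm_apply q)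
      rw [← h2, h3] at h1
      exact h1
  obtain ⟨Λ, hΛ, -⟩ := exists_extension_norm_eq (LinearMap.range J) g
  obtain ⟨b, hbm, hbb, hb⟩ := exists_bounded_repr_of_dual_L1 Λ
  have hvc : StronglyMeasurable fun x => (v x : ℂ) :=
    (Complex.measurable_ofReal.comp hvm).stronglyMeasurable
  refine ⟨fun x => (v x : ℂ) * conj (b x),
    hvc.mul (Complex.continuous_conj.comp_stronglyMeasurable hbm),
    ⟨‖Λ‖, norm_nonneg _, ?_⟩, fun h => ?_⟩
  · filter_upwards [hbb] with x hx
    rw [norm_mul, RCLike.norm_conj, Complex.norm_real, Real.norm_of_nonneg (hv x).le, mul_comm]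
    exact mul_le_mul_of_nonneg_right hx (hv x).le
  · have h1 : Λ (J h) = conj (f.1 h) := by
      have : (e h : Lp ℂ 1 μ) = J h := rfl
      rw [← this, hΛ]
      change fc (e.symm (e h)) = _
      rw [e.symm_apply_apply]
      rfl
    have h2 := hb _ (H1.integrable h)
    have h3 : conj (Λ (J h)) = f.1 h := by rw [h1, Complex.conj_conj]
    rw [← h3]
    change conj (Λ (Integrable.toL1 _ (H1.integrable h))) = _
    rw [h2, ← integral_conj]
    refine integral_congr_ae (ae_of_all _ fun x => ?_)
    simp only [map_mul, Complex.conj_ofReal]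
    ring

theorem H1.integrable_conj_mul (hψ : IsContinuousTightFrame μ A ψ) {v : X → ℝ}
    (hv : ∀ x, 0 ≤ v x) (h : H1 μ ψ v) {G : X → ℂ} (hG : AEStronglyMeasurable G μ) {c : ℝ}
    (hc : ∀ᵐ x ∂μ, ‖G x‖ ≤ c * v x) :
    Integrable (fun x => conj (transform ψ h x) * G x) μ := by
  refine ((H1.integrable_norm_mul hv h).const_mul c).mono'
    ((Complex.continuous_conj.comp_aestronglyMeasurable
      (hψ.stronglyMeasurable_transform _).aestronglyMeasurable).mul hG) ?_
  filter_upwards [hc] with x hx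
  rw [norm_mul, RCLike.norm_conj]
  nlinarith [norm_nonneg (transform ψ h x), hx]

/-- A function in `L^∞_{1/v}` defines an element of the anti-dual. -/
theorem exists_antidual_of_bound (hψ : IsContinuousTightFrame μ A ψ) {v : X → ℝ}
    (hv : ∀ x, 0 ≤ v x) (hH : ∀ x, ψ x ∈ H1 μ ψ v) {F : X → ℂ} (hF : AEStronglyMeasurable F μ)
    {c : ℝ} (hc : ∀ᵐ x ∂μ, ‖F x‖ ≤ c * v x) :
    ∃ f : antidual μ ψ v, (∀ h, ‖f.1 h‖ ≤ A⁻¹ * c * H1norm μ ψ v h) ∧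
      ∀ x, extTransform μ ψ v f x = kernelApply μ (frameKernel A ψ) F x := by
  have hA : (A : ℂ) ≠ 0 := by exact_mod_cast hψ.bound_pos.ne'
  let f₀ : H1 μ ψ v →ₛₗ[starRingEnd ℂ] ℂ :=
    { toFun := fun h => (A : ℂ)⁻¹ * ∫ x, conj (transform ψ h x) * F x ∂μ
      map_add' := fun a b => by
        rw [← mul_add, ← integral_add (H1.integrable_conj_mul hψ hv a hF hc)
          (H1.integrable_conj_mul hψ hv b hF hc)]
        congr 1
        refine integral_congr_ae (ae_of_all _ fun x => ?_)
        simp [transform_add, add_mul]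
      map_smul' := fun k a => by
        rw [smul_eq_mul, mul_left_comm, ← integral_const_mul (conj k)]
        congr 1
        refine integral_congr_ae (ae_of_all _ fun x => ?_)
        simp [transform_smul, mul_assoc] }
  have hb : ∀ h, ‖f₀ h‖ ≤ A⁻¹ * c * H1norm μ ψ v h := fun h => by
    change ‖(A : ℂ)⁻¹ * ∫ x, conj (transform ψ h x) * F x ∂μ‖ ≤ _
    rw [norm_mul, norm_inv, Complex.norm_real, Real.norm_of_nonneg hψ.bound_pos.le, mul_assoc]
    exact mul_le_mul_of_nonneg_left (H1.norm_integral_conj_mul_le hv h hc)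
      (inv_nonneg.2 hψ.bound_pos.le)
  refine ⟨⟨f₀, _, hb⟩, hb, fun x => ?_⟩
  rw [extTransform_eq _ (hH x)]
  change (A : ℂ)⁻¹ * ∫ y, conj (transform ψ (ψ x) y) * F y ∂μ = _
  rw [integral_conj_transform_frame hψ, inv_mul_cancel_left₀ hA]

variable [CompleteSpace H] [TopologicalSpace.SeparableSpace H] [SigmaFinite μ]

theorem stronglyMeasurable_kernelApply (hψ : IsContinuousTightFrame μ A ψ) {G : X → ℂ}
    (hG : StronglyMeasurable G) : StronglyMeasurable (kernelApply μ (frameKernel A ψ) G) := by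
  have : StronglyMeasurable fun p : X × X => frameKernel A ψ p.1 p.2 * G p.2 :=
    hψ.stronglyMeasurable_frameKernel.mul (hG.comp_measurable measurable_snd)
  exact this.integral_prod_right

theorem stronglyMeasurable_extTransform (hψ : IsContinuousTightFrame μ A ψ) {v : X → ℝ}
    (hv : ∀ x, 0 < v x) (hvm : Measurable v) (hH : ∀ x, ψ x ∈ H1 μ ψ v) (f : antidual μ ψ v) :
    StronglyMeasurable (extTransform μ ψ v f) := by
  obtain ⟨G, hG, -, hf⟩ := antidual_exists_repr hψ hv hvm f
  have : extTransform μ ψ v f = fun x => A * kernelApply μ (frameKernel A ψ) G x := by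
    ext x
    rw [extTransform_eq f (hH x), hf, integral_conj_transform_frame hψ]
  rw [this]
  exact (stronglyMeasurable_kernelApply hψ hG).const_mul _

/-- This justifies Fubini in the duality formula: ∫ |R(x,y) G(y)| dy is at most A⁻¹ d times the H¹_v
norm of ψ_x, hence at most A⁻¹ d c v(x), and Vh is integrable against v. -/
theorem integrable_conj_mul_frameKernel_mul (hψ : IsContinuousTightFrame μ A ψ) {v : X → ℝ}
    (hv' : ∀ x, 0 ≤ v x) {c : ℝ}
    (hH : ∀ x, ψ x ∈ H1 μ ψ v ∧ H1norm μ ψ v (ψ x) ≤ c * v x)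
    (h : H1 μ ψ v) {G : X → ℂ} (hG : StronglyMeasurable G) {d : ℝ} (hd0 : 0 ≤ d)
    (hd : ∀ᵐ x ∂μ, ‖G x‖ ≤ d * v x) :
    Integrable (fun p : X × X => conj (transform ψ h p.1) * (frameKernel A ψ p.1 p.2 * G p.2))
      (μ.prod μ) := by
  have hA : (A : ℂ) ≠ 0 := by exact_mod_cast hψ.bound_pos.ne'
  have hin : ∀ x, Integrable (fun y => frameKernel A ψ x y * G y) μ := fun x => by
    have := (H1.integrable_conj_mul hψ hv' ⟨ψ x, (hH x).1⟩ hG.aestronglyMeasurable hd).const_mul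
      (A : ℂ)⁻¹
    refine this.congr (ae_of_all _ fun y => ?_)
    simp only [conj_transform_frame hψ.bound_pos]
    rw [mul_assoc, inv_mul_cancel_left₀ hA]
  have hbd : ∀ x, ∫ y, ‖frameKernel A ψ x y * G y‖ ∂μ ≤ A⁻¹ * (d * (c * v x)) := fun x => by
    have h1 := H1.integrable_norm_mul hv' ⟨ψ x, (hH x).1⟩
    have h2 : ∫ y, ‖frameKernel A ψ x y * G y‖ ∂μ
        ≤ ∫ y, A⁻¹ * d * (‖transform ψ (ψ x) y‖ * v y) ∂μ := by
      refine integral_mono_ae (hin x).norm (h1.const_mul _) ?_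
      filter_upwards [hd] with y hy
      have e2 : ‖frameKernel A ψ x y‖ = A⁻¹ * ‖transform ψ (ψ x) y‖ := by
        rw [← norm_frameKernel_swap, frameKernel, norm_mul, norm_inv, Complex.norm_real,
          Real.norm_of_nonneg hψ.bound_pos.le]
      rw [norm_mul, e2]
      calc _ ≤ A⁻¹ * ‖transform ψ (ψ x) y‖ * (d * v y) :=
            mul_le_mul_of_nonneg_left hy (mul_nonneg (inv_nonneg.2 hψ.bound_pos.le)
              (norm_nonneg _))
        _ = _ := by ring
    refine h2.trans ?_
    rw [integral_const_mul, mul_assoc]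
    exact mul_le_mul_of_nonneg_left (mul_le_mul_of_nonneg_left (hH x).2 hd0)
      (inv_nonneg.2 hψ.bound_pos.le)
  have hΦm : StronglyMeasurable
      fun p : X × X => conj (transform ψ h p.1) * (frameKernel A ψ p.1 p.2 * G p.2) :=
    (Complex.continuous_conj.comp_stronglyMeasurable
      ((hψ.stronglyMeasurable_transform _).comp_measurable measurable_fst)).mul
      (hψ.stronglyMeasurable_frameKernel.mul (hG.comp_measurable measurable_snd))
  refine (integrable_prod_iff hΦm.aestronglyMeasurable).2
    ⟨ae_of_all _ fun x => (hin x).const_mul (conj (transform ψ h x)), ?_⟩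
  refine ((H1.integrable_norm_mul hv' h).const_mul (A⁻¹ * (d * c))).mono'
    hΦm.norm.integral_prod_right.aestronglyMeasurable (ae_of_all _ fun x => ?_)
  have e : ∀ y, ‖conj (transform ψ h x) * (frameKernel A ψ x y * G y)‖
      = ‖transform ψ h x‖ * ‖frameKernel A ψ x y * G y‖ := fun y => by
    rw [norm_mul, RCLike.norm_conj]
  rw [Real.norm_of_nonneg (integral_nonneg fun y => norm_nonneg _)]
  simp only [e]
  rw [integral_const_mul]
  calc _ ≤ ‖transform ψ h x‖ * (A⁻¹ * (d * (c * v x))) :=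
        mul_le_mul_of_nonneg_left (hbd x) (norm_nonneg _)
    _ = _ := by ring

/-- The duality formula: an element of the anti-dual is recovered from its transform. -/
theorem antidual_apply_eq (hψ : IsContinuousTightFrame μ A ψ) {v : X → ℝ}
    (hv : ∀ x, 0 < v x) (hvm : Measurable v) {c : ℝ}
    (hH : ∀ x, ψ x ∈ H1 μ ψ v ∧ H1norm μ ψ v (ψ x) ≤ c * v x) (f : antidual μ ψ v)
    (h : H1 μ ψ v) :
    f.1 h = (A : ℂ)⁻¹ * ∫ x, conj (transform ψ h x) * extTransform μ ψ v f x ∂μ := by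
  have hA : (A : ℂ) ≠ 0 := by exact_mod_cast hψ.bound_pos.ne'
  obtain ⟨G, hG, ⟨d, hd0, hd⟩, hf⟩ := antidual_exists_repr hψ hv hvm f
  have hv' : ∀ x, 0 ≤ v x := fun x => (hv x).le
  have e1 : ∀ x, extTransform μ ψ v f x = A * kernelApply μ (frameKernel A ψ) G x := fun x => by
    rw [extTransform_eq f (hH x).1, hf, integral_conj_transform_frame hψ]
  have hΦ := integrable_conj_mul_frameKernel_mul hψ hv' hH h hG hd0 hd
  have e3 : ∫ x, conj (transform ψ h x) * extTransform μ ψ v f x ∂μ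
      = A * ∫ x, ∫ y, conj (transform ψ h x) * (frameKernel A ψ x y * G y) ∂μ ∂μ := by
    rw [← integral_const_mul]
    refine integral_congr_ae (ae_of_all _ fun x => ?_)
    simp only [e1]
    rw [integral_const_mul, kernelApply]
    ring
  -- After the swap, the inner integral is the conjugate of the reproducing formula for h.
  rw [e3, inv_mul_cancel_left₀ hA, integral_integral_swap hΦ, hf]
  refine integral_congr_ae (ae_of_all _ fun y => ?_)
  have h4 := hψ.integral_frameKernel_mul h y
  have h5 : ∀ x, conj (transform ψ h x) * (frameKernel A ψ x y * G y) = conj (frameKernel A ψ y x * transform ψ h x) * G y := fun x => by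
    simp only [map_mul, ← frameKernel_swap]
    ring
  simp only [h5]
  rw [integral_mul_const, integral_conj, h4]

/-- The reproducing formula for elements of the anti-dual. -/
theorem kernelApply_extTransform (hψ : IsContinuousTightFrame μ A ψ) {v : X → ℝ}
    (hv : ∀ x, 0 < v x) (hvm : Measurable v) {c : ℝ}
    (hH : ∀ x, ψ x ∈ H1 μ ψ v ∧ H1norm μ ψ v (ψ x) ≤ c * v x) (f : antidual μ ψ v) (x : X) :
    kernelApply μ (frameKernel A ψ) (extTransform μ ψ v f) x = extTransform μ ψ v f x := by
  have hA : (A : ℂ) ≠ 0 := by exact_mod_cast hψ.bound_pos.ne'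
  rw [extTransform_eq f (hH x).1, antidual_apply_eq hψ hv hvm hH f,
    integral_conj_transform_frame hψ, inv_mul_cancel_left₀ hA]

theorem antidual_ext_of_ae (hψ : IsContinuousTightFrame μ A ψ) {v : X → ℝ}
    (hv : ∀ x, 0 < v x) (hvm : Measurable v) {c : ℝ}
    (hH : ∀ x, ψ x ∈ H1 μ ψ v ∧ H1norm μ ψ v (ψ x) ≤ c * v x) {f g : antidual μ ψ v}
    (h : extTransform μ ψ v f =ᵐ[μ] extTransform μ ψ v g) : f = g := by
  apply Subtype.ext
  ext k
  rw [antidual_apply_eq hψ hv hvm hH f, antidual_apply_eq hψ hv hvm hH g]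
  congr 1
  refine integral_congr_ae ?_
  filter_upwards [h] with x hx
  rw [hx]

end Antidual

theorem kernelApply_congr_ae {X : Type*} [MeasurableSpace X] {μ : Measure X} {K : X → X → ℂ}
    {F G : X → ℂ} (h : F =ᵐ[μ] G) (x : X) : kernelApply μ K F x = kernelApply μ K G x :=
  integral_congr_ae (by filter_upwards [h] with y hy; rw [hy])

/-! ### The coorbit space as the range of the reproducing operator. -/

section Correspondence

variable {X : Type u} {H : Type v} [NormedAddCommGroup H] [InnerProductSpace ℂ H]
  [TopologicalSpace X] [MeasurableSpace X] {μ : Measure X} {A : ℝ} {ψ : X → H}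
  {m : X → X → ℝ} {z : X} {Y : SolidBanachSpace.{u, w} μ} {c : ℝ}

/-- The standing assumptions of coorbit theory for the weight `v = m(·, z)`. -/
structure IsCoorbitSetting (A : ℝ) (ψ : X → H) (m : X → X → ℝ) (z : X)
    (Y : SolidBanachSpace.{u, w} μ) (c : ℝ) : Prop where
  frame : IsContinuousTightFrame μ A ψ
  weight : IsAdmissibleWeight m
  module : Y.IsKernelModule m
  kernel : MemKernelAlgebra μ m (frameKernel A ψ)
  kernel_bound : ∀ F : Y.carrier, ∃ d : ℝ, ∀ᵐ x ∂μ,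
    ‖kernelApply μ (frameKernel A ψ) (Y.emb F) x‖ ≤ d * m x z
  mem_H1 : ∀ x, ψ x ∈ H1 μ ψ (fun x => m x z) ∧ H1norm μ ψ (fun x => m x z) (ψ x) ≤ c * m x z

theorem Co.emb_toY_ae {v : X → ℝ} (f : Co ψ v Y) :
    Y.emb (Co.toY ψ v Y f) =ᵐ[μ] extTransform μ ψ v f.1 :=
  f.2.choose_spec

theorem Co.norm_toY {v : X → ℝ} (f : Co ψ v Y) : ‖Co.toY ψ v Y f‖ = ‖f‖ := rfl

namespace IsCoorbitSetting

/-- The reproducing operator on `Y`. -/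
noncomputable def proj (S : IsCoorbitSetting A ψ m z Y c) : Y.carrier →L[ℂ] Y.carrier :=
  S.module.op (frameKernel A ψ) S.kernel

/-- The range of the reproducing operator. -/
noncomputable def fixed (S : IsCoorbitSetting A ψ m z Y c) : Submodule ℂ Y.carrier :=
  LinearMap.eqLocus (S.proj : Y.carrier →ₗ[ℂ] Y.carrier) LinearMap.id

theorem mem_fixed (S : IsCoorbitSetting A ψ m z Y c) {F : Y.carrier} :
    F ∈ S.fixed ↔ S.proj F = F := Iff.rfl

theorem isClosed_fixed (S : IsCoorbitSetting A ψ m z Y c) : IsClosed (S.fixed : Set Y.carrier) :=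
  isClosed_eq S.proj.continuous continuous_id

theorem emb_proj_ae (S : IsCoorbitSetting A ψ m z Y c) (F : Y.carrier) :
    Y.emb (S.proj F) =ᵐ[μ] kernelApply μ (frameKernel A ψ) (Y.emb F) :=
  S.module.emb_op_ae S.kernel F

theorem measurable_weight (S : IsCoorbitSetting A ψ m z Y c) : Measurable fun x => m x z :=
  S.weight.measurable.comp (measurable_id.prodMk measurable_const)

theorem weight_pos (S : IsCoorbitSetting A ψ m z Y c) (x : X) : 0 < m x z :=
  S.weight.pos x z

/-- The reproducing operator maps `Y` boundedly into `L^∞_{1/v}`. -/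
theorem exists_proj_bound [SigmaCompactSpace X] (S : IsCoorbitSetting A ψ m z Y c) :
    ∃ d : ℝ, 0 ≤ d ∧ ∀ F : Y.carrier, ∀ᵐ x ∂μ, ‖Y.emb (S.proj F) x‖ ≤ d * ‖F‖ * m x z := by
  -- A Baire category argument: each F has its own constant, so the closed sets E n exhaust Y and
  -- one of them contains a ball.
  let E : ℕ → Set Y.carrier := fun n => {F | ∀ᵐ x ∂μ, ‖Y.emb (S.proj F) x‖ ≤ n * m x z}
  have hEc : ∀ n, IsClosed (E n) := fun n => by
    refine IsSeqClosed.isClosed fun F G hF hG => ?_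
    have h1 : Tendsto (fun k => S.proj (F k)) atTop (𝓝 (S.proj G)) :=
      (S.proj.continuous.tendsto G).comp hG
    exact Y.ae_mem_of_tendsto h1 (S := fun x => {w : ℂ | ‖w‖ ≤ n * m x z})
      (fun x => isClosed_le continuous_norm continuous_const) (Eventually.of_forall hF)
  have hEu : ⋃ n, E n = univ := by
    refine eq_univ_of_forall fun F => mem_iUnion.2 ?_
    obtain ⟨d, hd⟩ := S.kernel_bound F
    obtain ⟨n, hn⟩ := exists_nat_ge d
    refine ⟨n, ?_⟩
    filter_upwards [hd, S.emb_proj_ae F] with x h1 h2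
    rw [h2]
    exact h1.trans (mul_le_mul_of_nonneg_right hn (S.weight_pos x).le)
  obtain ⟨n, F₀, hF₀⟩ := nonempty_interior_of_iUnion_of_closed hEc hEu
  obtain ⟨r, hr, hball⟩ := Metric.isOpen_iff.1 isOpen_interior F₀ hF₀
  -- Writing F as (F₀ + F) − F₀ moves the ball to the origin and doubles the constant. Scaling a
  -- general F to norm r/2 then produces 4n/r.
  have hsub : ∀ F : Y.carrier, ‖F‖ < r → ∀ᵐ x ∂μ, ‖Y.emb (S.proj F) x‖ ≤ 2 * n * m x z := by
    intro F hF
    have a1 : F₀ + F ∈ E n := interior_subset (hball (by simpa [Metric.mem_ball] using hF))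
    have a2 : F₀ ∈ E n := interior_subset hF₀
    have e : S.proj F = S.proj (F₀ + F) - S.proj F₀ := by rw [map_add]; abel
    rw [e]
    filter_upwards [a1, a2, Y.emb_sub_ae (S.proj (F₀ + F)) (S.proj F₀)] with x h1 h2 h3
    rw [h3]
    linarith [norm_sub_le (Y.emb (S.proj (F₀ + F)) x) (Y.emb (S.proj F₀) x)]
  refine ⟨4 * n / r, by positivity, fun F => ?_⟩
  rcases eq_or_ne F 0 with rfl | hF
  · rw [map_zero]
    filter_upwards [Y.emb_zero_ae] with x hx
    rw [hx]; simp
  have hFp : 0 < ‖F‖ := norm_pos_iff.2 hF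
  let t : ℝ := r / (2 * ‖F‖)
  have ht : 0 < t := by positivity
  have h1 := hsub ((t : ℂ) • F) (by
    rw [norm_smul, Complex.norm_real, Real.norm_of_nonneg ht.le]
    have : t * ‖F‖ = r / 2 := by simp only [t]; field_simp
    rw [this]; linarith)
  rw [map_smul] at h1
  filter_upwards [h1, Y.emb_smul_ae (t : ℂ) (S.proj F)] with x h2 h3
  rw [h3, norm_mul, Complex.norm_real, Real.norm_of_nonneg ht.le] at h2
  have h4 : ‖Y.emb (S.proj F) x‖ ≤ (2 * n * m x z) / t := by
    rw [le_div_iff₀ ht]; linarith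
  refine h4.trans (le_of_eq ?_)
  simp only [t]
  field_simp
  ring

variable [BorelSpace X]

/-- F = R F is bounded by a multiple of v, so integration against F defines a functional; its
transform is R F, which is F again. -/
theorem exists_co_of_mem_fixed (S : IsCoorbitSetting A ψ m z Y c) {F : Y.carrier}
    (hF : F ∈ S.fixed) : ∃ f : Co ψ (fun x => m x z) Y, Co.toY ψ (fun x => m x z) Y f = F := by
  obtain ⟨d, hd⟩ := S.kernel_bound F
  have h1 := S.emb_proj_ae F
  rw [S.mem_fixed.1 hF] at h1
  have h2 : ∀ᵐ x ∂μ, ‖Y.emb F x‖ ≤ d * m x z := by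
    filter_upwards [h1, hd] with x e1 e2
    rwa [e1]
  obtain ⟨f, -, hf⟩ := exists_antidual_of_bound S.frame (fun x => (S.weight_pos x).le)
    (fun x => (S.mem_H1 x).1) (Y.emb F).aestronglyMeasurable h2
  have h3 : Y.emb F =ᵐ[μ] extTransform μ ψ (fun x => m x z) f := by
    filter_upwards [h1] with x e1
    rw [hf, e1]
  refine ⟨⟨f, F, h3⟩, Y.ext_of_ae ((Co.emb_toY_ae _).trans h3.symm)⟩

variable [SigmaFinite μ]  [CompleteSpace H] [TopologicalSpace.SeparableSpace H]

theorem toY_mem_fixed (S : IsCoorbitSetting A ψ m z Y c) (f : Co ψ (fun x => m x z) Y) :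
    Co.toY ψ (fun x => m x z) Y f ∈ S.fixed := by
  rw [S.mem_fixed]
  apply Y.ext_of_ae
  have h := Co.emb_toY_ae f
  filter_upwards [S.emb_proj_ae (Co.toY ψ (fun x => m x z) Y f), h] with x e1 e2
  rw [e1, e2, kernelApply_congr_ae h,
    kernelApply_extTransform S.frame S.weight_pos S.measurable_weight S.mem_H1]

theorem toY_injective (S : IsCoorbitSetting A ψ m z Y c) :
    Function.Injective (Co.toY ψ (fun x => m x z) Y) := by
  intro f g h
  apply Subtype.ext
  refine antidual_ext_of_ae S.frame S.weight_pos S.measurable_weight S.mem_H1 ?_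
  refine (Co.emb_toY_ae f).symm.trans ?_
  rw [h]
  exact Co.emb_toY_ae g

/-- The coorbit space is isometric to the range of the reproducing operator. -/
noncomputable def coEquiv (S : IsCoorbitSetting A ψ m z Y c) :
    Co ψ (fun x => m x z) Y ≃ₗᵢ[ℂ] S.fixed where
  toLinearEquiv := LinearEquiv.ofBijective
    ((Co.toY ψ (fun x => m x z) Y).codRestrict S.fixed S.toY_mem_fixed)
    ⟨fun f g h => S.toY_injective (congrArg Subtype.val h), fun F => by
      obtain ⟨f, hf⟩ := S.exists_co_of_mem_fixed F.2
      exact ⟨f, Subtype.ext hf⟩⟩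
  norm_map' _ := rfl

instance completeSpace_fixed (S : IsCoorbitSetting A ψ m z Y c) : CompleteSpace S.fixed :=
  S.isClosed_fixed.completeSpace_coe

theorem completeSpace_co (S : IsCoorbitSetting A ψ m z Y c) :
    CompleteSpace (Co ψ (fun x => m x z) Y) :=
  (S.coEquiv.isometry.isUniformInducing.completeSpace_congr S.coEquiv.surjective).2
    inferInstance

theorem eq_zero_of_norm_eq_zero (S : IsCoorbitSetting A ψ m z Y c)
    (f : Co ψ (fun x => m x z) Y) (hf : ‖f‖ = 0) : f = 0 := by
  apply S.toY_injective
  rw [map_zero]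
  exact norm_eq_zero.1 hf

/-- The reproducing operator is idempotent. -/
theorem proj_mem_fixed (S : IsCoorbitSetting A ψ m z Y c) (F : Y.carrier) :
    S.proj F ∈ S.fixed := by
  have hA : (A : ℂ) ≠ 0 := by exact_mod_cast S.frame.bound_pos.ne'
  rw [S.mem_fixed]
  apply Y.ext_of_ae
  -- Fubini for R(x,w) R(w,y) F(y): applying the module property of |R| twice, starting from |F|,
  -- makes the iterated integral of absolute values finite for almost every x.
  obtain ⟨F₁, hF₁, -⟩ := Y.exists_abs F
  set G₁ := S.module.op _ S.kernel.norm F₁ with hG₁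
  have hFm := (Y.emb F).stronglyMeasurable
  have hRm := S.frame.stronglyMeasurable_frameKernel
  have hG₁e : ∀ᵐ w ∂μ, Y.emb G₁ w = ((∫ y, ‖frameKernel A ψ w y * Y.emb F y‖ ∂μ : ℝ) : ℂ) := by
    filter_upwards [S.module.emb_op_ae S.kernel.norm F₁] with w hw
    rw [hw, kernelApply_congr_ae hF₁, kernelApply, ← integral_complex_ofReal]
    refine integral_congr_ae (ae_of_all _ fun y => ?_)
    simp
  filter_upwards [S.emb_proj_ae (S.proj F), S.emb_proj_ae F,
    S.module.ae_integrable S.kernel.norm G₁] with x e1 e2 i1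
  rw [e1, e2, kernelApply_congr_ae (S.emb_proj_ae F)]
  have hΦm : StronglyMeasurable
      fun p : X × X => frameKernel A ψ x p.1 * (frameKernel A ψ p.1 p.2 * Y.emb F p.2) :=
    (hRm.comp_measurable (measurable_const.prodMk measurable_fst)).mul
      (hRm.mul (hFm.comp_measurable measurable_snd))
  have hΦ : Integrable
      (fun p : X × X => frameKernel A ψ x p.1 * (frameKernel A ψ p.1 p.2 * Y.emb F p.2))
      (μ.prod μ) := by
    refine (integrable_prod_iff hΦm.aestronglyMeasurable).2 ⟨?_, ?_⟩
    · filter_upwards [S.module.ae_integrable S.kernel F] with w hw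
      exact hw.const_mul (frameKernel A ψ x w)
    · have i2 := i1.norm
      refine i2.congr ?_
      filter_upwards [hG₁e] with w hw
      have e : ∀ y, ‖frameKernel A ψ x w * (frameKernel A ψ w y * Y.emb F y)‖
        = ‖frameKernel A ψ x w‖ * ‖frameKernel A ψ w y * Y.emb F y‖ := fun y => norm_mul _ _
      simp only [e]
      rw [integral_const_mul, hw, norm_mul, Complex.norm_real, Complex.norm_real, norm_norm,
        Real.norm_of_nonneg (integral_nonneg fun y => norm_nonneg _)]
  have h1 : kernelApply μ (frameKernel A ψ) (kernelApply μ (frameKernel A ψ) (Y.emb F)) x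
      = ∫ w, ∫ y, frameKernel A ψ x w * (frameKernel A ψ w y * Y.emb F y) ∂μ ∂μ := by
    refine integral_congr_ae (ae_of_all _ fun w => ?_)
    simp only
    rw [integral_const_mul, kernelApply]
  rw [h1, integral_integral_swap hΦ]
  refine integral_congr_ae (ae_of_all _ fun y => ?_)
  -- The composition of R with itself is R, by the reproducing formula for the vector ψ_y.
  have h2 := S.frame.integral_frameKernel_mul (ψ y) x
  have h3 : ∀ w, frameKernel A ψ x w * (frameKernel A ψ w y * Y.emb F y)
      = frameKernel A ψ x w * transform ψ (ψ y) w * ((A : ℂ)⁻¹ * Y.emb F y) := fun w => by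
    simp only [frameKernel]; ring
  simp only [h3]
  rw [integral_mul_const, h2, frameKernel]
  ring

end IsCoorbitSetting

end Correspondence

/-! ### Indicator functions of the covering sets belong to Y. -/

section Indicators

variable {X : Type u} [TopologicalSpace X] [MeasurableSpace X] {μ : Measure X}
  {m : X → X → ℝ} {Y : SolidBanachSpace.{u, w} μ} {I : Type v} {U : I → Set X} {C : ℝ}

theorem IsAdmissibleCovering.measure_lt_top [IsFiniteMeasureOnCompacts μ]
    (hU : IsAdmissibleCovering U) (i : I) : μ (U i) < ∞ :=
  (measure_mono subset_closure).trans_lt (hU.relativelyCompact i).measure_lt_top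

/-- Passing through fixed points a ∈ U_i and b ∈ U_j bounds the weight on U_i × U_j by C m(a,b) C,
and both sets have finite measure. -/
theorem memKernelAlgebra_indicator [IsFiniteMeasureOnCompacts μ]
    (hm : IsAdmissibleWeight m) (hU : IsAdmissibleCovering U)
    (hC : ∀ i, ∀ x ∈ U i, ∀ y ∈ U i, m x y ≤ C) (i j : I) :
    MemKernelAlgebra μ m fun x y =>
      (U i).indicator (fun _ => (1 : ℂ)) x * (U j).indicator (fun _ => (1 : ℂ)) y := by
  obtain ⟨a, ha⟩ := hU.interior_nonempty i
  obtain ⟨b, hb⟩ := hU.interior_nonempty j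
  have ha' := interior_subset ha
  have hb' := interior_subset hb
  have hC0 : 0 ≤ C := (hm.pos a a).le.trans (hC i a ha' a ha')
  set B := C * (m a b * C) with hB
  have hB0 : 0 ≤ B := mul_nonneg hC0 (mul_nonneg (hm.pos a b).le hC0)
  have hbd : ∀ x ∈ U i, ∀ y ∈ U j, m x y ≤ B := fun x hx y hy => by
    refine (hm.le_mul x y a).trans (mul_le_mul (hC i x hx a ha') ?_ (hm.pos a y).le hC0)
    exact (hm.le_mul a y b).trans (mul_le_mul_of_nonneg_left (hC j b hb' y hy) (hm.pos a b).le)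
  have pt : ∀ x y, ‖(U i).indicator (fun _ => (1 : ℂ)) x * (U j).indicator (fun _ => (1 : ℂ)) y
      * (m x y : ℂ)‖ₑ ≤ ENNReal.ofReal B * ((U i).indicator 1 x * (U j).indicator 1 y) := by
    intro x y
    by_cases hx : x ∈ U i
    · by_cases hy : y ∈ U j
      · simp only [indicator_of_mem hx, indicator_of_mem hy, one_mul, Pi.one_apply, mul_one]
        rw [← ofReal_norm, Complex.norm_real, Real.norm_of_nonneg (hm.pos x y).le]
        exact ENNReal.ofReal_le_ofReal (hbd x hx y hy)
      · simp [indicator_of_notMem hy]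
    · simp [indicator_of_notMem hx]
  refine ⟨?_, ?_⟩
  · have h1 : Measurable ((U i).indicator fun _ => (1 : ℂ)) :=
      measurable_const.indicator (hU.measurableSet i)
    have h2 : Measurable ((U j).indicator fun _ => (1 : ℂ)) :=
      measurable_const.indicator (hU.measurableSet j)
    exact ((h1.comp measurable_fst).mul (h2.comp measurable_snd)).aestronglyMeasurable
  · have t1 : ENNReal.ofReal B * μ (U j) < ∞ :=
      ENNReal.mul_lt_top ENNReal.ofReal_lt_top (hU.measure_lt_top j)
    have t2 : ENNReal.ofReal B * μ (U i) < ∞ :=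
      ENNReal.mul_lt_top ENNReal.ofReal_lt_top (hU.measure_lt_top i)
    have le1 : ∀ (s : Set X) (x : X), s.indicator (1 : X → ℝ≥0∞) x ≤ 1 := fun s x =>
      indicator_le_self' (fun _ _ => zero_le) x
    refine max_lt (lt_of_le_of_lt (essSup_le_of_ae_le _ (ae_of_all _ fun x => ?_)) t1)
      (lt_of_le_of_lt (essSup_le_of_ae_le _ (ae_of_all _ fun y => ?_)) t2)
    · refine (lintegral_mono fun y => (pt x y).trans
        (mul_le_mul_right (mul_le_of_le_one_left zero_le (le1 _ x)) _)).trans ?_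
      rw [lintegral_const_mul' _ _ ENNReal.ofReal_ne_top,
        lintegral_indicator_one (hU.measurableSet j)]
    · refine (lintegral_mono fun x => (pt x y).trans
        (mul_le_mul_right (mul_le_of_le_one_right zero_le (le1 _ y)) _)).trans ?_
      rw [lintegral_const_mul' _ _ ENNReal.ofReal_ne_top,
        lintegral_indicator_one (hU.measurableSet i)]

/-- A nontrivial solid kernel module contains the indicator functions of the covering sets. -/
theorem exists_emb_eq_indicator [BorelSpace X] [IsFiniteMeasureOnCompacts μ]
    (hm : IsAdmissibleWeight m) (hY : Y.IsKernelModule m) (hU : IsAdmissibleCovering U)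
    (hC : ∀ i, ∀ x ∈ U i, ∀ y ∈ U i, m x y ≤ C) (i : I) :
    ∃ F : Y.carrier, Y.emb F =ᵐ[μ] (U i).indicator fun _ => (1 : ℂ) := by
  obtain ⟨F₀, hF₀⟩ := exists_ne (0 : Y.carrier)
  obtain ⟨F, hF, hFn⟩ := Y.exists_abs F₀
  have := hU.countable
  have hj : ∃ j, ¬ ∀ᵐ x ∂μ.restrict (U j), Y.emb F₀ x = 0 := by
    by_contra! hcon
    have h1 := (ae_restrict_iUnion_iff (μ := μ) U fun x => Y.emb F₀ x = 0).2 hcon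
    rw [hU.covers, Measure.restrict_univ] at h1
    exact hF₀ (Y.ext_of_ae (EventuallyEq.trans h1 Y.emb_zero_ae.symm))
  obtain ⟨j, hj⟩ := hj
  have hint : IntegrableOn (fun x => ‖Y.emb F₀ x‖) (U j) μ :=
    (((Y.locallyIntegrable F₀).integrableOn_isCompact (hU.relativelyCompact j)).mono_set
      subset_closure).norm
  set t : ℝ := ∫ x in U j, ‖Y.emb F₀ x‖ ∂μ with ht
  have ht0 : t ≠ 0 := fun h0 => hj (by
    have := (integral_eq_zero_iff_of_nonneg (fun x => norm_nonneg _) hint).1 h0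
    filter_upwards [this] with x hx
    simpa using hx)
  -- The rank-one kernel sends |F₀| to t χ_{U_i}, and j was chosen so that t = ∫_{U_j} |F₀| is not
  -- zero.
  have hK := memKernelAlgebra_indicator (μ := μ) hm hU hC i j
  refine ⟨(t : ℂ)⁻¹ • hY.op _ hK F, ?_⟩
  filter_upwards [Y.emb_smul_ae (t : ℂ)⁻¹ (hY.op _ hK F), hY.emb_op_ae hK F] with x h1 h2
  rw [h1, h2, kernelApply_congr_ae hF, kernelApply]
  have h3 : ∀ y, (U i).indicator (fun _ => (1 : ℂ)) x * (U j).indicator (fun _ => (1 : ℂ)) y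
      * (‖Y.emb F₀ y‖ : ℂ) = (U i).indicator (fun _ => (1 : ℂ)) x *
        (U j).indicator (fun y => ((‖Y.emb F₀ y‖ : ℝ) : ℂ)) y := fun y => by
    by_cases hy : y ∈ U j
    · simp [indicator_of_mem hy]
    · simp [indicator_of_notMem hy]
  simp only [h3]
  rw [integral_const_mul, integral_indicator (hU.measurableSet j), integral_complex_ofReal, ← ht]
  have : (t : ℂ) ≠ 0 := by exact_mod_cast ht0
  field_simp

end Indicators

/-! ### Sequence spaces attached to the covering. -/

section SequenceSpace

variable {X : Type u} [TopologicalSpace X] [MeasurableSpace X] {μ : Measure X} {I : Type v}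
  {U : I → Set X}

/-- The step function `∑ᵢ |aᵢ| ωᵢ χ_{Uᵢ}`. -/
noncomputable def stepFun (hU : IsAdmissibleCovering U) (ω : I → ℝ) (a : I → ℂ) (x : X) : ℝ :=
  ∑ i ∈ (hU.finite_mem x).toFinset, ‖a i‖ * ω i

variable (hU : IsAdmissibleCovering U) {ω : I → ℝ}

theorem stronglyMeasurable_stepFun (ω : I → ℝ) (a : I → ℂ) :
    StronglyMeasurable (stepFun hU ω a) := by
  have := hU.countable
  refine stronglyMeasurable_of_tendsto (u := (atTop : Filter (Finset I)))
    (f := fun t x => ∑ i ∈ t, (U i).indicator (fun _ => ‖a i‖ * ω i) x) (fun t => ?_) ?_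
  · exact Finset.stronglyMeasurable_fun_sum t fun i _ =>
      stronglyMeasurable_const.indicator (hU.measurableSet i)
  · rw [tendsto_pi_nhds]
    intro x
    refine tendsto_const_nhds.congr' ?_
    filter_upwards [eventually_ge_atTop (hU.finite_mem x).toFinset] with t ht
    rw [← Finset.sum_subset ht]
    · refine Finset.sum_congr rfl fun i hi => ?_
      have hx : x ∈ U i := (hU.finite_mem x).mem_toFinset.1 hi
      rw [indicator_of_mem hx]
    · intro i _ hi
      have hx : x ∉ U i := fun h => hi ((hU.finite_mem x).mem_toFinset.2 h)
      exact indicator_of_notMem hx _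

theorem stepFun_nonneg (hω : ∀ i, 0 < ω i) (a : I → ℂ) (x : X) : 0 ≤ stepFun hU ω a x :=
  Finset.sum_nonneg fun i _ => mul_nonneg (norm_nonneg _) (hω i).le

theorem le_stepFun (hω : ∀ i, 0 < ω i) (a : I → ℂ) {i : I} {x : X} (hx : x ∈ U i) :
    ‖a i‖ * ω i ≤ stepFun hU ω a x :=
  Finset.single_le_sum (f := fun i => ‖a i‖ * ω i)
    (fun i _ => mul_nonneg (norm_nonneg _) (hω i).le) ((hU.finite_mem x).mem_toFinset.2 hx)

theorem stepFun_mono (hω : ∀ i, 0 < ω i) {a b : I → ℂ} (h : ∀ i, ‖a i‖ ≤ ‖b i‖) (x : X) :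
    stepFun hU ω a x ≤ stepFun hU ω b x :=
  Finset.sum_le_sum fun i _ => mul_le_mul_of_nonneg_right (h i) (hω i).le

theorem stepFun_add_le (hω : ∀ i, 0 < ω i) (a b : I → ℂ) (x : X) :
    stepFun hU ω (a + b) x ≤ stepFun hU ω a x + stepFun hU ω b x := by
  unfold stepFun
  rw [← Finset.sum_add_distrib]
  refine Finset.sum_le_sum fun i _ => ?_
  rw [← add_mul]
  exact mul_le_mul_of_nonneg_right (norm_add_le _ _) (hω i).le

theorem stepFun_smul (c : ℂ) (a : I → ℂ) (x : X) :
    stepFun hU ω (c • a) x = ‖c‖ * stepFun hU ω a x := by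
  unfold stepFun
  rw [Finset.mul_sum]
  refine Finset.sum_congr rfl fun i _ => ?_
  simp [mul_assoc]

theorem stepFun_zero (x : X) : stepFun hU ω (0 : I → ℂ) x = 0 := by simp [stepFun]

theorem exists_card_le : ∃ N : ℕ, ∀ x, (hU.finite_mem x).toFinset.card ≤ N := by
  obtain ⟨N, hN⟩ := hU.overlap
  refine ⟨N, fun x => ?_⟩
  obtain ⟨i, hi⟩ := hU.exists_mem x
  have hsub : {j | x ∈ U j} ⊆ {j | (U i ∩ U j).Nonempty} := fun j hj => ⟨x, hi, hj⟩
  have h1 : {j | x ∈ U j}.encard ≤ N := (encard_le_encard hsub).trans (hN i)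
  rw [(hU.finite_mem x).encard_eq_coe_toFinset_card] at h1
  exact_mod_cast h1

theorem emb_stepFun_of_le [BorelSpace X] (Y : SolidBanachSpace.{u, w} μ) (hω : ∀ i, 0 < ω i)
    {a : I → ℂ} {F : Y.carrier} (h : ∀ᵐ x ∂μ, stepFun hU ω a x ≤ ‖Y.emb F x‖) :
    ∃ G : Y.carrier, (Y.emb G =ᵐ[μ] fun x => (stepFun hU ω a x : ℂ)) ∧ ‖G‖ ≤ ‖F‖ := by
  refine Y.exists_of_ae_le (Complex.continuous_ofReal.comp_aestronglyMeasurable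
    (stronglyMeasurable_stepFun hU ω a).aestronglyMeasurable) F ?_
  filter_upwards [h] with x hx
  rwa [Complex.norm_real, Real.norm_of_nonneg (stepFun_nonneg hU hω a x)]

variable [BorelSpace X] (Y : SolidBanachSpace.{u, w} μ)

/-- The sequences whose step function belongs to `Y`. -/
noncomputable def seqSubmodule (hω : ∀ i, 0 < ω i) : Submodule ℂ (I → ℂ) where
  carrier := {a | ∃ F : Y.carrier, Y.emb F =ᵐ[μ] fun x => (stepFun hU ω a x : ℂ)}
  add_mem' := by
    rintro a b ⟨F, hF⟩ ⟨G, hG⟩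
    obtain ⟨G', h, -⟩ := emb_stepFun_of_le hU Y hω (a := a + b) (F := F + G) (by
      filter_upwards [hF, hG, Y.emb_add_ae F G] with x h1 h2 h3
      rw [h3, h1, h2, ← Complex.ofReal_add, Complex.norm_real]
      exact (stepFun_add_le hU hω a b x).trans (le_abs_self _))
    exact ⟨G', h⟩
  zero_mem' := ⟨0, by
    filter_upwards [Y.emb_zero_ae] with x hx
    rw [hx, stepFun_zero, Complex.ofReal_zero]⟩
  smul_mem' := by
    rintro c a ⟨F, hF⟩
    refine ⟨(‖c‖ : ℂ) • F, ?_⟩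
    filter_upwards [hF, Y.emb_smul_ae (‖c‖ : ℂ) F] with x h1 h2
    rw [h2, h1, stepFun_smul, Complex.ofReal_mul]

/-- The sequence space of `seqSubmodule`, with the norm of `Y` instead of the product topology. -/
def SeqCarrier (hω : ∀ i, 0 < ω i) : Type v := seqSubmodule hU Y hω

namespace SeqCarrier

variable {hU Y} {hω : ∀ i, 0 < ω i}

noncomputable instance : AddCommGroup (SeqCarrier hU Y hω) :=
  inferInstanceAs (AddCommGroup (seqSubmodule hU Y hω))

noncomputable instance : Module ℂ (SeqCarrier hU Y hω) :=
  inferInstanceAs (Module ℂ (seqSubmodule hU Y hω))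

/-- The underlying sequence. -/
noncomputable def coord : SeqCarrier hU Y hω →ₗ[ℂ] (I → ℂ) := (seqSubmodule hU Y hω).subtype

theorem coord_injective : Function.Injective (coord : SeqCarrier hU Y hω → I → ℂ) :=
  Subtype.val_injective

/-- The step function of a sequence as an element of `Y`. -/
noncomputable def step (a : SeqCarrier hU Y hω) : Y.carrier :=
  Classical.choose (Subtype.property a)

theorem emb_step (a : SeqCarrier hU Y hω) :
    Y.emb (step a) =ᵐ[μ] fun x => (stepFun hU ω (coord a) x : ℂ) :=
  Classical.choose_spec (Subtype.property a)

noncomputable instance : Norm (SeqCarrier hU Y hω) := ⟨fun a => ‖step a‖⟩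

theorem norm_def (a : SeqCarrier hU Y hω) : ‖a‖ = ‖step a‖ := rfl

theorem exists_of_le {a : I → ℂ} {F : Y.carrier}
    (h : ∀ᵐ x ∂μ, stepFun hU ω a x ≤ ‖Y.emb F x‖) :
    ∃ b : SeqCarrier hU Y hω, coord b = a ∧ ‖b‖ ≤ ‖F‖ := by
  obtain ⟨G, hG, hn⟩ := emb_stepFun_of_le hU Y hω h
  have hmem : a ∈ seqSubmodule hU Y hω := ⟨G, hG⟩
  obtain ⟨b, hb⟩ : ∃ b : SeqCarrier hU Y hω, coord b = a := ⟨⟨a, hmem⟩, rfl⟩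
  have hstep : step b = G := by
    refine Y.ext_of_ae ((emb_step b).trans ?_)
    rw [hb]; exact hG.symm
  exact ⟨b, hb, by rwa [norm_def, hstep]⟩

theorem norm_le_of_le {b : SeqCarrier hU Y hω} {F : Y.carrier}
    (h : ∀ᵐ x ∂μ, stepFun hU ω (coord b) x ≤ ‖Y.emb F x‖) : ‖b‖ ≤ ‖F‖ := by
  obtain ⟨b', h1, h2⟩ := exists_of_le (hω := hω) h
  rwa [coord_injective h1] at h2

theorem norm_coord_mul_le (b : SeqCarrier hU Y hω) {i : I} {χ : Y.carrier}
    (hχ : Y.emb χ =ᵐ[μ] (U i).indicator fun _ => (1 : ℂ)) :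
    ‖coord b i‖ * (ω i * ‖χ‖) ≤ ‖b‖ := by
  have h0 : 0 ≤ ‖coord b i‖ * ω i := mul_nonneg (norm_nonneg _) (hω i).le
  have e : ‖coord b i‖ * (ω i * ‖χ‖) = ‖((‖coord b i‖ * ω i : ℝ) : ℂ) • χ‖ := by
    rw [norm_smul, Complex.norm_real, Real.norm_of_nonneg h0, mul_assoc]
  rw [e, norm_def]
  refine Y.norm_le_of_ae_le ?_
  filter_upwards [hχ, emb_step b, Y.emb_smul_ae ((‖coord b i‖ * ω i : ℝ) : ℂ) χ] with x h1 h2 h3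
  rw [h3, h1, h2, norm_mul, Complex.norm_real, Complex.norm_real, Real.norm_of_nonneg h0,
    Real.norm_of_nonneg (stepFun_nonneg hU hω _ x)]
  by_cases hx : x ∈ U i
  · rw [indicator_of_mem hx, norm_one, mul_one]
    exact le_stepFun hU hω _ hx
  · rw [indicator_of_notMem hx, norm_zero, mul_zero]
    exact stepFun_nonneg hU hω _ x

theorem normedSpaceCore (hμ : ∀ i, μ (U i) ≠ 0) : NormedSpace.Core ℂ (SeqCarrier hU Y hω) where
  norm_nonneg a := norm_nonneg (step a)
  norm_smul c a := by
    have h : step (c • a) = (‖c‖ : ℂ) • step a := by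
      apply Y.ext_of_ae
      filter_upwards [emb_step (c • a), emb_step a, Y.emb_smul_ae (‖c‖ : ℂ) (step a)]
        with x h1 h2 h3
      rw [h1, h3, h2, map_smul, stepFun_smul, Complex.ofReal_mul]
    rw [norm_def, h, norm_smul, Complex.norm_real, norm_norm, norm_def]
  norm_triangle a b := by
    refine (norm_le_of_le (F := step a + step b) ?_).trans (norm_add_le _ _)
    filter_upwards [emb_step a, emb_step b, Y.emb_add_ae (step a) (step b)] with x h1 h2 h3
    rw [h3, h1, h2, ← Complex.ofReal_add, Complex.norm_real, map_add]
    exact (stepFun_add_le hU hω _ _ x).trans (le_abs_self _)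
  norm_eq_zero_iff a := by
    constructor
    · intro h
      have h0 : step a = 0 := norm_eq_zero.1 h
      apply coord_injective
      rw [map_zero]
      ext i
      have h1 := emb_step a
      rw [h0] at h1
      obtain ⟨x, hx, h2, h3⟩ := Measure.exists_mem_of_measure_ne_zero_of_ae (hμ i)
        (ae_restrict_of_ae (h1.and Y.emb_zero_ae))
      rw [h3] at h2
      have h4 : stepFun hU ω (coord a) x = 0 := Complex.ofReal_eq_zero.1 h2.symm
      have h5 := le_stepFun hU hω (coord a) hx
      rw [h4] at h5
      have h6 : ‖coord a i‖ ≤ 0 := by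
        by_contra hcon
        exact absurd h5 (not_le.2 (mul_pos (not_le.1 hcon) (hω i)))
      simpa using h6
    · rintro rfl
      have : step (0 : SeqCarrier hU Y hω) = 0 := by
        apply Y.ext_of_ae
        filter_upwards [emb_step (0 : SeqCarrier hU Y hω), Y.emb_zero_ae] with x h1 h2
        rw [h1, h2, map_zero, stepFun_zero, Complex.ofReal_zero]
      rw [norm_def, this, norm_zero]

/-- The norm of a componentwise sum is controlled by the sum of the step functions. -/
theorem exists_of_hasSum [SigmaCompactSpace X] {a : ℕ → SeqCarrier hU Y hω} {b : I → ℂ}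
    (hb : ∀ i, HasSum (fun n => coord (a n) i) (b i)) {G : Y.carrier}
    (hG : HasSum (fun n => step (a n)) G) :
    ∃ b' : SeqCarrier hU Y hω, coord b' = b ∧ ‖b'‖ ≤ ‖G‖ := by
  refine exists_of_le ?_
  have sum_le : ∀ (N : ℕ) (x : X), stepFun hU ω (∑ n ∈ Finset.range N, coord (a n)) x
      ≤ ∑ n ∈ Finset.range N, stepFun hU ω (coord (a n)) x := fun N x => by
    induction N with
    | zero => simp [stepFun_zero]
    | succ k ih =>
      rw [Finset.sum_range_succ, Finset.sum_range_succ]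
      exact (stepFun_add_le hU hω _ _ x).trans (by linarith)
  have emb_sum : ∀ N : ℕ, ∀ᵐ x ∂μ, Y.emb (∑ n ∈ Finset.range N, step (a n)) x
      = ((∑ n ∈ Finset.range N, stepFun hU ω (coord (a n)) x : ℝ) : ℂ) := fun N => by
    induction N with
    | zero => 
      filter_upwards [Y.emb_zero_ae] with x hx
      rw [Finset.sum_range_zero, Finset.sum_range_zero, hx, Complex.ofReal_zero]
    | succ k ih =>
      filter_upwards [ih, emb_step (a k),
        Y.emb_add_ae (∑ n ∈ Finset.range k, step (a n)) (step (a k))] with x h1 h2 h3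
      rw [Finset.sum_range_succ, h3, h1, h2, Finset.sum_range_succ, Complex.ofReal_add]
  -- The step function of a partial sum is below the partial sum of the step functions. These
  -- increase and tend to G in Y, so the inequality passes to the limit almost everywhere. Letting N
  -- grow is harmless, since a step function is a finite sum at each point.
  have key : ∀ N : ℕ, ∀ᵐ x ∂μ,
      stepFun hU ω (∑ n ∈ Finset.range N, coord (a n)) x ≤ (Y.emb G x).re := fun N => by
    refine Y.ae_mem_of_tendsto hG.tendsto_sum_nat
      (S := fun x => {w : ℂ | stepFun hU ω (∑ n ∈ Finset.range N, coord (a n)) x ≤ w.re})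
      (fun x => isClosed_le continuous_const Complex.continuous_re) ?_
    filter_upwards [eventually_ge_atTop N] with M hM
    filter_upwards [emb_sum M] with x hx
    rw [hx, Complex.ofReal_re]
    exact (sum_le N x).trans (Finset.sum_le_sum_of_subset_of_nonneg
      (Finset.range_subset_range.2 hM) fun n _ _ => stepFun_nonneg hU hω _ x)
  filter_upwards [ae_all_iff.2 key] with x hx
  have lim : Tendsto (fun N => stepFun hU ω (∑ n ∈ Finset.range N, coord (a n)) x) atTop
      (𝓝 (stepFun hU ω b x)) := by
    unfold stepFun
    refine tendsto_finsetSum _ fun i _ => Tendsto.mul_const _ (Tendsto.norm ?_)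
    simpa only [Finset.sum_apply] using (hb i).tendsto_sum_nat
  exact (le_of_tendsto' lim hx).trans (Complex.re_le_norm _)

end SeqCarrier

/-- The BK-space of the sequences `a` with `∑ᵢ |aᵢ| ωᵢ χ_{Uᵢ} ∈ Y`. -/
noncomputable def seqSpace [SigmaCompactSpace X] (hω : ∀ i, 0 < ω i) (hμ : ∀ i, μ (U i) ≠ 0)
    (hχ : ∀ i, ∃ F : Y.carrier, Y.emb F =ᵐ[μ] (U i).indicator fun _ => (1 : ℂ)) : BKSpace I :=
  letI i₁ : NormedAddCommGroup (SeqCarrier hU Y hω) :=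
    NormedAddCommGroup.ofCore (SeqCarrier.normedSpaceCore (hω := hω) hμ)
  letI i₂ : NormedSpace ℂ (SeqCarrier hU Y hω) :=
    NormedSpace.ofCore (SeqCarrier.normedSpaceCore (hω := hω) hμ)
  have hcoord : ∀ i, ∃ k : ℝ, ∀ a : SeqCarrier hU Y hω, ‖SeqCarrier.coord a i‖ ≤ k * ‖a‖ := by
    intro i
    obtain ⟨χ, h⟩ := hχ i
    have hp : 0 < ω i * ‖χ‖ := by
      refine mul_pos (hω i) (norm_pos_iff.2 ?_)
      rintro rfl
      obtain ⟨x, hx, h2, h3⟩ := Measure.exists_mem_of_measure_ne_zero_of_ae (hμ i)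
        (ae_restrict_of_ae (h.and Y.emb_zero_ae))
      rw [h3, indicator_of_mem hx] at h2
      exact zero_ne_one h2
    refine ⟨(ω i * ‖χ‖)⁻¹, fun a => ?_⟩
    rw [inv_mul_eq_div, le_div_iff₀ hp]
    exact SeqCarrier.norm_coord_mul_le a h
  { carrier := SeqCarrier hU Y hω
    normedAddCommGroup := i₁
    normedSpace := i₂
    completeSpace := by
      refine NormedAddCommGroup.completeSpace_of_summable_imp_tendsto fun a ha => ?_
      have hs : ∀ i, Summable fun n => SeqCarrier.coord (a n) i := fun i => by
        obtain ⟨k, hk⟩ := hcoord i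
        exact Summable.of_norm_bounded (ha.mul_left k) fun n => hk (a n)
      have hY : Summable fun n => SeqCarrier.step (a n) := Summable.of_norm ha
      obtain ⟨b, hb, -⟩ := SeqCarrier.exists_of_hasSum (fun i => (hs i).hasSum) hY.hasSum
      refine ⟨b, tendsto_iff_norm_sub_tendsto_zero.2 ?_⟩
      refine squeeze_zero (fun _ => norm_nonneg _) (fun k => ?_) (tendsto_sum_nat_add fun n => ‖a n‖)
      rw [norm_sub_rev]
      -- The same construction applied to the shifted series yields the remainder, whose norm is at
      -- most the tail of ∑ ‖a n‖.
      obtain ⟨d, hd, hdn⟩ := SeqCarrier.exists_of_hasSum (a := fun n => a (n + k))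
        (fun i => ((summable_nat_add_iff k).2 (hs i)).hasSum)
        ((summable_nat_add_iff k).2 hY).hasSum
      have e : d = b - ∑ n ∈ Finset.range k, a n := by
        apply SeqCarrier.coord_injective
        ext i
        rw [hd, map_sub, map_sum, hb, Pi.sub_apply, Finset.sum_apply, eq_sub_iff_add_eq']
        exact (hs i).sum_add_tsum_nat_add k
      rw [← e]
      exact hdn.trans (norm_tsum_le_tsum_norm ((summable_nat_add_iff k).2 ha))
    coord := SeqCarrier.coord
    coord_injective := SeqCarrier.coord_injective
    continuous_coord := fun i => by
      obtain ⟨k, hk⟩ := hcoord i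
      let L : SeqCarrier hU Y hω →ₗ[ℂ] ℂ := (LinearMap.proj i).comp SeqCarrier.coord
      exact (L.mkContinuous k hk).continuous
    solid := fun b a h => by
      refine SeqCarrier.exists_of_le (F := SeqCarrier.step a) ?_
      filter_upwards [SeqCarrier.emb_step a] with x hx
      rw [hx, Complex.norm_real]
      exact (stepFun_mono hU hω h x).trans (le_abs_self _) }

section

variable [SigmaCompactSpace X] {hω : ∀ i, 0 < ω i} {hμ : ∀ i, μ (U i) ≠ 0}
  {hχ : ∀ i, ∃ F : Y.carrier, Y.emb F =ᵐ[μ] (U i).indicator fun _ => (1 : ℂ)}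

theorem seqSpace_exists_of_le {a : I → ℂ} {F : Y.carrier}
    (h : ∀ᵐ x ∂μ, stepFun hU ω a x ≤ ‖Y.emb F x‖) :
    ∃ b : (seqSpace hU Y hω hμ hχ).carrier,
      (seqSpace hU Y hω hμ hχ).coord b = a ∧ ‖b‖ ≤ ‖F‖ :=
  SeqCarrier.exists_of_le (hω := hω) h

theorem seqSpace_exists_step (b : (seqSpace hU Y hω hμ hχ).carrier) :
    ∃ F : Y.carrier, (Y.emb F =ᵐ[μ] fun x =>
      (stepFun hU ω ((seqSpace hU Y hω hμ hχ).coord b) x : ℂ)) ∧ ‖F‖ = ‖b‖ :=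
  ⟨SeqCarrier.step (hω := hω) b, SeqCarrier.emb_step (hω := hω) b, rfl⟩

end

end SequenceSpace

/-! ### Measurable selection of the covering index and of the phase. -/

section Phase

variable {X : Type u} [MeasurableSpace X] {μ : Measure X} {I : Type w} {U : I → Set X}

/-- The first covering set containing y, in an enumeration of the indices, is selected. The fibres
are U_i minus earlier sets; this disjoint refinement does the work of a partition of unity. -/
theorem exists_measurable_index [Countable I] (hU : ∀ i, MeasurableSet (U i))
    (hcov : ∀ y, ∃ i, y ∈ U i) :
    ∃ ι : X → I, (∀ y, y ∈ U (ι y)) ∧ ∀ i, MeasurableSet (ι ⁻¹' {i}) := by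
  obtain ⟨e, he⟩ := exists_injective_nat I
  have h : ∀ y, ∃ i, y ∈ U i ∧ ∀ j, y ∈ U j → e i ≤ e j := fun y => by
    obtain ⟨i, hi, hmin⟩ := (measure e).wf.has_min {i | y ∈ U i} (hcov y)
    exact ⟨i, hi, fun j hj => not_lt.1 (hmin j hj)⟩
  choose ι h1 h2 using h
  refine ⟨ι, h1, fun i => ?_⟩
  have : ι ⁻¹' {i} = U i \ ⋃ j ∈ {j | e j < e i}, U j := by
    ext y
    simp only [mem_preimage, mem_singleton_iff, Set.mem_sdiff, mem_iUnion, not_exists]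
    constructor
    · rintro rfl
      exact ⟨h1 y, fun j hj hy => absurd (h2 y j hy) (not_le.2 hj)⟩
    · rintro ⟨hy, hn⟩
      refine he (le_antisymm (h2 y i hy) ?_)
      by_contra hlt
      exact hn (ι y) (not_le.1 hlt) (h1 y)
  rw [this]
  exact (hU i).diff (MeasurableSet.biUnion (to_countable _) fun j _ => hU j)

theorem measurable_comp_index [Countable I] {Z : Type*} [MeasurableSpace Z] {ι : X → I}
    (hι : ∀ i, MeasurableSet (ι ⁻¹' {i})) (g : I → Z) : Measurable fun y => g (ι y) := by
  let _ : MeasurableSpace I := ⊤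
  have h1 : Measurable ι := measurable_to_countable' hι
  exact (measurable_from_top (f := g)).comp h1

variable {H : Type v} [NormedAddCommGroup H] [InnerProductSpace ℂ H] [TopologicalSpace X]
  [BorelSpace X] [CompleteSpace H] [TopologicalSpace.SeparableSpace H]
  {A : ℝ} {ψ : X → H} {m : X → X → ℝ} {Γ : X → X → ℂ}

/-- The kernel that compares `R(x, y)` with the phase-corrected sample `R(x, ξ y)`. -/
noncomputable def errKernel (A : ℝ) (ψ : X → H) (γ : X → ℂ) (ξ : X → X) (x y : X) : ℂ :=
  frameKernel A ψ x y - γ y * frameKernel A ψ x (ξ y)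

theorem stronglyMeasurable_errKernel (hψ : IsContinuousTightFrame μ A ψ) {γ : X → ℂ}
    (hγ : Measurable γ) {ξ : X → X} (hξ : Measurable ξ) :
    StronglyMeasurable (Function.uncurry (errKernel A ψ γ ξ)) := by
  have hR := hψ.stronglyMeasurable_frameKernel
  exact hR.sub (((hγ.comp measurable_snd).stronglyMeasurable).mul
    (hR.comp_measurable (measurable_fst.prodMk (hξ.comp measurable_snd))))

variable [SFinite μ]

/-- A measurable choice of the phases. -/
theorem exists_measurable_phase (hψ : IsContinuousTightFrame μ A ψ)
    (hΓ : ∀ x y, ‖Γ x y‖ = 1) (hU : IsAdmissibleCovering U)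
    (hosc : AEStronglyMeasurable (Function.uncurry fun x y => (osc A ψ U Γ x y : ℂ)) (μ.prod μ))
    {ξ : X → X} (hξ : Measurable ξ) (hξQ : ∀ y, ∃ i, y ∈ U i ∧ ξ y ∈ U i)
    {ε : ℝ} (hε : 0 < ε) :
    ∃ γ : X → ℂ, Measurable γ ∧ (∀ y, ‖γ y‖ = 1) ∧
      (∀ᵐ x ∂μ, ∀ᵐ y ∂μ, ‖errKernel A ψ γ ξ x y‖
        ≤ osc A ψ U Γ x y + ε * (‖frameKernel A ψ x y‖ + osc A ψ U Γ x y)) ∧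
      (∀ᵐ y ∂μ, ∀ᵐ x ∂μ, ‖errKernel A ψ γ ξ x y‖
        ≤ osc A ψ U Γ x y + ε * (‖frameKernel A ψ x y‖ + osc A ψ U Γ x y)) := by
  classical
  have hR := hψ.stronglyMeasurable_frameKernel
  -- The oscillation is measurable only up to a null set of the product, so measurability questions
  -- are settled for the version o.
  let o : X × X → ℂ := hosc.mk _
  have hom : StronglyMeasurable o := hosc.stronglyMeasurable_mk
  have hoe : ∀ᵐ p ∂μ.prod μ, osc A ψ U Γ p.1 p.2 = ‖o p‖ := by
    filter_upwards [hosc.ae_eq_mk] with p hp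
    change _ = ‖hosc.mk _ p‖
    rw [← hp]
    simp only [Function.uncurry, Complex.norm_real]
    exact (Real.norm_of_nonneg (osc_nonneg hψ.bound_pos ψ U Γ p.1 p.2)).symm
  have hoe1 : ∀ᵐ x ∂μ, ∀ᵐ y ∂μ, osc A ψ U Γ x y = ‖o (x, y)‖ := Measure.ae_ae_of_ae_prod hoe
  have hoe2 : ∀ᵐ y ∂μ, ∀ᵐ x ∂μ, osc A ψ U Γ x y = ‖o (x, y)‖ := by
    have h := (Measure.measurePreserving_swap (μ := μ) (ν := μ)).quasiMeasurePreserving.ae hoe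
    exact Measure.ae_ae_of_ae_prod h
  -- The phase Γ(y, ξ y) need not be measurable in y; it is approximated within ε by a countable
  -- dense set of phases.
  let θ : ℕ → ℂ := fun n => ((TopologicalSpace.denseSeq Circle n : Circle) : ℂ)
  have hθ : ∀ n, ‖θ n‖ = 1 := fun n => Circle.norm_coe _
  have hdense : ∀ w : ℂ, ‖w‖ = 1 → ∃ n, ‖θ n - w‖ < ε := fun w hw => by
    let w' : Circle := ⟨w, by simpa [Submonoid.unitSphere] using hw⟩
    obtain ⟨n, hn⟩ := (TopologicalSpace.denseRange_denseSeq Circle).exists_dist_lt w' hε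
    refine ⟨n, ?_⟩
    rw [← dist_eq_norm, dist_comm]
    exact hn
  let D : (X → ℂ) → Set (X × X) := fun γ => {p | ‖errKernel A ψ γ ξ p.1 p.2‖
    ≤ ‖o p‖ + ε * (‖frameKernel A ψ p.1 p.2‖ + ‖o p‖)}
  have hD : ∀ γ, Measurable γ → MeasurableSet (D γ) := fun γ hγ =>
    measurableSet_le (stronglyMeasurable_errKernel hψ hγ hξ).norm.measurable
      (hom.norm.measurable.add ((hR.norm.measurable.add hom.norm.measurable).const_mul ε))
  -- B n collects the y for which the phase θ n satisfies the bound at almost every x. It is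
  -- measurable because sections of a measurable set have measurable measure.
  let B : ℕ → Set X := fun n => {y | μ ((fun x => (x, y)) ⁻¹' (D fun _ => θ n)ᶜ) = 0}
  have hB : ∀ n, MeasurableSet (B n) := fun n =>
    measurable_measure_prodMk_right (hD _ measurable_const).compl (measurableSet_singleton 0)
  have hBex : ∀ᵐ y ∂μ, ∃ n, y ∈ B n := by
    filter_upwards [hoe2] with y hy
    obtain ⟨n, hn⟩ := hdense (Γ y (ξ y)) (hΓ _ _)
    refine ⟨n, ?_⟩
    have : ∀ᵐ x ∂μ, (x, y) ∈ D fun _ => θ n := by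
      filter_upwards [hy] with x hx
      change ‖errKernel A ψ (fun _ => θ n) ξ x y‖ ≤ _
      rw [← hx]
      obtain ⟨i, hi1, hi2⟩ := hξQ y
      have h1 := norm_sub_le_osc hψ hU hΓ x (mem_coverNhd hi1 hi2)
      have h2 := norm_frameKernel_le hψ hU hΓ x hi1 hi2
      have h3 : errKernel A ψ (fun _ => θ n) ξ x y
          = (frameKernel A ψ x y - Γ y (ξ y) * frameKernel A ψ x (ξ y))
            - (θ n - Γ y (ξ y)) * frameKernel A ψ x (ξ y) := by
        simp only [errKernel]; ring
      rw [h3]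
      refine (norm_sub_le _ _).trans (add_le_add h1 ?_)
      rw [norm_mul]
      exact mul_le_mul hn.le h2 (norm_nonneg _) hε.le
    exact this
  -- The first admissible n is selected. Where no n works, a null set, every n is declared
  -- admissible, so the search is total and returns 0.
  let p : ℕ → X → Prop := fun n y => y ∈ B n ∨ y ∉ ⋃ k, B k
  have hp : ∀ n, MeasurableSet {y | p n y} := fun n =>
    (hB n).union (MeasurableSet.iUnion hB).compl
  have hpex : ∀ y, ∃ n, p n y := fun y => by
    by_cases h : y ∈ ⋃ k, B k
    · obtain ⟨n, hn⟩ := mem_iUnion.1 h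
      exact ⟨n, Or.inl hn⟩
    · exact ⟨0, Or.inr h⟩
  let γ : X → ℂ := fun y => θ (Nat.find (hpex y))
  have hγ : Measurable γ :=
    Measurable.find (f := fun n _ => θ n) (fun n => measurable_const) hp hpex
  have key : ∀ᵐ y ∂μ, ∀ᵐ x ∂μ, (x, y) ∈ D γ := by
    filter_upwards [hBex] with y hy
    have h1 : y ∈ B (Nat.find (hpex y)) :=
      (Nat.find_spec (hpex y)).resolve_right fun h => h (mem_iUnion.2 hy)
    have h2 : ∀ᵐ x ∂μ, (x, y) ∈ D fun _ => θ (Nat.find (hpex y)) := h1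
    exact h2
  have key' : ∀ᵐ x ∂μ, ∀ᵐ y ∂μ, (x, y) ∈ D γ := (Measure.ae_ae_comm (hD γ hγ)).2 key
  refine ⟨γ, hγ, fun y => hθ _, ?_, ?_⟩
  · filter_upwards [key', hoe1] with x h1 h2
    filter_upwards [h1, h2] with y h3 h4
    rw [h4]; exact h3
  · filter_upwards [key, hoe2] with x h1 h2
    filter_upwards [h1, h2] with y h3 h4
    rw [h4]; exact h3

/-- With k = ‖osc‖ and r = ‖R‖ the error kernel has norm at most k + ε(r + k), and the strict
inequalities k < 1 and rk < 1 leave room for a small ε. -/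
theorem exists_phase_small (hψ : IsContinuousTightFrame μ A ψ) (hm : IsAdmissibleWeight m)
    (hK : MemKernelAlgebra μ m (frameKernel A ψ))
    (hΓ : ∀ x y, ‖Γ x y‖ = 1) (hU : IsAdmissibleCovering U)
    (hosc : MemKernelAlgebra μ m (fun x y => (osc A ψ U Γ x y : ℂ)))
    (h₁ : (kernelNorm μ m (fun x y => (osc A ψ U Γ x y : ℂ))).toReal < 1)
    (h₂ : (kernelNorm μ m (frameKernel A ψ)).toReal *
      (kernelNorm μ m (fun x y => (osc A ψ U Γ x y : ℂ))).toReal < 1)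
    {ξ : X → X} (hξ : Measurable ξ) (hξQ : ∀ y, ∃ i, y ∈ U i ∧ ξ y ∈ U i) :
    ∃ γ : X → ℂ, Measurable γ ∧ (∀ y, ‖γ y‖ = 1) ∧
      MemKernelAlgebra μ m (errKernel A ψ γ ξ) ∧
      (kernelNorm μ m (errKernel A ψ γ ξ)).toReal < 1 ∧
      (kernelNorm μ m (frameKernel A ψ)).toReal *
        (kernelNorm μ m (errKernel A ψ γ ξ)).toReal < 1 := by
  set k := (kernelNorm μ m (fun x y => (osc A ψ U Γ x y : ℂ))).toReal with hk
  set r := (kernelNorm μ m (frameKernel A ψ)).toReal with hr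
  have ev : ∀ᶠ ε : ℝ in 𝓝[>] 0, k + ε * (r + k) < 1 ∧ r * (k + ε * (r + k)) < 1 := by
    refine nhdsWithin_le_nhds (Filter.Eventually.and ?_ ?_)
    · have : Tendsto (fun ε : ℝ => k + ε * (r + k)) (𝓝 0) (𝓝 (k + 0 * (r + k))) :=
        Continuous.tendsto (by fun_prop) 0
      exact this.eventually_lt_const (by simpa using h₁)
    · have : Tendsto (fun ε : ℝ => r * (k + ε * (r + k))) (𝓝 0) (𝓝 (r * (k + 0 * (r + k)))) :=
        Continuous.tendsto (by fun_prop) 0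
      exact this.eventually_lt_const (by simpa using h₂)
  obtain ⟨ε, ⟨hε1, hε2⟩, hε⟩ := (ev.and self_mem_nhdsWithin).exists
  have hε : 0 < ε := hε
  obtain ⟨γ, hγ, hγ1, ha, hb⟩ := exists_measurable_phase hψ hΓ hU hosc.1 hξ hξQ hε
  let L : X → X → ℂ := fun x y => (osc A ψ U Γ x y : ℂ) +
    (ε : ℂ) * ((‖frameKernel A ψ x y‖ : ℂ) + (osc A ψ U Γ x y : ℂ))
  have hL : MemKernelAlgebra μ m L := hosc.add hm ((hK.norm.add hm hosc).const_mul ε)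
  have hLn : ∀ x y, ‖L x y‖
      = osc A ψ U Γ x y + ε * (‖frameKernel A ψ x y‖ + osc A ψ U Γ x y) := fun x y => by
    have h0 := osc_nonneg hψ.bound_pos ψ U Γ x y
    have : L x y = ((osc A ψ U Γ x y
        + ε * (‖frameKernel A ψ x y‖ + osc A ψ U Γ x y) : ℝ) : ℂ) := by
      simp only [L]; push_cast; ring
    rw [this, Complex.norm_real, Real.norm_of_nonneg (by positivity)]
  simp only [← hLn] at ha hb
  have hE : MemKernelAlgebra μ m (errKernel A ψ γ ξ) :=
    hL.mono (stronglyMeasurable_errKernel hψ hγ hξ).aestronglyMeasurable ha hb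
  have hle : (kernelNorm μ m (errKernel A ψ γ ξ)).toReal ≤ k + ε * (r + k) := by
    have b1 : kernelNorm μ m (errKernel A ψ γ ξ)
        ≤ kernelNorm μ m (fun x y => (osc A ψ U Γ x y : ℂ)) + ENNReal.ofReal ε *
          (kernelNorm μ m (frameKernel A ψ)
            + kernelNorm μ m (fun x y => (osc A ψ U Γ x y : ℂ))) := by
      refine (kernelNorm_mono ha hb).trans ((kernelNorm_add_le hm hosc.1).trans ?_)
      refine add_le_add le_rfl ((kernelNorm_const_mul _ _).trans ?_)
      have : ‖(ε : ℂ)‖ₑ = ENNReal.ofReal ε := by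
        rw [← ofReal_norm, Complex.norm_real, Real.norm_of_nonneg hε.le]
      rw [this]
      refine mul_le_mul_right ((kernelNorm_add_le hm hK.norm.1).trans
        (add_le_add (kernelNorm_mono ?_ ?_) le_rfl)) _ <;>
      exact ae_of_all _ fun x => ae_of_all _ fun y => by simp
    have t := ENNReal.add_ne_top.2 ⟨hK.2.ne, hosc.2.ne⟩
    refine (ENNReal.toReal_mono (ENNReal.add_ne_top.2
      ⟨hosc.2.ne, ENNReal.mul_ne_top ENNReal.ofReal_ne_top t⟩) b1).trans (le_of_eq ?_)
    rw [ENNReal.toReal_add hosc.2.ne (ENNReal.mul_ne_top ENNReal.ofReal_ne_top t),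
      ENNReal.toReal_mul, ENNReal.toReal_ofReal hε.le, ENNReal.toReal_add hK.2.ne hosc.2.ne]
  exact ⟨γ, hγ, hγ1, hE, hle.trans_lt hε1,
    (mul_le_mul_of_nonneg_left hle ENNReal.toReal_nonneg).trans_lt hε2⟩

end Phase

/-! ### Neumann series on an invariant subspace, and auxiliary operators. -/

section Helpers

/-- Neumann series on a complete invariant subspace. -/
theorem exists_inverse_sub_on {E : Type*} [NormedAddCommGroup E] [NormedSpace ℂ E]
    (M : Submodule ℂ E) [CompleteSpace M] (D : E →L[ℂ] E) (hM : ∀ F ∈ M, D F ∈ M) {ρ : ℝ}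
    (hρ0 : 0 ≤ ρ) (hρ : ρ < 1) (hD : ∀ F, ‖D F‖ ≤ ρ * ‖F‖) :
    ∃ W : M →L[ℂ] M, (∀ F G : M, (G : E) = F - D F → W G = F) ∧
      ∀ F : M, (W F : E) - D (W F) = F := by
  let D' : M →L[ℂ] M := (D.comp M.subtypeL).codRestrict M fun F => hM F F.2
  have hn : ‖D'‖ < 1 := (ContinuousLinearMap.opNorm_le_bound D' hρ0 fun F => hD F).trans_lt hρ
  let u := Units.oneSub D' hn
  refine ⟨(↑u⁻¹ : M →L[ℂ] M), fun F G h => ?_, fun F => ?_⟩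
  · have e : G = (↑u : M →L[ℂ] M) F := Subtype.ext h
    rw [e]
    exact DFunLike.congr_fun u.inv_mul F
  · have e : (↑u : M →L[ℂ] M) ((↑u⁻¹ : M →L[ℂ] M) F) = F := DFunLike.congr_fun u.mul_inv F
    exact congrArg Subtype.val e

theorem SolidBanachSpace.exists_clm {X : Type u} [TopologicalSpace X] [MeasurableSpace X]
    {μ : Measure X} (Y : SolidBanachSpace.{u, w} μ) {B : Type*} [SeminormedAddCommGroup B]
    [NormedSpace ℂ B] (T : B → X → ℂ) (hadd : ∀ a b x, T (a + b) x = T a x + T b x)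
    (hsmul : ∀ (k : ℂ) a x, T (k • a) x = k * T a x) (k : ℝ)
    (h : ∀ b, ∃ F : Y.carrier, Y.emb F =ᵐ[μ] T b ∧ ‖F‖ ≤ k * ‖b‖) :
    ∃ L : B →L[ℂ] Y.carrier, ∀ b, Y.emb (L b) =ᵐ[μ] T b := by
  choose F hF hn using h
  let L : B →ₗ[ℂ] Y.carrier :=
    { toFun := F
      map_add' := fun a b => by
        apply Y.ext_of_ae
        filter_upwards [hF (a + b), hF a, hF b, Y.emb_add_ae (F a) (F b)] with x h1 h2 h3 h4
        rw [h1, h4, h2, h3, hadd]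
      map_smul' := fun c a => by
        apply Y.ext_of_ae
        filter_upwards [hF (c • a), hF a, Y.emb_smul_ae c (F a)] with x h1 h2 h3
        rw [h1, RingHom.id_apply, h3, h2, hsmul] }
  exact ⟨L.mkContinuous k hn, hF⟩

theorem memKernelAlgebra_conj_swap {X : Type*} [MeasurableSpace X] {μ : Measure X} [SFinite μ]
    {m : X → X → ℝ} (hm : IsAdmissibleWeight m) {K : X → X → ℂ}
    (hK : MemKernelAlgebra μ m K) :
    MemKernelAlgebra μ m (fun x y => conj (K y x)) ∧
      kernelNorm μ m (fun x y => conj (K y x)) ≤ kernelNorm μ m K := by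
  have h : kernelNorm μ m (fun x y => conj (K y x)) ≤ kernelNorm μ m K := by
    rw [← kernelNorm_swap hm K]
    refine kernelNorm_mono ?_ ?_ <;>
    exact ae_of_all _ fun x => ae_of_all _ fun y => by simp
  exact ⟨⟨Complex.continuous_conj.comp_aestronglyMeasurable hK.1.prod_swap, h.trans_lt hK.2⟩, h⟩

end Helpers

/-! ### Sampling and the Banach frame. -/

section Discretization

variable {X : Type u} {H : Type v} [NormedAddCommGroup H] [InnerProductSpace ℂ H]
  [TopologicalSpace X] [MeasurableSpace X] [BorelSpace X] {μ : Measure X}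
  [SigmaFinite μ] [CompleteSpace H] [TopologicalSpace.SeparableSpace H]
  {A : ℝ} {ψ : X → H} {m : X → X → ℝ} {z : X} {Y : SolidBanachSpace.{u, w} μ} {c : ℝ}

namespace IsCoorbitSetting

/-- The coorbit space is continuously embedded in the anti-dual. -/
theorem exists_norm_apply_le [SigmaCompactSpace X] (S : IsCoorbitSetting A ψ m z Y c) :
    ∃ d : ℝ, 0 ≤ d ∧ ∀ (f : Co ψ (fun x => m x z) Y) (h : H1 μ ψ (fun x => m x z)),
      ‖f.1.1 h‖ ≤ d * ‖f‖ * H1norm μ ψ (fun x => m x z) h := by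
  obtain ⟨d, hd0, hd⟩ := S.exists_proj_bound
  have hA := S.frame.bound_pos
  refine ⟨A⁻¹ * d, by positivity, fun f h => ?_⟩
  rw [antidual_apply_eq S.frame S.weight_pos S.measurable_weight S.mem_H1 f.1, norm_mul, norm_inv,
    Complex.norm_real, Real.norm_of_nonneg hA.le, mul_assoc, mul_assoc]
  refine mul_le_mul_of_nonneg_left ?_ (inv_nonneg.2 hA.le)
  rw [← mul_assoc]
  refine H1.norm_integral_conj_mul_le (fun x => (S.weight_pos x).le) h ?_
  have h1 := hd (Co.toY ψ (fun x => m x z) Y f)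
  rw [S.mem_fixed.1 (S.toY_mem_fixed f)] at h1
  filter_upwards [h1, Co.emb_toY_ae f] with x e1 e2
  rw [e2] at e1
  exact e1

theorem exists_sampling [SigmaCompactSpace X] (S : IsCoorbitSetting A ψ m z Y c) (x : X) :
    ∃ g : Co ψ (fun x => m x z) Y →L[ℂ] ℂ,
      ∀ f, g f = extTransform μ ψ (fun x => m x z) f.1 x := by
  obtain ⟨d, hd0, hd⟩ := S.exists_norm_apply_le
  let L : Co ψ (fun x => m x z) Y →ₗ[ℂ] ℂ :=
    { toFun := fun f => extTransform μ ψ (fun x => m x z) f.1 x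
      map_add' := fun f g => extTransform_add _ _ _ _ _ _
      map_smul' := fun k f => extTransform_smul _ _ _ _ _ _ }
  refine ⟨L.mkContinuous (d * H1norm μ ψ (fun x => m x z) (ψ x)) fun f => ?_, fun f => rfl⟩
  change ‖extTransform μ ψ (fun x => m x z) f.1 x‖ ≤ _
  rw [extTransform_eq f.1 (S.mem_H1 x).1]
  refine (hd f ⟨ψ x, (S.mem_H1 x).1⟩).trans (le_of_eq ?_)
  ring

theorem integrable_frameKernel_mul_extTransform (S : IsCoorbitSetting A ψ m z Y c)
    (f : antidual μ ψ fun x => m x z) (x : X) :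
    Integrable (fun y => frameKernel A ψ x y * extTransform μ ψ (fun x => m x z) f y) μ := by
  have hA : (A : ℂ) ≠ 0 := by exact_mod_cast S.frame.bound_pos.ne'
  obtain ⟨d, -, hd⟩ := exists_norm_extTransform_le S.mem_H1 (fun x => (S.weight_pos x).le) f
  have h1 := (H1.integrable_conj_mul S.frame (fun x => (S.weight_pos x).le)
    ⟨ψ x, (S.mem_H1 x).1⟩ (stronglyMeasurable_extTransform S.frame S.weight_pos
      S.measurable_weight (fun x => (S.mem_H1 x).1) f).aestronglyMeasurable
    (ae_of_all _ hd)).const_mul (A : ℂ)⁻¹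
  refine h1.congr (ae_of_all _ fun y => ?_)
  simp only [conj_transform_frame S.frame.bound_pos]
  rw [mul_assoc, inv_mul_cancel_left₀ hA]

variable {I : Type*} {U : I → Set X} {Γ : X → X → ℂ}

/-- The samples of the transform on the covering sets are dominated by a function in `Y`. -/
theorem exists_stepFun_samples_le (S : IsCoorbitSetting A ψ m z Y c)
    (hU : IsAdmissibleCovering U) (hΓ : ∀ x y, ‖Γ x y‖ = 1)
    (hosc : MemKernelAlgebra μ m (fun x y => (osc A ψ U Γ x y : ℂ)))
    {x : I → X} (hx : ∀ i, x i ∈ U i) :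
    ∃ k : ℝ, 0 ≤ k ∧ ∀ f : Co ψ (fun x => m x z) Y, ∃ F : Y.carrier, ‖F‖ ≤ k * ‖f‖ ∧
      ∀ᵐ w ∂μ, stepFun hU (fun _ => 1)
        (fun i => extTransform μ ψ (fun x => m x z) f.1 (x i)) w ≤ ‖Y.emb F w‖ := by
  -- For w in U_i the reproducing formula gives |f(x_i)| ≤ ∫ (|R(y,w)| + osc(y,w)) |Vf(y)| dy, and
  -- at most N covering sets contain w. The transposed kernel appears because the oscillation
  -- compares values in the second variable.
  have hN := (S.kernel.norm.add S.weight hosc).swap S.weight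
  obtain ⟨N, hcard⟩ := exists_card_le hU
  refine ⟨N * (kernelNorm μ m fun x y =>
    (‖frameKernel A ψ y x‖ : ℂ) + (osc A ψ U Γ y x : ℂ)).toReal, mul_nonneg N.cast_nonneg ENNReal.toReal_nonneg,
    fun f => ?_⟩
  obtain ⟨F₁, hF₁, hF₁n⟩ := Y.exists_abs (Co.toY ψ (fun x => m x z) Y f)
  refine ⟨(N : ℂ) • S.module.op _ hN F₁, ?_, ?_⟩
  · rw [norm_smul, mul_assoc, Complex.norm_natCast, ← Co.norm_toY f, ← hF₁n]
    exact mul_le_mul_of_nonneg_left (S.module.norm_op_le hN F₁) N.cast_nonneg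
  have hFe : Y.emb F₁ =ᵐ[μ] fun y => ((‖extTransform μ ψ (fun x => m x z) f.1 y‖ : ℝ) : ℂ) := by
    filter_upwards [hF₁, Co.emb_toY_ae f] with y h1 h2
    rw [h1, h2]
  filter_upwards [Y.emb_smul_ae (N : ℂ) (S.module.op _ hN F₁), S.module.emb_op_ae hN F₁,
    S.module.ae_integrable hN F₁] with w e1 e2 hint
  have e3 : ∀ y, ((‖frameKernel A ψ y w‖ : ℂ) + (osc A ψ U Γ y w : ℂ)) *
      ((‖extTransform μ ψ (fun x => m x z) f.1 y‖ : ℝ) : ℂ)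
      = (((‖frameKernel A ψ y w‖ + osc A ψ U Γ y w) *
        ‖extTransform μ ψ (fun x => m x z) f.1 y‖ : ℝ) : ℂ) := fun y => by push_cast; ring
  have hint' : Integrable (fun y => (‖frameKernel A ψ y w‖ + osc A ψ U Γ y w) *
      ‖extTransform μ ψ (fun x => m x z) f.1 y‖) μ := by
    have : Integrable (fun y => (((‖frameKernel A ψ y w‖ + osc A ψ U Γ y w) *
        ‖extTransform μ ψ (fun x => m x z) f.1 y‖ : ℝ) : ℂ)) μ := by
      refine hint.congr ?_
      filter_upwards [hFe] with y hy
      rw [hy, e3]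
    exact this.re
  set t := ∫ y, (‖frameKernel A ψ y w‖ + osc A ψ U Γ y w) *
      ‖extTransform μ ψ (fun x => m x z) f.1 y‖ ∂μ with ht
  have ht0 : 0 ≤ t := integral_nonneg fun y => mul_nonneg (add_nonneg (norm_nonneg _)
    (osc_nonneg S.frame.bound_pos ψ U Γ y w)) (norm_nonneg _)
  rw [e1, e2, kernelApply_congr_ae hFe, kernelApply]
  simp only [e3]
  rw [integral_complex_ofReal, ← ht, norm_mul, Complex.norm_natCast, Complex.norm_real,
    Real.norm_of_nonneg ht0]
  have hpt : ∀ i ∈ (hU.finite_mem w).toFinset,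
      ‖extTransform μ ψ (fun x => m x z) f.1 (x i)‖ * 1 ≤ t := fun i hi => by
    have hwi : w ∈ U i := (hU.finite_mem w).mem_toFinset.1 hi
    rw [mul_one, ← kernelApply_extTransform S.frame S.weight_pos S.measurable_weight S.mem_H1]
    refine norm_integral_le_of_norm_le hint' (ae_of_all _ fun y => ?_)
    rw [norm_mul, ← norm_frameKernel_swap]
    exact mul_le_mul_of_nonneg_right (norm_frameKernel_le S.frame hU hΓ y hwi (hx i))
      (norm_nonneg _)
  refine (Finset.sum_le_card_nsmul _ _ t hpt).trans ?_
  rw [nsmul_eq_mul]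
  exact mul_le_mul_of_nonneg_right (by exact_mod_cast hcard w) ht0

/-- The samples form a Banach frame. -/
theorem isBanachFrame [SigmaCompactSpace X] (S : IsCoorbitSetting A ψ m z Y c)
    (hU : IsModerateAdmissibleCovering μ U) (hΓ : ∀ x y, ‖Γ x y‖ = 1)
    (hosc : MemKernelAlgebra μ m (fun x y => (osc A ψ U Γ x y : ℂ)))
    (hχ : ∀ i, ∃ F : Y.carrier, Y.emb F =ᵐ[μ] (U i).indicator fun _ => (1 : ℂ))
    {x : I → X} (hx : ∀ i, x i ∈ U i) {ι : X → I} (hι : ∀ y, y ∈ U (ι y))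
    (hιm : ∀ i, MeasurableSet (ι ⁻¹' {i})) {γ : X → ℂ} (hγ : Measurable γ)
    (hγ1 : ∀ y, ‖γ y‖ = 1) (hE : MemKernelAlgebra μ m (errKernel A ψ γ fun y => x (ι y)))
    (hsmall : (kernelNorm μ m (frameKernel A ψ)).toReal *
        (kernelNorm μ m (errKernel A ψ γ fun y => x (ι y))).toReal < 1)
    {g : I → (Co ψ (fun x => m x z) Y →L[ℂ] ℂ)}
    (hg : ∀ i f, g i f = extTransform μ ψ (fun x => m x z) f.1 (x i)) : IsBanachFrame g := by
  have := hU.countable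
  have hU' := hU.toIsAdmissibleCovering
  let B : BKSpace I := seqSpace hU' Y (ω := fun _ => 1) (fun _ => one_pos) hU.measure_ne_zero hχ
  -- The adjoint kernel at (y,w) is R(y,w) − conj γ(y) R(x_{ι y}, w). On a reproduced F it acts as
  -- F(y) − conj γ(y) F(x_{ι y}), so F − E*F is read off from the samples.
  obtain ⟨hE', hE'n⟩ := memKernelAlgebra_conj_swap S.weight hE
  have hE'r : (kernelNorm μ m fun x_1 y => conj (errKernel A ψ γ (fun y => x (ι y)) y x_1)).toReal
      ≤ (kernelNorm μ m (errKernel A ψ γ fun y => x (ι y))).toReal :=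
    ENNReal.toReal_mono hE.2.ne hE'n
  -- synthesis of step functions
  obtain ⟨Θ, hΘ⟩ := Y.exists_clm (B := B.carrier) (fun b y => conj (γ y) * B.coord b (ι y))
    (fun a b y => by simp [mul_add]) (fun k a y => by simp; ring) 1 (fun b => by
      obtain ⟨F, hF, hFn⟩ := seqSpace_exists_step hU' Y b
      rw [one_mul, ← hFn]
      have hm1 : Measurable fun y => conj (γ y) * B.coord b (ι y) :=
        (Complex.continuous_conj.measurable.comp hγ).mul (measurable_comp_index hιm _)
      refine Y.exists_of_ae_le hm1.aestronglyMeasurable F ?_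
      filter_upwards [hF] with y hy
      have h1 := le_stepFun hU' (ω := fun _ => 1) (fun _ => one_pos) (B.coord b) (hι y)
      rw [mul_one] at h1
      rw [hy, norm_mul, RCLike.norm_conj, hγ1, one_mul, Complex.norm_real]
      exact h1.trans (le_abs_self _))
  -- inversion of the approximation operator
  obtain ⟨W, hW, -⟩ := exists_inverse_sub_on S.fixed (S.proj.comp (S.module.op _ hE'))
    (fun F _ => S.proj_mem_fixed _) (mul_nonneg ENNReal.toReal_nonneg ENNReal.toReal_nonneg)
    hsmall (fun F => by
      refine (S.module.norm_op_le S.kernel _).trans ?_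
      rw [mul_assoc]
      refine mul_le_mul_of_nonneg_left ?_ ENNReal.toReal_nonneg
      exact (S.module.norm_op_le hE' F).trans
        (mul_le_mul_of_nonneg_right hE'r (norm_nonneg _)))
  let P : Y.carrier →L[ℂ] S.fixed := S.proj.codRestrict S.fixed S.proj_mem_fixed
  let Ω : B.carrier →L[ℂ] Co ψ (fun x => m x z) Y :=
    (S.coEquiv.symm.toContinuousLinearEquiv : S.fixed →L[ℂ] _).comp (W.comp (P.comp Θ))
  obtain ⟨k, hk0, hk⟩ := S.exists_stepFun_samples_le hU' hΓ hosc hx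
  have hΩ0 : 0 < ‖Ω‖ + 1 := by positivity
  -- The lower bound comes from f = Ω a; adding 1 keeps the constant positive when Ω = 0. The upper
  -- constant is enlarged so that C₁ ≤ C₂.
  refine ⟨B, Ω, (‖Ω‖ + 1)⁻¹, k + (‖Ω‖ + 1)⁻¹, inv_pos.2 hΩ0, by linarith, fun f => ?_⟩
  obtain ⟨F, hFn, hF⟩ := hk f
  obtain ⟨a, ha, han⟩ := seqSpace_exists_of_le hU' Y (hω := fun _ => one_pos)
    (hμ := hU.measure_ne_zero) (hχ := hχ) hF
  have hΩa : Ω a = f := by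
    have h1 : Θ a = Co.toY ψ (fun x => m x z) Y f - S.module.op _ hE' (Co.toY ψ _ Y f) := by
      apply Y.ext_of_ae
      have hf := Co.emb_toY_ae f
      filter_upwards [hΘ a, hf, Y.emb_sub_ae (Co.toY ψ (fun x => m x z) Y f)
        (S.module.op _ hE' (Co.toY ψ _ Y f)),
        S.module.emb_op_ae hE' (Co.toY ψ _ Y f)] with y e1 e2 e3 e4
      rw [e1, e3, e2, e4, kernelApply_congr_ae hf]
      have e5 : B.coord a (ι y) = extTransform μ ψ (fun x => m x z) f.1 (x (ι y)) :=
        congrFun ha (ι y)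
      have e6 : ∀ w, conj (errKernel A ψ γ (fun y => x (ι y)) w y) *
          extTransform μ ψ (fun x => m x z) f.1 w
          = frameKernel A ψ y w * extTransform μ ψ (fun x => m x z) f.1 w - conj (γ y) *
            (frameKernel A ψ (x (ι y)) w * extTransform μ ψ (fun x => m x z) f.1 w) := fun w => by
        simp only [errKernel, map_sub, map_mul, ← frameKernel_swap]
        ring
      rw [kernelApply]
      simp only [e6]
      rw [integral_sub (S.integrable_frameKernel_mul_extTransform f.1 y)
        ((S.integrable_frameKernel_mul_extTransform f.1 _).const_mul _), integral_const_mul, e5]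
      have e7 := fun y => kernelApply_extTransform S.frame S.weight_pos S.measurable_weight
        S.mem_H1 f.1 y
      simp only [kernelApply] at e7
      rw [e7, e7]
      ring
    change S.coEquiv.symm (W (P (Θ a))) = f
    rw [hW (S.coEquiv f) (P (Θ a)), S.coEquiv.symm_apply_apply]
    change S.proj (Θ a) = _
    rw [h1, map_sub, S.mem_fixed.1 (S.toY_mem_fixed f)]
    rfl
  refine ⟨a, ?_, ?_, ?_, hΩa⟩
  · ext i
    rw [hg]
    exact congrFun ha i
  · rw [inv_mul_le_iff₀ hΩ0]
    have h1 := Ω.le_opNorm a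
    rw [hΩa] at h1
    have h2 : 0 ≤ ‖a‖ := norm_nonneg a
    linarith
  · have h1 : 0 ≤ (‖Ω‖ + 1)⁻¹ * ‖f‖ := by positivity
    have h2 : ‖a‖ ≤ ‖F‖ := han
    rw [add_mul]
    linarith

end IsCoorbitSetting

end Discretization

/-! ### The averaging kernel of the covering. -/

section AveragingKernel

variable {X : Type u} [TopologicalSpace X] [MeasurableSpace X] {μ : Measure X} {I : Type v}
  {U : I → Set X}

/-- The kernel `∑ᵢ ωᵢ χ_{Uᵢ}(x) χ_{Uᵢ}(y)`. -/
noncomputable def avgKernel (hU : IsAdmissibleCovering U) (ω : I → ℝ) (x y : X) : ℝ :=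
  ∑ i ∈ (hU.finite_mem x).toFinset, (U i).indicator (fun _ => ω i) y

variable (hU : IsAdmissibleCovering U) {ω : I → ℝ}

theorem avgKernel_eq_sum (ω : I → ℝ) {x y : X} {t : Finset I}
    (ht : (hU.finite_mem x).toFinset ⊆ t) : avgKernel hU ω x y
      = ∑ i ∈ t, (U i).indicator (fun _ => (1 : ℝ)) x * (U i).indicator (fun _ => ω i) y := by
  rw [← Finset.sum_subset ht]
  · refine Finset.sum_congr rfl fun i hi => ?_
    have hx : x ∈ U i := (hU.finite_mem x).mem_toFinset.1 hi
    rw [indicator_of_mem hx, one_mul]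
  · intro i _ hi
    have hx : x ∉ U i := fun h => hi ((hU.finite_mem x).mem_toFinset.2 h)
    rw [indicator_of_notMem hx, zero_mul]

theorem avgKernel_symm (ω : I → ℝ) (x y : X) : avgKernel hU ω x y = avgKernel hU ω y x := by
  classical
  rw [avgKernel_eq_sum hU ω (Finset.subset_union_left (s₂ := (hU.finite_mem y).toFinset)),
    avgKernel_eq_sum hU ω (Finset.subset_union_right (s₁ := (hU.finite_mem x).toFinset))]
  refine Finset.sum_congr rfl fun i _ => ?_
  by_cases hx : x ∈ U i <;> by_cases hy : y ∈ U i <;> simp [hx, hy]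

theorem avgKernel_nonneg (hω : ∀ i, 0 < ω i) (x y : X) : 0 ≤ avgKernel hU ω x y :=
  Finset.sum_nonneg fun i _ => indicator_nonneg (fun _ _ => (hω i).le) y

theorem stronglyMeasurable_avgKernel (ω : I → ℝ) :
    StronglyMeasurable (Function.uncurry (avgKernel hU ω)) := by
  have := hU.countable
  refine stronglyMeasurable_of_tendsto (u := (atTop : Filter (Finset I)))
    (f := fun t p => ∑ i ∈ t, (U i).indicator (fun _ => (1 : ℝ)) p.1 *
      (U i).indicator (fun _ => ω i) p.2) (fun t => ?_) ?_
  · refine Finset.stronglyMeasurable_fun_sum t fun i _ => StronglyMeasurable.mul ?_ ?_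
    · exact (stronglyMeasurable_const.indicator (hU.measurableSet i)).comp_measurable measurable_fst
    · exact (stronglyMeasurable_const.indicator (hU.measurableSet i)).comp_measurable measurable_snd
  · rw [tendsto_pi_nhds]
    rintro ⟨x, y⟩
    refine tendsto_const_nhds.congr' ?_
    filter_upwards [eventually_ge_atTop (hU.finite_mem x).toFinset] with t ht
    exact avgKernel_eq_sum hU ω ht

/-- At most N covering sets contain x, the weight is at most C on each, and ω_i μ(U_i) ≤ 1. So row
integrals are at most N C, and column integrals follow by symmetry. -/
theorem memKernelAlgebra_avgKernel {m : X → X → ℝ} {C : ℝ}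
    (hm : IsAdmissibleWeight m) (hC : ∀ i, ∀ x ∈ U i, ∀ y ∈ U i, m x y ≤ C)
    (hω : ∀ i, 0 < ω i) (hωμ : ∀ i, ENNReal.ofReal (ω i) * μ (U i) ≤ 1) :
    MemKernelAlgebra μ m fun x y => (avgKernel hU ω x y : ℂ) := by
  obtain ⟨N, hN⟩ := exists_card_le hU
  have row : ∀ x, ∫⁻ y, ‖(avgKernel hU ω x y : ℂ) * (m x y : ℂ)‖ₑ ∂μ
      ≤ N * ENNReal.ofReal C := by
    intro x
    have pt : ∀ y, ‖(avgKernel hU ω x y : ℂ) * (m x y : ℂ)‖ₑ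
        ≤ ∑ i ∈ (hU.finite_mem x).toFinset,
          (U i).indicator (fun _ => ENNReal.ofReal (ω i) * ENNReal.ofReal C) y := by
      intro y
      rw [← Complex.ofReal_mul, ← ofReal_norm, Complex.norm_real, Real.norm_of_nonneg
        (mul_nonneg (avgKernel_nonneg hU hω x y) (hm.pos x y).le), avgKernel, Finset.sum_mul,
        ENNReal.ofReal_sum_of_nonneg]
      · refine Finset.sum_le_sum fun i hi => ?_
        have hx : x ∈ U i := (hU.finite_mem x).mem_toFinset.1 hi
        by_cases hy : y ∈ U i
        · rw [indicator_of_mem hy, indicator_of_mem hy, ENNReal.ofReal_mul (hω i).le]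
          exact mul_le_mul_right (ENNReal.ofReal_le_ofReal (hC i x hx y hy)) _
        · simp [indicator_of_notMem hy]
      · exact fun i _ => mul_nonneg (indicator_nonneg (fun _ _ => (hω i).le) y) (hm.pos x y).le
    refine (lintegral_mono pt).trans ?_
    rw [lintegral_finsetSum _ fun i _ => measurable_const.indicator (hU.measurableSet i)]
    have : ∀ i ∈ (hU.finite_mem x).toFinset,
        ∫⁻ y, (U i).indicator (fun _ => ENNReal.ofReal (ω i) * ENNReal.ofReal C) y ∂μ
          ≤ ENNReal.ofReal C := fun i _ => by
      rw [lintegral_indicator_const (hU.measurableSet i), mul_right_comm]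
      exact mul_le_of_le_one_left zero_le (hωμ i)
    refine (Finset.sum_le_card_nsmul _ _ _ this).trans ?_
    rw [nsmul_eq_mul]
    exact mul_le_mul_left (by exact_mod_cast hN x) _
  have ht : (N : ℝ≥0∞) * ENNReal.ofReal C < ∞ :=
    ENNReal.mul_lt_top (ENNReal.natCast_lt_top N) ENNReal.ofReal_lt_top
  refine ⟨(Complex.continuous_ofReal.comp_stronglyMeasurable
    (stronglyMeasurable_avgKernel hU ω)).aestronglyMeasurable, max_lt
    (lt_of_le_of_lt (essSup_le_of_ae_le _ (ae_of_all _ row)) ht)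
    (lt_of_le_of_lt (essSup_le_of_ae_le _ (ae_of_all _ fun y => ?_)) ht)⟩
  refine (le_of_eq (lintegral_congr fun x => ?_)).trans (row y)
  rw [avgKernel_symm, hm.symm]

end AveragingKernel

/-! ### Unconditional sums in the weak-* topology. -/

section WeakStar

variable {X : Type u} {H : Type v} [NormedAddCommGroup H] [InnerProductSpace ℂ H]
  [TopologicalSpace X] [MeasurableSpace X] {μ : Measure X} {ψ : X → H} {v : X → ℝ}
  {Y : SolidBanachSpace.{u, w} μ} {I : Type*}

theorem hasSum_weakStar {φ : I → Co ψ v Y} {f : Co ψ v Y}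
    (h : ∀ k : H1 μ ψ v, HasSum (fun i => (φ i).1.1 k) (f.1.1 k)) :
    @HasSum (Co ψ v Y) I _ (Co.weakStar ψ v Y) φ f (SummationFilter.unconditional I) := by
  unfold HasSum
  rw [nhds_induced, tendsto_comap_iff, tendsto_pi_nhds]
  intro k
  have := h k
  unfold HasSum at this
  refine this.congr fun s => ?_
  simp

end WeakStar

theorem summable_and_norm_tsum_le {I : Type*} {f : I → ℂ} {B : ℝ}
    (h : ∀ J : Finset I, ∑ i ∈ J, ‖f i‖ ≤ B) : Summable f ∧ ‖∑' i, f i‖ ≤ B := by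
  have hs : Summable fun i => ‖f i‖ := summable_of_sum_le (fun _ => norm_nonneg _) h
  exact ⟨hs.of_norm, (norm_tsum_le_tsum_norm hs).trans (hs.tsum_le_of_sum_le h)⟩

/-! ### Atoms and the synthesis operator. -/

section Atomic

variable {X : Type u} {H : Type v} [NormedAddCommGroup H] [InnerProductSpace ℂ H]
  [TopologicalSpace X] [MeasurableSpace X] {μ : Measure X} [SigmaFinite μ]
  {A : ℝ} {ψ : X → H} {m : X → X → ℝ} {z : X} {Y : SolidBanachSpace.{u, w} μ} {c : ℝ}
  {I : Type*} {U : I → Set X} {Γ : X → X → ℂ} {ω : I → ℝ}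

namespace IsCoorbitSetting

/-- Domination of the synthesis sums by a function in `Y`. -/
theorem ae_sum_norm_le [IsFiniteMeasureOnCompacts μ] (S : IsCoorbitSetting A ψ m z Y c)
    (hU : IsAdmissibleCovering U)
    (hΓ : ∀ x y, ‖Γ x y‖ = 1) (hosc : MemKernelAlgebra μ m (fun x y => (osc A ψ U Γ x y : ℂ)))
    (hω : ∀ i, 0 < ω i) (hωμ : ∀ i, (μ (U i)).toReal * ω i = 1)
    {x : I → X} (hx : ∀ i, x i ∈ U i) {a : I → ℂ} {G : Y.carrier}
    (hG : Y.emb G =ᵐ[μ] fun y => (stepFun hU ω a y : ℂ)) :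
    ∀ᵐ w ∂μ, ∀ J : Finset I, ∑ i ∈ J, ‖a i‖ * ‖frameKernel A ψ w (x i)‖
      ≤ ‖Y.emb (S.module.op _ (S.kernel.norm.add S.weight hosc) G) w‖ := by
  classical
  have hN := S.kernel.norm.add S.weight hosc
  filter_upwards [S.module.emb_op_ae hN G, S.module.ae_integrable hN G] with w e2 hint J
  have e3 : ∀ y, ((‖frameKernel A ψ w y‖ : ℂ) + (osc A ψ U Γ w y : ℂ)) * (stepFun hU ω a y : ℂ)
      = (((‖frameKernel A ψ w y‖ + osc A ψ U Γ w y) * stepFun hU ω a y : ℝ) : ℂ) := fun y => by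
    push_cast; ring
  have hint' : Integrable (fun y => (‖frameKernel A ψ w y‖ + osc A ψ U Γ w y) *
      stepFun hU ω a y) μ := by
    have : Integrable (fun y => (((‖frameKernel A ψ w y‖ + osc A ψ U Γ w y) *
        stepFun hU ω a y : ℝ) : ℂ)) μ := by
      refine hint.congr ?_
      filter_upwards [hG] with y hy
      rw [hy, e3]
    exact this.re
  have h0 : ∀ y, 0 ≤ ‖frameKernel A ψ w y‖ + osc A ψ U Γ w y := fun y =>
    add_nonneg (norm_nonneg _) (osc_nonneg S.frame.bound_pos ψ U Γ w y)
  rw [e2, kernelApply_congr_ae hG, kernelApply]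
  simp only [e3]
  rw [integral_complex_ofReal, Complex.norm_real, Real.norm_of_nonneg
    (integral_nonneg fun y => mul_nonneg (h0 y) (stepFun_nonneg hU hω a y))]
  have hi : ∀ i, Integrable ((U i).indicator
      fun _ => ‖a i‖ * ω i * ‖frameKernel A ψ w (x i)‖) μ := fun i =>
    (integrableOn_const (hU.measure_lt_top i).ne).integrable_indicator (hU.measurableSet i)
  -- As μ(U_i) ω_i = 1, each term is the integral over U_i of a constant. For y in U_i the
  -- oscillation then replaces |R(w,x_i)| by |R(w,y)| + osc(w,y).
  have hterm : ∀ i, ‖a i‖ * ‖frameKernel A ψ w (x i)‖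
      = ∫ y, (U i).indicator (fun _ => ‖a i‖ * ω i * ‖frameKernel A ψ w (x i)‖) y ∂μ := fun i => by
    rw [integral_indicator_const _ (hU.measurableSet i), smul_eq_mul, Measure.real]
    calc _ = ((μ (U i)).toReal * ω i) * (‖a i‖ * ‖frameKernel A ψ w (x i)‖) := by
          rw [hωμ, one_mul]
      _ = _ := by ring
  rw [Finset.sum_congr rfl fun i _ => hterm i, ← integral_finsetSum _ fun i _ => hi i]
  refine integral_mono (integrable_finsetSum _ fun i _ => hi i) hint' fun y => ?_
  simp only [indicator_apply]
  rw [← Finset.sum_filter, stepFun, Finset.mul_sum]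
  calc _ ≤ ∑ i ∈ J.filter (fun i => y ∈ U i),
        (‖frameKernel A ψ w y‖ + osc A ψ U Γ w y) * (‖a i‖ * ω i) := by
        refine Finset.sum_le_sum fun i hi => ?_
        rw [mul_comm]
        exact mul_le_mul_of_nonneg_right (norm_frameKernel_le S.frame hU hΓ w
          (Finset.mem_filter.1 hi).2 (hx i)) (mul_nonneg (norm_nonneg _) (hω i).le)
    _ ≤ _ := by
        refine Finset.sum_le_sum_of_subset_of_nonneg (fun i hi => ?_) fun i _ _ =>
          mul_nonneg (h0 y) (mul_nonneg (norm_nonneg _) (hω i).le)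
        exact (hU.finite_mem y).mem_toFinset.2 (Finset.mem_filter.1 hi).2

variable [BorelSpace X] [CompleteSpace H] [TopologicalSpace.SeparableSpace H]

/-- The frame vectors belong to the coorbit space. -/
theorem exists_atom [IsFiniteMeasureOnCompacts μ] (S : IsCoorbitSetting A ψ m z Y c)
    (hU : IsAdmissibleCovering U)
    (hΓ : ∀ x y, ‖Γ x y‖ = 1) (hosc : MemKernelAlgebra μ m (fun x y => (osc A ψ U Γ x y : ℂ)))
    (hω : ∀ i, 0 < ω i) (hωμ : ∀ i, (μ (U i)).toReal * ω i = 1)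
    (hχ : ∀ i, ∃ F : Y.carrier, Y.emb F =ᵐ[μ] (U i).indicator fun _ => (1 : ℂ))
    {x : I → X} (hx : ∀ i, x i ∈ U i) (i : I) :
    ∃ g : Co ψ (fun x => m x z) Y,
      ∀ h : H1 μ ψ (fun x => m x z), g.1.1 h = inner ℂ (h : H) (ψ (x i)) := by
  classical
  have hA : (A : ℂ) ≠ 0 := by exact_mod_cast S.frame.bound_pos.ne'
  obtain ⟨χ, hχ⟩ := hχ i
  -- The unit sequence has step function ω_i χ_{U_i}, which is in Y. Domination with J = {i} and
  -- solidity put V ψ_{x_i} in Y.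
  have hG : Y.emb ((ω i : ℂ) • χ) =ᵐ[μ]
      fun y => (stepFun hU ω (Pi.single i (1 : ℂ)) y : ℂ) := by
    filter_upwards [Y.emb_smul_ae (ω i : ℂ) χ, hχ] with y h1 h2
    rw [h1, h2, stepFun]
    by_cases hy : y ∈ U i
    · rw [Finset.sum_eq_single_of_mem i ((hU.finite_mem y).mem_toFinset.2 hy) fun j _ hj => by
        simp [Pi.single_eq_of_ne hj]]
      simp [indicator_of_mem hy]
    · rw [Finset.sum_eq_zero fun j hj => ?_]
      · simp [indicator_of_notMem hy]
      · have hyj : y ∈ U j := (hU.finite_mem y).mem_toFinset.1 hj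
        have hj : j ≠ i := fun h => hy (h ▸ hyj)
        simp [Pi.single_eq_of_ne hj]
  have hle := S.ae_sum_norm_le hU hΓ hosc hω hωμ hx hG
  set D := S.module.op _ (S.kernel.norm.add S.weight hosc) ((ω i : ℂ) • χ) with hD
  obtain ⟨G', hG', -⟩ := Y.exists_of_ae_le
    (S.frame.stronglyMeasurable_transform (ψ (x i))).aestronglyMeasurable ((A : ℂ) • D) (by
      filter_upwards [hle, Y.emb_smul_ae (A : ℂ) D] with w h1 h2
      have h3 := h1 {i}
      rw [Finset.sum_singleton, Pi.single_eq_same, norm_one, one_mul] at h3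
      rw [h2, transform_eq_frameKernel S.frame.bound_pos, norm_mul, norm_mul]
      exact mul_le_mul_of_nonneg_left h3 (norm_nonneg _))
  have hfix : G' ∈ S.fixed := by
    rw [S.mem_fixed]
    apply Y.ext_of_ae
    filter_upwards [S.emb_proj_ae G', hG'] with w h1 h2
    rw [h1, h2, kernelApply_congr_ae hG']
    exact S.frame.integral_frameKernel_mul _ _
  obtain ⟨f, hf⟩ := S.exists_co_of_mem_fixed hfix
  refine ⟨f, fun h => ?_⟩
  have h1 := Co.emb_toY_ae f
  rw [hf] at h1
  rw [antidual_apply_eq S.frame S.weight_pos S.measurable_weight S.mem_H1 f.1]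
  have h2 : ∫ y, conj (transform ψ h y) * extTransform μ ψ (fun x => m x z) f.1 y ∂μ
      = A * inner ℂ (h : H) (ψ (x i)) := by
    rw [← S.frame.integral_conj_mul]
    refine integral_congr_ae ?_
    filter_upwards [h1, hG'] with y e1 e2
    rw [← e1, e2]
  rw [h2, inv_mul_cancel_left₀ hA]

/-- Weak-* convergence of the synthesis sums. -/
theorem exists_synthesis [IsFiniteMeasureOnCompacts μ] [SigmaCompactSpace X]
    (S : IsCoorbitSetting A ψ m z Y c) (hU : IsAdmissibleCovering U)
    (hΓ : ∀ x y, ‖Γ x y‖ = 1) (hosc : MemKernelAlgebra μ m (fun x y => (osc A ψ U Γ x y : ℂ)))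
    (hω : ∀ i, 0 < ω i) (hωμ : ∀ i, (μ (U i)).toReal * ω i = 1)
    {x : I → X} (hx : ∀ i, x i ∈ U i) {g : I → Co ψ (fun x => m x z) Y}
    (hg : ∀ i (h : H1 μ ψ (fun x => m x z)), (g i).1.1 h = inner ℂ (h : H) (ψ (x i))) :
    ∃ k : ℝ, 0 ≤ k ∧ ∀ (a : I → ℂ) (G : Y.carrier),
      (Y.emb G =ᵐ[μ] fun y => (stepFun hU ω a y : ℂ)) → ∃ f : Co ψ (fun x => m x z) Y,
        (∀ h, HasSum (fun i => a i * (g i).1.1 h) (f.1.1 h)) ∧ ‖f‖ ≤ k * ‖G‖ := by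
  have hA := S.frame.bound_pos
  have hN := S.kernel.norm.add S.weight hosc
  obtain ⟨d, hd0, hd⟩ := S.exists_norm_apply_le
  refine ⟨A * (kernelNorm μ m fun x y =>
    (‖frameKernel A ψ x y‖ : ℂ) + (osc A ψ U Γ x y : ℂ)).toReal,
    mul_nonneg hA.le ENNReal.toReal_nonneg, fun a G hG => ?_⟩
  have hle := S.ae_sum_norm_le hU hΓ hosc hω hωμ hx hG
  set D := S.module.op _ hN G with hD
  have hDn : ‖(A : ℂ) • D‖ ≤ A * (kernelNorm μ m fun x y =>
      (‖frameKernel A ψ x y‖ : ℂ) + (osc A ψ U Γ x y : ℂ)).toReal * ‖G‖ := by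
    rw [norm_smul, Complex.norm_real, Real.norm_of_nonneg hA.le, mul_assoc]
    exact mul_le_mul_of_nonneg_left (S.module.norm_op_le hN G) hA.le
  have hgψ : ∀ i w, (g i).1.1 ⟨ψ w, (S.mem_H1 w).1⟩ = A * frameKernel A ψ w (x i) := fun i w => by
    rw [hg, ← transform_eq_frameKernel hA]
    rfl
  have hleA : ∀ᵐ w ∂μ, ∀ J : Finset I,
      ∑ i ∈ J, ‖a i‖ * ‖(g i).1.1 ⟨ψ w, (S.mem_H1 w).1⟩‖ ≤ ‖Y.emb ((A : ℂ) • D) w‖ := by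
    filter_upwards [hle, Y.emb_smul_ae (A : ℂ) D] with w h1 h2 J
    rw [h2, norm_mul]
    have : ∀ i ∈ J, ‖a i‖ * ‖(g i).1.1 ⟨ψ w, (S.mem_H1 w).1⟩‖
        = ‖(A : ℂ)‖ * (‖a i‖ * ‖frameKernel A ψ w (x i)‖) := fun i _ => by
      rw [hgψ, norm_mul]; ring
    rw [Finset.sum_congr rfl this, ← Finset.mul_sum]
    exact mul_le_mul_of_nonneg_left (h1 J) (norm_nonneg _)
  -- finite sums
  have hfin : ∀ (b : I → ℂ), (∀ i, ‖b i‖ ≤ ‖a i‖) → ∀ (J : Finset I)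
      (h : H1 μ ψ (fun x => m x z)), ‖∑ i ∈ J, b i * (g i).1.1 h‖
        ≤ d * ‖(A : ℂ) • D‖ * H1norm μ ψ (fun x => m x z) h := by
    intro b hb J h
    let f : Co ψ (fun x => m x z) Y := ∑ i ∈ J, b i • g i
    have hf : ∀ h, f.1.1 h = ∑ i ∈ J, b i * (g i).1.1 h := fun h => by
      simp [f]
    have hfn : ‖f‖ ≤ ‖(A : ℂ) • D‖ := by
      rw [← Co.norm_toY f]
      refine Y.norm_le_of_ae_le ?_
      filter_upwards [Co.emb_toY_ae f, hleA] with w h1 h2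
      rw [h1, extTransform_eq f.1 (S.mem_H1 w).1, hf]
      refine (norm_sum_le _ _).trans ((Finset.sum_le_sum fun i _ => ?_).trans (h2 J))
      rw [norm_mul]
      exact mul_le_mul_of_nonneg_right (hb i) (norm_nonneg _)
    rw [← hf]
    refine (hd f h).trans (mul_le_mul_of_nonneg_right (mul_le_mul_of_nonneg_left hfn hd0) ?_)
    exact integral_nonneg fun y => mul_nonneg (norm_nonneg _) (S.weight_pos y).le
  have habs : ∀ (h : H1 μ ψ (fun x => m x z)) (J : Finset I),
      ∑ i ∈ J, ‖a i * (g i).1.1 h‖ ≤ d * ‖(A : ℂ) • D‖ * H1norm μ ψ (fun x => m x z) h := by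
    intro h J
    let t : I → ℂ := fun i => a i * (g i).1.1 h
    -- Rotating the coefficients makes every term non-negative without changing moduli, so the
    -- uniform bound on finite sums becomes absolute summability.
    let b : I → ℂ := fun i => a i * (conj (t i) / ‖t i‖)
    have hb : ∀ i, ‖b i‖ ≤ ‖a i‖ := fun i => by
      rw [norm_mul, norm_div, RCLike.norm_conj, Complex.norm_real, norm_norm]
      exact mul_le_of_le_one_right (norm_nonneg _) (div_self_le_one _)
    have e : ∀ i, b i * (g i).1.1 h = (‖t i‖ : ℂ) := fun i => by
      have e1 : b i * (g i).1.1 h = t i * conj (t i) / ‖t i‖ := by simp only [b, t]; ring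
      rw [e1, Complex.mul_conj, Complex.normSq_eq_norm_sq]
      by_cases h0 : ‖t i‖ = 0
      · simp [h0]
      · have : (‖t i‖ : ℂ) ≠ 0 := by exact_mod_cast h0
        push_cast
        field_simp
    have h1 := hfin b hb J h
    rw [Finset.sum_congr rfl fun i _ => e i, ← Complex.ofReal_sum, Complex.norm_real] at h1
    exact (le_abs_self _).trans h1
  have hsum : ∀ h, Summable fun i => a i * (g i).1.1 h := fun h =>
    (summable_and_norm_tsum_le (habs h)).1
  let f₀ : H1 μ ψ (fun x => m x z) →ₛₗ[starRingEnd ℂ] ℂ :=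
    { toFun := fun h => ∑' i, a i * (g i).1.1 h
      map_add' := fun h k => by
        rw [← (hsum h).tsum_add (hsum k)]
        congr 1; ext i
        rw [map_add, mul_add]
      map_smul' := fun k h => by
        rw [smul_eq_mul, ← tsum_mul_left]
        congr 1; ext i
        rw [LinearMap.map_smulₛₗ, smul_eq_mul]
        ring }
  -- The limit functional inherits the uniform bound. Its transform is pointwise dominated by A D,
  -- so solidity places it in the coorbit space.
  let f₁ : antidual μ ψ (fun x => m x z) :=
    ⟨f₀, d * ‖(A : ℂ) • D‖, fun h => (summable_and_norm_tsum_le (habs h)).2⟩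
  obtain ⟨G', hG', hG'n⟩ := Y.exists_of_ae_le
    (stronglyMeasurable_extTransform S.frame S.weight_pos S.measurable_weight
      (fun x => (S.mem_H1 x).1) f₁).aestronglyMeasurable ((A : ℂ) • D) (by
      filter_upwards [hleA] with w hw
      rw [extTransform_eq f₁ (S.mem_H1 w).1]
      refine (summable_and_norm_tsum_le (f := fun i => a i * (g i).1.1 ⟨ψ w, (S.mem_H1 w).1⟩)
        fun J => ?_).2
      simp only [norm_mul]
      exact hw J)
  let f : Co ψ (fun x => m x z) Y := ⟨f₁, G', hG'⟩
  have hf : Co.toY ψ (fun x => m x z) Y f = G' :=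
    Y.ext_of_ae ((Co.emb_toY_ae f).trans hG'.symm)
  refine ⟨f, fun h => (hsum h).hasSum, ?_⟩
  rw [← Co.norm_toY f, hf]
  exact hG'n.trans hDn

end IsCoorbitSetting

end Atomic

/-! ### The transposed Neumann series on L¹. -/

section NeumannSeries

variable {X : Type*} [MeasurableSpace X] {μ : Measure X} [SigmaFinite μ] {E : X → X → ℂ}
  {k : ℝ≥0∞}

theorem lintegral_enorm_kernel_mul_le (hE : StronglyMeasurable (Function.uncurry E))
    (hb : ∀ᵐ x ∂μ, ∫⁻ y, ‖E x y‖ₑ ∂μ ≤ k) {κ : X → ℂ} (hκ : AEStronglyMeasurable κ μ) :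
    ∫⁻ p, ‖E p.1 p.2 * κ p.1‖ₑ ∂μ.prod μ ≤ k * ∫⁻ x, ‖κ x‖ₑ ∂μ := by
  have hm : AEStronglyMeasurable (fun p : X × X => E p.1 p.2 * κ p.1) (μ.prod μ) :=
    hE.aestronglyMeasurable.mul hκ.comp_fst
  rw [lintegral_prod _ hm.enorm, ← lintegral_const_mul'' _ hκ.enorm]
  refine lintegral_mono_ae ?_
  filter_upwards [hb] with x hx
  simp only [enorm_mul]
  rw [lintegral_mul_const']
  · exact mul_le_mul_left hx _
  · exact enorm_ne_top

theorem integrable_kernel_mul (hE : StronglyMeasurable (Function.uncurry E)) (hk : k < ∞)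
    (hb : ∀ᵐ x ∂μ, ∫⁻ y, ‖E x y‖ₑ ∂μ ≤ k) {κ : X → ℂ} (hκ : Integrable κ μ) :
    Integrable (fun p : X × X => E p.1 p.2 * κ p.1) (μ.prod μ) :=
  ⟨hE.aestronglyMeasurable.mul hκ.1.comp_fst,
    (lintegral_enorm_kernel_mul_le hE hb hκ.1).trans_lt (ENNReal.mul_lt_top hk hκ.2)⟩

/-- The adjoint of a kernel operator of norm less than `1` on `L^∞` is inverted on `L¹`. -/
theorem exists_integrable_sub_eq (hE : StronglyMeasurable (Function.uncurry E)) (hk : k < 1)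
    (hb : ∀ᵐ x ∂μ, ∫⁻ y, ‖E x y‖ₑ ∂μ ≤ k) {u : X → ℂ} (hu : Integrable u μ) :
    ∃ κ : X → ℂ, Integrable κ μ ∧ ∀ᵐ y ∂μ, κ y - ∫ x, E x y * κ x ∂μ = u y := by
  have hkt : k < ∞ := hk.trans ENNReal.one_lt_top
  have hp := fun κ : Lp ℂ 1 μ => integrable_kernel_mul hE hkt hb (L1.integrable_coeFn κ)
  have hi : ∀ κ : Lp ℂ 1 μ, Integrable (fun y => ∫ x, E x y * κ x ∂μ) μ := fun κ =>
    (hp κ).integral_prod_right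
  have hs : ∀ κ : Lp ℂ 1 μ, ∀ᵐ y ∂μ, Integrable (fun x => E x y * κ x) μ := fun κ =>
    (hp κ).prod_left_ae
  -- The transpose integrates over the first variable, so the row bound on E is exactly what bounds
  -- it on L¹ by k.
  let T₀ : Lp ℂ 1 μ →ₗ[ℂ] Lp ℂ 1 μ :=
    { toFun := fun κ => (hi κ).toL1 _
      map_add' := fun κ₁ κ₂ => by
        rw [← Integrable.toL1_add, Integrable.toL1_eq_toL1_iff]
        filter_upwards [hs κ₁, hs κ₂] with y h1 h2
        rw [Pi.add_apply, ← integral_add h1 h2]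
        refine integral_congr_ae ?_
        filter_upwards [Lp.coeFn_add κ₁ κ₂] with x hx
        rw [hx, Pi.add_apply, mul_add]
      map_smul' := fun c κ => by
        rw [RingHom.id_apply, ← Integrable.toL1_smul', Integrable.toL1_eq_toL1_iff]
        refine ae_of_all _ fun y => ?_
        rw [Pi.smul_apply, ← integral_smul]
        refine integral_congr_ae ?_
        filter_upwards [Lp.coeFn_smul c κ] with x hx
        rw [hx, Pi.smul_apply, smul_eq_mul, smul_eq_mul]
        ring }
  have hT₀ : ∀ κ, ‖T₀ κ‖ ≤ k.toReal * ‖κ‖ := fun κ => by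
    have h1 : ‖T₀ κ‖ₑ ≤ k * ‖κ‖ₑ := by
      rw [Lp.enorm_def, Lp.enorm_def, eLpNorm_one_eq_lintegral_enorm,
        eLpNorm_one_eq_lintegral_enorm]
      refine le_trans ?_ (lintegral_enorm_kernel_mul_le hE hb (Lp.aestronglyMeasurable κ))
      rw [lintegral_prod_symm _ (hp κ).1.enorm]
      refine lintegral_mono_ae ?_
      filter_upwards [Integrable.coeFn_toL1 (hi κ)] with y hy
      change ‖(Integrable.toL1 _ (hi κ)) y‖ₑ ≤ _
      rw [hy]
      exact enorm_integral_le_lintegral_enorm _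
    have h2 := ENNReal.toReal_mono (ENNReal.mul_ne_top hkt.ne enorm_ne_top) h1
    rwa [ENNReal.toReal_mul, toReal_enorm, toReal_enorm] at h2
  have hk1 : k.toReal < 1 := by
    have := (ENNReal.toReal_lt_toReal hkt.ne ENNReal.one_ne_top).2 hk
    simpa using this
  let T : Lp ℂ 1 μ →L[ℂ] Lp ℂ 1 μ := T₀.mkContinuous k.toReal hT₀
  have hT : ‖T‖ < 1 := (T₀.mkContinuous_norm_le ENNReal.toReal_nonneg hT₀).trans_lt hk1
  let t := Units.oneSub T hT
  let κ : Lp ℂ 1 μ := (↑t⁻¹ : Lp ℂ 1 μ →L[ℂ] Lp ℂ 1 μ) (hu.toL1 u)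
  have h1 : κ - T κ = hu.toL1 u := by
    have e : (↑t * ↑t⁻¹ : Lp ℂ 1 μ →L[ℂ] Lp ℂ 1 μ) (hu.toL1 u) = hu.toL1 u := by
      rw [Units.mul_inv]
      rfl
    exact e
  refine ⟨κ, L1.integrable_coeFn κ, ?_⟩
  have h2 := Lp.coeFn_sub κ (T κ)
  rw [h1] at h2
  filter_upwards [h2, hu.coeFn_toL1, Integrable.coeFn_toL1 (hi κ)] with y e1 e2 e3
  rw [e2, Pi.sub_apply] at e1
  rw [e1]
  change _ = _ - (Integrable.toL1 _ (hi κ)) y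
  rw [e3]

/-- By Fubini, pairing κ with (1 − E)F is pairing (1 − Eᵗ)κ = u with F. Boundedness of F and
integrability of κ justify the exchange. -/
theorem integral_mul_sub_kernel (hE : StronglyMeasurable (Function.uncurry E)) (hk : k < ∞)
    (hb : ∀ᵐ x ∂μ, ∫⁻ y, ‖E x y‖ₑ ∂μ ≤ k) {u κ : X → ℂ} (hκ : Integrable κ μ)
    (h : ∀ᵐ y ∂μ, κ y - ∫ x, E x y * κ x ∂μ = u y) {F : X → ℂ} (hF : AEStronglyMeasurable F μ)
    {d : ℝ} (hd : ∀ᵐ x ∂μ, ‖F x‖ ≤ d) :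
    ∫ x, κ x * (F x - ∫ y, E x y * F y ∂μ) ∂μ = ∫ y, u y * F y ∂μ := by
  have hp : Integrable (fun p : X × X => E p.1 p.2 * κ p.1 * F p.2) (μ.prod μ) := by
    refine (integrable_kernel_mul hE hk hb hκ).mul_bdd hF.comp_snd
      (Measure.quasiMeasurePreserving_snd.ae hd)
  have h1 : Integrable (fun x => κ x * F x) μ := hκ.mul_bdd hF hd
  have e1 : ∀ x, ∫ y, E x y * κ x * F y ∂μ = κ x * ∫ y, E x y * F y ∂μ := fun x => by
    rw [← integral_const_mul]
    exact integral_congr_ae (ae_of_all _ fun y => by ring)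
  have e2 : ∀ y, ∫ x, E x y * κ x * F y ∂μ = (∫ x, E x y * κ x ∂μ) * F y := fun y =>
    integral_mul_const _ _
  have i1 := hp.integral_prod_left
  have i2 := hp.integral_prod_right
  have sw := integral_integral_swap (f := fun x y => E x y * κ x * F y) hp
  simp only [e1, e2] at i1 i2 sw
  simp only [mul_sub]
  rw [integral_sub h1 i1, sw, ← integral_sub h1 i2]
  refine integral_congr_ae ?_
  filter_upwards [h] with y hy
  rw [← sub_mul, hy]

end NeumannSeries

/-! ### Coefficient functionals as vectors of H¹_v. -/

section Predual

variable {X : Type u} {H : Type v} [NormedAddCommGroup H] [InnerProductSpace ℂ H]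
  [TopologicalSpace X] [MeasurableSpace X] {μ : Measure X} {A : ℝ} {ψ : X → H}

/-- A weighted integrable function `K` yields a vector `∫ conj (K y) ψ_y dμ(y)` of `H¹_v`. -/
theorem exists_H1_of_integrable [BorelSpace X] [SigmaFinite μ] [CompleteSpace H]
    [TopologicalSpace.SeparableSpace H] (hψ : IsContinuousTightFrame μ A ψ) {v : X → ℝ}
    (hv : ∀ x, 1 ≤ v x) (hvm : Measurable v) {c : ℝ}
    (hH : ∀ x, ψ x ∈ H1 μ ψ v ∧ H1norm μ ψ v (ψ x) ≤ c * v x) {M : ℝ}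
    (hM : ∀ᵐ y ∂μ, ‖ψ y‖ ≤ M) {K : X → ℂ} (hKm : AEStronglyMeasurable K μ)
    (hK : Integrable (fun y => ‖K y‖ * v y) μ) :
    ∃ h : H1 μ ψ v, ∀ f : antidual μ ψ v,
      f.1 h = ∫ y, K y * extTransform μ ψ v f y ∂μ := by
  have hA : (A : ℂ) ≠ 0 := by exact_mod_cast hψ.bound_pos.ne'
  have hv0 : ∀ x, 0 < v x := fun x => zero_lt_one.trans_le (hv x)
  have hv' : ∀ x, 0 ≤ v x := fun x => (hv0 x).le
  have hK1 : Integrable K μ := hK.mono' hKm (ae_of_all _ fun y =>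
    le_mul_of_one_le_right (norm_nonneg _) (hv y))
  have hKc : AEStronglyMeasurable (fun y => conj (K y)) μ :=
    Complex.continuous_conj.comp_aestronglyMeasurable hKm
  -- K is integrable because v ≥ 1. With the essential bound on ‖ψ_y‖, the vector exists as a
  -- Bochner integral in the Hilbert space.
  have hint : Integrable (fun y => conj (K y) • ψ y) μ := by
    refine (hK1.norm.mul_const M).mono' (hKc.smul hψ.stronglyMeasurable.aestronglyMeasurable) ?_
    filter_upwards [hM] with y hy
    rw [norm_smul, RCLike.norm_conj]
    exact mul_le_mul_of_nonneg_left hy (norm_nonneg _)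
  have hR : StronglyMeasurable fun p : X × X => transform ψ (ψ p.1) p.2 := by
    have h1 := (hψ.stronglyMeasurable_frameKernel.comp_measurable measurable_swap).const_mul (A : ℂ)
    have e : (fun p : X × X => transform ψ (ψ p.1) p.2)
        = fun p => A * (Function.uncurry (frameKernel A ψ) ∘ Prod.swap) p := by
      ext p
      exact transform_eq_frameKernel hψ.bound_pos ψ p.2 p.1
    rw [e]
    exact h1
  -- Fubini for `conj K(y) V ψ_y(x) G(x)` with `|G| ≤ d v`
  have hfub : ∀ (G : X → ℂ), AEStronglyMeasurable G μ → ∀ d : ℝ, 0 ≤ d → (∀ x, ‖G x‖ ≤ d * v x) →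
      Integrable (fun p : X × X => conj (K p.1) * transform ψ (ψ p.1) p.2 * G p.2)
        (μ.prod μ) := by
    intro G hG d hd0 hd
    have hm : AEStronglyMeasurable
        (fun p : X × X => conj (K p.1) * transform ψ (ψ p.1) p.2 * G p.2) (μ.prod μ) :=
      (hKc.comp_fst.mul hR.aestronglyMeasurable).mul hG.comp_snd
    have hb : ∀ y x, ‖transform ψ (ψ y) x * G x‖ ≤ d * (‖transform ψ (ψ y) x‖ * v x) :=
      fun y x => by
        rw [norm_mul]
        calc _ ≤ ‖transform ψ (ψ y) x‖ * (d * v x) :=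
              mul_le_mul_of_nonneg_left (hd x) (norm_nonneg _)
          _ = _ := by ring
    have hi : ∀ y, Integrable (fun x => transform ψ (ψ y) x * G x) μ := fun y =>
      ((H1.integrable_norm_mul hv' ⟨ψ y, (hH y).1⟩).const_mul d).mono'
        ((hψ.stronglyMeasurable_transform _).aestronglyMeasurable.mul hG)
        (ae_of_all _ (hb y))
    refine (integrable_prod_iff hm).2 ⟨ae_of_all _ fun y => ?_, ?_⟩
    · simpa only [mul_assoc] using (hi y).const_mul (conj (K y))
    · refine (hK.const_mul (d * c)).mono' hm.norm.integral_prod_right' (ae_of_all _ fun y => ?_)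
      have e : ∀ x, ‖conj (K y) * transform ψ (ψ y) x * G x‖
          = ‖K y‖ * ‖transform ψ (ψ y) x * G x‖ := fun x => by
        rw [mul_assoc, norm_mul, RCLike.norm_conj]
      rw [Real.norm_of_nonneg (integral_nonneg fun x => norm_nonneg _)]
      simp only [e]
      rw [integral_const_mul]
      have h1 : ∫ x, ‖transform ψ (ψ y) x * G x‖ ∂μ ≤ d * (c * v y) := by
        refine (integral_mono (hi y).norm
          ((H1.integrable_norm_mul hv' ⟨ψ y, (hH y).1⟩).const_mul d) (hb y)).trans ?_
        rw [integral_const_mul]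
        exact mul_le_mul_of_nonneg_left (hH y).2 hd0
      calc _ ≤ ‖K y‖ * (d * (c * v y)) := mul_le_mul_of_nonneg_left h1 (norm_nonneg _)
        _ = _ := by ring
  let h₀ : H := ∫ y, conj (K y) • ψ y ∂μ
  have hVh : ∀ x, transform ψ h₀ x = ∫ y, conj (K y) * transform ψ (ψ y) x ∂μ := fun x => by
    simp only [transform, h₀]
    rw [← integral_inner hint]
    simp only [inner_smul_right]
  have hVhG : ∀ (G : X → ℂ) x, ∫ y, conj (K y) * transform ψ (ψ y) x * G x ∂μ
      = transform ψ h₀ x * G x := fun G x => by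
    rw [integral_mul_const, hVh]
  have hmem : h₀ ∈ H1 μ ψ v := by
    have := (hfub (fun x => (v x : ℂ))
      (Complex.measurable_ofReal.comp hvm).aestronglyMeasurable 1 zero_le_one fun x => by
        rw [Complex.norm_real, Real.norm_of_nonneg (hv' x), one_mul]).integral_prod_right
    exact this.congr (ae_of_all _ fun x => hVhG (fun x => (v x : ℂ)) x)
  refine ⟨⟨h₀, hmem⟩, fun f => ?_⟩
  obtain ⟨d, hd0, hd⟩ := exists_norm_extTransform_le hH hv' f
  have hFm := stronglyMeasurable_extTransform hψ hv0 hvm (fun x => (hH x).1) f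
  set F := extTransform μ ψ v f with hFdef
  have hG := hfub (fun x => conj (F x))
    (Complex.continuous_conj.comp_stronglyMeasurable hFm).aestronglyMeasurable d hd0 fun x => by
      rw [RCLike.norm_conj]; exact hd x
  have sw := integral_integral_swap
    (f := fun y x => conj (K y) * transform ψ (ψ y) x * conj (F x)) hG
  have e : ∀ x, ∫ y, conj (K y) * transform ψ (ψ y) x * conj (F x) ∂μ
      = transform ψ h₀ x * conj (F x) := fun x => hVhG (fun x => conj (F x)) x
  simp only [e] at sw
  have h1 : ∫ x, conj (transform ψ h₀ x) * F x ∂μ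
      = conj (∫ x, transform ψ h₀ x * conj (F x) ∂μ) := by
    rw [← integral_conj]
    simp
  rw [antidual_apply_eq hψ hv0 hvm hH f ⟨h₀, hmem⟩, h1, ← sw, ← integral_conj,
    ← integral_const_mul]
  refine integral_congr_ae (ae_of_all _ fun y => ?_)
  have h2 := integral_conj_transform_frame hψ F y
  rw [kernelApply_extTransform hψ hv0 hvm hH f, ← hFdef] at h2
  simp only
  rw [← integral_conj]
  simp only [map_mul, Complex.conj_conj, mul_assoc]
  rw [integral_const_mul, h2]
  field_simp

/-- ‖ψ_w‖² = A R(w,w). Integrating |R(w,w)| ≤ |R(w,y)| + osc(w,y) over a covering set containing w,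
of measure at least D, bounds this by a row integral divided by D; m ≥ 1 allows the weight to be
inserted. -/
theorem exists_ae_norm_frame_le [BorelSpace X] [SFinite μ] [CompleteSpace H]
    [TopologicalSpace.SeparableSpace H] {I : Type*} {U : I → Set X}
    {Γ : X → X → ℂ} {m : X → X → ℝ} (hψ : IsContinuousTightFrame μ A ψ)
    (hm : IsAdmissibleWeight m)
    (hK : MemKernelAlgebra μ m (frameKernel A ψ)) (hΓ : ∀ x y, ‖Γ x y‖ = 1)
    (hU : IsModerateAdmissibleCovering μ U)
    (hosc : MemKernelAlgebra μ m (fun x y => (osc A ψ U Γ x y : ℂ))) :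
    ∃ M : ℝ, ∀ᵐ y ∂μ, ‖ψ y‖ ≤ M := by
  obtain ⟨D, hD0, hD⟩ := hU.lower
  have hA := hψ.bound_pos
  set k := kernelNorm μ m (frameKernel A ψ) + kernelNorm μ m (fun x y => (osc A ψ U Γ x y : ℂ))
    with hk
  have hkt : k < ∞ := ENNReal.add_lt_top.2 ⟨hK.2, hosc.2⟩
  refine ⟨√(A * (k.toReal / D)), ?_⟩
  have r1 := ae_lintegral_le_kernelNorm (μ := μ) (m := m) fun x y => frameKernel A ψ y x
  have r2 := ae_lintegral_le_kernelNorm (μ := μ) (m := m) fun x y => (osc A ψ U Γ y x : ℂ)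
  rw [kernelNorm_swap hm (frameKernel A ψ)] at r1
  rw [kernelNorm_swap hm fun x y => (osc A ψ U Γ x y : ℂ)] at r2
  filter_upwards [r1, r2] with w h1 h2
  obtain ⟨i, hi⟩ := hU.toIsAdmissibleCovering.exists_mem w
  have e : ‖frameKernel A ψ w w‖ = A⁻¹ * ‖ψ w‖ ^ 2 := by
    rw [frameKernel, transform, norm_mul, norm_inv, Complex.norm_real, Real.norm_of_nonneg hA.le,
      inner_self_eq_norm_sq_to_K]
    simp
  have hmeas : Measurable fun y => ‖frameKernel A ψ w y * (m y w : ℂ)‖ₑ := by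
    have e1 : Measurable fun y => frameKernel A ψ w y :=
      hψ.stronglyMeasurable_frameKernel.measurable.comp (measurable_const.prodMk measurable_id)
    have hmw : Measurable fun y => m y w :=
      hm.measurable.comp (measurable_id.prodMk measurable_const)
    exact (e1.mul (Complex.measurable_ofReal.comp hmw)).enorm
  have pt : ∀ y ∈ U i, ‖frameKernel A ψ w w‖ₑ ≤ ‖frameKernel A ψ w y * (m y w : ℂ)‖ₑ
      + ‖(osc A ψ U Γ w y : ℂ) * (m y w : ℂ)‖ₑ := fun y hy => by
    have o := osc_nonneg hA ψ U Γ w y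
    rw [← ofReal_norm, ← ofReal_norm, ← ofReal_norm, ← ENNReal.ofReal_add (norm_nonneg _)
      (norm_nonneg _)]
    refine ENNReal.ofReal_le_ofReal ((norm_frameKernel_le hψ hU.toIsAdmissibleCovering hΓ w hy
      hi).trans (add_le_add ?_ ?_))
    · rw [norm_mul, Complex.norm_real, Real.norm_of_nonneg (hm.pos y w).le]
      exact le_mul_of_one_le_right (norm_nonneg _) (hm.one_le y w)
    · rw [norm_mul, Complex.norm_real, Complex.norm_real, Real.norm_of_nonneg (hm.pos y w).le,
        Real.norm_of_nonneg o]
      exact le_mul_of_one_le_right o (hm.one_le y w)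
  have h3 : ‖frameKernel A ψ w w‖ₑ * ENNReal.ofReal D ≤ k := by
    calc _ ≤ ‖frameKernel A ψ w w‖ₑ * μ (U i) := mul_le_mul_right (hD i) _
      _ = ∫⁻ _ in U i, ‖frameKernel A ψ w w‖ₑ ∂μ := (setLIntegral_const _ _).symm
      _ ≤ ∫⁻ y in U i, (‖frameKernel A ψ w y * (m y w : ℂ)‖ₑ
          + ‖(osc A ψ U Γ w y : ℂ) * (m y w : ℂ)‖ₑ) ∂μ := setLIntegral_mono' (hU.measurableSet i) pt
      _ ≤ ∫⁻ y, (‖frameKernel A ψ w y * (m y w : ℂ)‖ₑ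
          + ‖(osc A ψ U Γ w y : ℂ) * (m y w : ℂ)‖ₑ) ∂μ := setLIntegral_le_lintegral _ _
      _ ≤ k := by
          rw [lintegral_add_left hmeas]
          exact add_le_add h1 h2
  have h4 := ENNReal.toReal_mono hkt.ne h3
  rw [ENNReal.toReal_mul, toReal_enorm, ENNReal.toReal_ofReal hD0.le, e, inv_mul_eq_div,
    div_mul_eq_mul_div, div_le_iff₀ hA] at h4
  refine Real.le_sqrt_of_sq_le ?_
  rw [mul_div_assoc', le_div_iff₀ hD0]
  linarith

/-- Coefficient functionals have to be of this kind, since `IsAtomicDecomposition` demands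
continuity for its topology `τ`. -/
theorem Co.exists_weakStar_eval {v : X → ℝ} {Y : SolidBanachSpace.{u, w} μ} (h : H1 μ ψ v) :
    ∃ L : @ContinuousLinearMap ℂ ℂ _ _ (RingHom.id ℂ) (Co ψ v Y) (Co.weakStar ψ v Y) _ ℂ _ _ _ _,
      ∀ f : Co ψ v Y, L f = f.1.1 h := by
  let _ := Co.weakStar ψ v Y
  exact ⟨⟨⟨⟨fun f => f.1.1 h, fun f g => rfl⟩, fun c f => rfl⟩,
    (continuous_apply h).comp continuous_induced_dom⟩, fun f => rfl⟩

namespace IsCoorbitSetting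

variable {m : X → X → ℝ} {z : X} {Y : SolidBanachSpace.{u, w} μ} {c : ℝ} {I : Type*}
  {U : I → Set X}

theorem ae_norm_le_of_mem_fixed (S : IsCoorbitSetting A ψ m z Y c) {F : Y.carrier}
    (hF : F ∈ S.fixed) : ∃ d : ℝ, ∀ᵐ x ∂μ, ‖Y.emb F x‖ ≤ d * m x z := by
  obtain ⟨d, hd⟩ := S.kernel_bound F
  have h1 := S.emb_proj_ae F
  rw [S.mem_fixed.1 hF] at h1
  refine ⟨d, ?_⟩
  filter_upwards [h1, hd] with x e1 e2
  rwa [e1]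

/-- The coefficient functionals are represented by vectors of `H¹_v`. -/
theorem exists_H1_coefficient [BorelSpace X] [SigmaFinite μ] [IsFiniteMeasureOnCompacts μ]
    [CompleteSpace H] [TopologicalSpace.SeparableSpace H] (S : IsCoorbitSetting A ψ m z Y c)
    {M : ℝ} (hM : ∀ᵐ y ∂μ, ‖ψ y‖ ≤ M) (hU : IsAdmissibleCovering U) {C : ℝ}
    (hC : ∀ i, ∀ x ∈ U i, ∀ y ∈ U i, m x y ≤ C) {γ : X → ℂ} (hγ : Measurable γ)
    (hγ1 : ∀ y, ‖γ y‖ = 1) {ξ : X → X} (hξ : Measurable ξ)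
    (hE : MemKernelAlgebra μ m (errKernel A ψ γ ξ))
    (hsmall : (kernelNorm μ m (errKernel A ψ γ ξ)).toReal < 1) {i : I} {x₀ : X}
    (hx₀ : x₀ ∈ U i) {s : Set X} (hs : MeasurableSet s) (hsU : s ⊆ U i) :
    ∃ h : H1 μ ψ (fun x => m x z), ∀ (f : Co ψ (fun x => m x z) Y), ∀ G ∈ S.fixed,
      G - S.module.op _ hE G = Co.toY ψ (fun x => m x z) Y f →
      f.1.1 h = ∫ y in s, γ y * Y.emb G y ∂μ := by
  have hv := S.weight_pos
  have hvc : ∀ x, (m x z : ℂ) ≠ 0 := fun x => by exact_mod_cast (hv x).ne'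
  have hvm : StronglyMeasurable fun x => (m x z : ℂ) :=
    (Complex.measurable_ofReal.comp S.measurable_weight).stronglyMeasurable
  have hEm := stronglyMeasurable_errKernel S.frame hγ hξ
  set E := errKernel A ψ γ ξ with hEdef
  -- Conjugating by v turns the weighted problem into one on L^∞ and L¹. Since m(y,z) ≤ m(y,x)
  -- m(x,z), the rows of E' are bounded by the A_m norm of E, which is below 1.
  let E' : X → X → ℂ := fun x y => m y z * E x y * (m x z : ℂ)⁻¹
  have hE'm : StronglyMeasurable (Function.uncurry E') :=
    ((hvm.comp_measurable measurable_snd).mul hEm).mul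
      (hvm.measurable.inv.stronglyMeasurable.comp_measurable measurable_fst)
  have hk : kernelNorm μ m E < 1 := by
    rw [← ENNReal.toReal_lt_toReal hE.2.ne ENNReal.one_ne_top]
    simpa using hsmall
  have hb : ∀ᵐ x ∂μ, ∫⁻ y, ‖E' x y‖ₑ ∂μ ≤ kernelNorm μ m E := by
    have r := ae_lintegral_le_kernelNorm (μ := μ) (m := m) fun x y => E y x
    rw [kernelNorm_swap S.weight E] at r
    filter_upwards [r] with x hx
    refine (lintegral_mono fun y => ?_).trans hx
    rw [← ofReal_norm, ← ofReal_norm]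
    refine ENNReal.ofReal_le_ofReal ?_
    simp only [E', norm_mul, norm_inv, Complex.norm_real, Real.norm_of_nonneg (hv _).le,
      Real.norm_of_nonneg (S.weight.pos _ _).le]
    rw [mul_comm (m y z), mul_assoc]
    refine mul_le_mul_of_nonneg_left ?_ (norm_nonneg _)
    rw [← div_eq_mul_inv, div_le_iff₀ (hv x)]
    exact S.weight.le_mul y z x
  have hu : Integrable (s.indicator fun y => γ y * (m y z : ℂ)) μ := by
    have hsm : μ s < ∞ := (measure_mono hsU).trans_lt (hU.measure_lt_top i)
    refine IntegrableOn.integrable_indicator ?_ hs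
    refine Measure.integrableOn_of_bounded (M := C * m x₀ z) hsm.ne
      (hγ.stronglyMeasurable.mul hvm).aestronglyMeasurable ?_
    refine (ae_restrict_iff' hs).2 (ae_of_all _ fun y hy => ?_)
    rw [norm_mul, hγ1, one_mul, Complex.norm_real, Real.norm_of_nonneg (hv y).le]
    exact (S.weight.le_mul y z x₀).trans
      (mul_le_mul_of_nonneg_right (hC i y (hsU hy) x₀ hx₀) (hv x₀).le)
  -- κ solves the transposed equation with right-hand side χ_s γ v. Then κ / v is the density of h,
  -- and pairing it with (1 − E)G returns ∫_s γG.
  obtain ⟨κ, hκ, hκu⟩ := exists_integrable_sub_eq hE'm hk hb hu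
  obtain ⟨h, hh⟩ := exists_H1_of_integrable S.frame (fun x => S.weight.one_le x z)
    S.measurable_weight S.mem_H1 hM (K := fun y => κ y * (m y z : ℂ)⁻¹)
    (hκ.1.mul hvm.measurable.inv.aestronglyMeasurable) (by
      refine hκ.norm.congr (ae_of_all _ fun y => ?_)
      simp only [norm_mul, norm_inv, Complex.norm_real, Real.norm_of_nonneg (hv _).le]
      rw [inv_mul_cancel_right₀ (hv y).ne'])
  refine ⟨h, fun f G hG hGf => ?_⟩
  obtain ⟨d, hd⟩ := S.ae_norm_le_of_mem_fixed hG
  have h1 := integral_mul_sub_kernel hE'm (hk.trans ENNReal.one_lt_top) hb hκ hκu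
    (F := fun y => Y.emb G y * (m y z : ℂ)⁻¹)
    ((Y.emb G).aestronglyMeasurable.mul hvm.measurable.inv.aestronglyMeasurable) (d := d) (by
      filter_upwards [hd] with y hy
      rw [norm_mul, norm_inv, Complex.norm_real, Real.norm_of_nonneg (hv _).le,
        ← div_eq_mul_inv, div_le_iff₀ (hv y)]
      exact hy)
  have h2 : ∫ y, s.indicator (fun y => γ y * (m y z : ℂ)) y * (Y.emb G y * (m y z : ℂ)⁻¹) ∂μ
      = ∫ y in s, γ y * Y.emb G y ∂μ := by
    rw [← integral_indicator hs]
    refine integral_congr_ae (ae_of_all _ fun y => ?_)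
    by_cases hy : y ∈ s
    · simp only [indicator_of_mem hy]
      field_simp [hvc y]
    · simp only [indicator_of_notMem hy, zero_mul]
  rw [hh, ← h2, ← h1]
  refine integral_congr_ae ?_
  have h3 := Y.emb_sub_ae G (S.module.op _ hE G)
  rw [hGf] at h3
  filter_upwards [Co.emb_toY_ae f, h3, S.module.emb_op_ae hE G] with x e1 e2 e3
  have e4 : ∫ y, E' x y * (Y.emb G y * (m y z : ℂ)⁻¹) ∂μ
      = kernelApply μ E (Y.emb G) x * (m x z : ℂ)⁻¹ := by
    rw [kernelApply, ← integral_mul_const]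
    refine integral_congr_ae (ae_of_all _ fun y => ?_)
    simp only [E']
    field_simp [hvc y, hvc x]
  rw [e4, ← e1, e2, e3]
  ring

end IsCoorbitSetting

end Predual

/-! ### Local averages as coefficients. -/

section Coefficients

variable {X : Type u} [TopologicalSpace X] [MeasurableSpace X] {μ : Measure X}
  {Y : SolidBanachSpace.{u, w} μ} {I : Type*} {U : I → Set X} {ι : X → I} {γ : X → ℂ}

theorem integrableOn_phase_mul (hU : IsAdmissibleCovering U) (hι : ∀ y, y ∈ U (ι y))
    (hγ : Measurable γ) (hγ1 : ∀ y, ‖γ y‖ = 1) (i : I) (F : Y.carrier) :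
    IntegrableOn (fun y => γ y * Y.emb F y) (ι ⁻¹' {i}) μ := by
  have hsub : ι ⁻¹' {i} ⊆ closure (U i) := fun y hy =>
    subset_closure ((show ι y = i from hy) ▸ hι y)
  have h1 : IntegrableOn (Y.emb F) (ι ⁻¹' {i}) μ :=
    ((Y.locallyIntegrable F).integrableOn_isCompact (hU.relativelyCompact i)).mono_set hsub
  exact h1.bdd_mul hγ.aestronglyMeasurable.restrict (ae_of_all _ fun y => (hγ1 y).le)

theorem exists_coefficient (hU : IsAdmissibleCovering U) (hι : ∀ y, y ∈ U (ι y))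
    (hγ : Measurable γ) (hγ1 : ∀ y, ‖γ y‖ = 1) (i : I) :
    ∃ Λ : Y.carrier →L[ℂ] ℂ, ∀ F, Λ F = ∫ y in ι ⁻¹' {i}, γ y * Y.emb F y ∂μ := by
  have hsub : ι ⁻¹' {i} ⊆ closure (U i) := fun y hy =>
    subset_closure ((show ι y = i from hy) ▸ hι y)
  have hint := fun F : Y.carrier => integrableOn_phase_mul hU hι hγ hγ1 i F
  obtain ⟨C, hC⟩ := Y.continuous_emb _ (hU.relativelyCompact i)
  let L : Y.carrier →ₗ[ℂ] ℂ :=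
    { toFun := fun F => ∫ y in ι ⁻¹' {i}, γ y * Y.emb F y ∂μ
      map_add' := fun F G => by
        rw [← integral_add (hint F) (hint G)]
        refine integral_congr_ae (ae_restrict_of_ae ?_)
        filter_upwards [Y.emb_add_ae F G] with y hy
        rw [hy, mul_add]
      map_smul' := fun k F => by
        rw [RingHom.id_apply, smul_eq_mul, ← integral_const_mul]
        refine integral_congr_ae (ae_restrict_of_ae ?_)
        filter_upwards [Y.emb_smul_ae k F] with y hy
        rw [hy]; ring }
  refine ⟨L.mkContinuous C fun F => ?_, fun F => rfl⟩
  refine (norm_integral_le_integral_norm _).trans ?_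
  simp only [norm_mul, hγ1, one_mul]
  refine le_trans ?_ (hC F)
  exact setIntegral_mono_set
    ((Y.locallyIntegrable F).integrableOn_isCompact (hU.relativelyCompact i)).norm
    (ae_of_all _ fun y => norm_nonneg _) hsub.eventuallyLE

/-- The step function of the coefficients is dominated by an average. -/
theorem ae_stepFun_coefficient_le [BorelSpace X] {m : X → X → ℝ} (hY : Y.IsKernelModule m)
    (hU : IsAdmissibleCovering U) {ω : I → ℝ} (hω : ∀ i, 0 < ω i) (hι : ∀ y, y ∈ U (ι y))
    (hγ1 : ∀ y, ‖γ y‖ = 1) (hL : MemKernelAlgebra μ m fun x y => (avgKernel hU ω x y : ℂ))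
    (F F₁ : Y.carrier) (hF₁ : Y.emb F₁ =ᵐ[μ] fun x => (‖Y.emb F x‖ : ℂ)) :
    ∀ᵐ u ∂μ, stepFun hU ω (fun i => ∫ y in ι ⁻¹' {i}, γ y * Y.emb F y ∂μ) u
      ≤ ‖Y.emb (hY.op _ hL F₁) u‖ := by
  have hintU : ∀ i, IntegrableOn (fun y => ‖Y.emb F y‖) (U i) μ := fun i =>
    (((Y.locallyIntegrable F).integrableOn_isCompact (hU.relativelyCompact i)).mono_set
      subset_closure).norm
  filter_upwards [hY.emb_op_ae hL F₁] with u e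
  rw [e, kernelApply_congr_ae hF₁, kernelApply]
  have e3 : ∀ y, (avgKernel hU ω u y : ℂ) * (‖Y.emb F y‖ : ℂ)
      = ((∑ i ∈ (hU.finite_mem u).toFinset,
        ω i * (U i).indicator (fun y => ‖Y.emb F y‖) y : ℝ) : ℂ) := fun y => by
    rw [avgKernel, ← Complex.ofReal_mul, Finset.sum_mul]
    congr 1
    refine Finset.sum_congr rfl fun i _ => ?_
    by_cases hy : y ∈ U i
    · simp [indicator_of_mem hy]
    · simp [indicator_of_notMem hy]
  simp only [e3]
  rw [integral_complex_ofReal, Complex.norm_real, integral_finsetSum _ fun i _ =>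
    ((hintU i).integrable_indicator (hU.measurableSet i)).const_mul (ω i)]
  refine le_trans (Finset.sum_le_sum fun i _ => ?_) (le_abs_self _)
  rw [integral_const_mul, integral_indicator (hU.measurableSet i), mul_comm]
  refine mul_le_mul_of_nonneg_left ?_ (hω i).le
  refine (norm_integral_le_integral_norm _).trans ?_
  simp only [norm_mul, hγ1, one_mul]
  refine setIntegral_mono_set (hintU i) (ae_of_all _ fun y => norm_nonneg _)
    (LE.le.eventuallyLE (show ι ⁻¹' {i} ⊆ U i from fun y hy => ?_))
  exact (show ι y = i from hy) ▸ hι y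

end Coefficients

/-! ### The atomic decomposition. -/

section AtomicDecomposition

variable {X : Type u} {H : Type v} [NormedAddCommGroup H] [InnerProductSpace ℂ H]
  [TopologicalSpace X] [MeasurableSpace X] {μ : Measure X}
  {A : ℝ} {ψ : X → H} {m : X → X → ℝ} {z : X} {Y : SolidBanachSpace.{u, w} μ} {c : ℝ}
  {I : Type*} {U : I → Set X} {Γ : X → X → ℂ}

namespace IsCoorbitSetting

/-- On the piece ι⁻¹{i} the kernel R − E is γ(y) R(w,x_i), so countable additivity of the integral
over the partition gives the sum. -/
theorem ae_hasSum_coefficient (S : IsCoorbitSetting A ψ m z Y c) (hI : Countable I)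
    {x : I → X} {ι : X → I} (hιm : ∀ i, MeasurableSet (ι ⁻¹' {i})) {γ : X → ℂ}
    (hE : MemKernelAlgebra μ m (errKernel A ψ γ fun y => x (ι y))) (F : Y.carrier) :
    ∀ᵐ w ∂μ, HasSum
      (fun i => (∫ y in ι ⁻¹' {i}, γ y * Y.emb F y ∂μ) * frameKernel A ψ w (x i))
      (Y.emb (S.proj F - S.module.op _ hE F) w) := by
  filter_upwards [Y.emb_sub_ae (S.proj F) (S.module.op _ hE F), S.emb_proj_ae F,
    S.module.emb_op_ae hE F, S.module.ae_integrable S.kernel F,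
    S.module.ae_integrable hE F] with w e1 e2 e3 i1 i2
  rw [e1, e2, e3, kernelApply, kernelApply, ← integral_sub i1 i2]
  have hcov : ⋃ i, ι ⁻¹' {i} = univ := eq_univ_of_forall fun y => mem_iUnion.2 ⟨ι y, rfl⟩
  have h1 := hasSum_integral_iUnion (μ := μ) (s := fun i => ι ⁻¹' {i})
    (f := fun y => frameKernel A ψ w y * Y.emb F y
      - errKernel A ψ γ (fun y => x (ι y)) w y * Y.emb F y) hιm
    (fun i j hij => Disjoint.preimage _ (by simpa using hij)) (i1.sub i2).integrableOn
  rw [hcov, Measure.restrict_univ] at h1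
  have e : (fun i => (∫ y in ι ⁻¹' {i}, γ y * Y.emb F y ∂μ) * frameKernel A ψ w (x i))
      = fun i => ∫ y in ι ⁻¹' {i}, (frameKernel A ψ w y * Y.emb F y
        - errKernel A ψ γ (fun y => x (ι y)) w y * Y.emb F y) ∂μ := by
    funext i
    have h2 : ∀ y ∈ ι ⁻¹' {i}, frameKernel A ψ w y * Y.emb F y
        - errKernel A ψ γ (fun y => x (ι y)) w y * Y.emb F y
        = γ y * Y.emb F y * frameKernel A ψ w (x i) := fun y hy => by
      have : ι y = i := hy
      simp only [errKernel, this]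
      ring
    rw [setIntegral_congr_fun (hιm i) h2, integral_mul_const]
  rw [e]
  exact h1

/-- The frame vectors form an atomic decomposition. -/
theorem isAtomicDecomposition [BorelSpace X] [SigmaCompactSpace X] [SigmaFinite μ]
    [IsFiniteMeasureOnCompacts μ] [CompleteSpace H] [TopologicalSpace.SeparableSpace H]
    (S : IsCoorbitSetting A ψ m z Y c)
    (hU : IsModerateAdmissibleCovering μ U) {C : ℝ}
    (hC : ∀ i, ∀ x ∈ U i, ∀ y ∈ U i, m x y ≤ C) (hΓ : ∀ x y, ‖Γ x y‖ = 1)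
    (hosc : MemKernelAlgebra μ m (fun x y => (osc A ψ U Γ x y : ℂ)))
    (hχ : ∀ i, ∃ F : Y.carrier, Y.emb F =ᵐ[μ] (U i).indicator fun _ => (1 : ℂ))
    {x : I → X} (hx : ∀ i, x i ∈ U i) {ι : X → I} (hι : ∀ y, y ∈ U (ι y))
    (hιm : ∀ i, MeasurableSet (ι ⁻¹' {i})) {γ : X → ℂ} (hγ : Measurable γ)
    (hγ1 : ∀ y, ‖γ y‖ = 1) (hE : MemKernelAlgebra μ m (errKernel A ψ γ fun y => x (ι y)))
    (hsmall : (kernelNorm μ m (errKernel A ψ γ fun y => x (ι y))).toReal < 1) :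
    ∃ g : I → Co ψ (fun x => m x z) Y,
      (∀ i (h : H1 μ ψ (fun x => m x z)), (g i).1.1 h = inner ℂ (h : H) (ψ (x i))) ∧
      IsAtomicDecomposition (Co.weakStar ψ (fun x => m x z) Y) g := by
  have hU' := hU.toIsAdmissibleCovering
  have hA := S.frame.bound_pos
  have hA0 : (A : ℂ) ≠ 0 := by exact_mod_cast hA.ne'
  -- Coefficients are integrals over pieces of U_i, so this normalisation makes the step function
  -- one of local means, dominated by the averaging kernel.
  let ω : I → ℝ := fun i => (μ (U i)).toReal⁻¹
  have hμpos : ∀ i, 0 < (μ (U i)).toReal := fun i =>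
    ENNReal.toReal_pos (hU.measure_ne_zero i) (hU'.measure_lt_top i).ne
  have hω : ∀ i, 0 < ω i := fun i => inv_pos.2 (hμpos i)
  have hωμ : ∀ i, (μ (U i)).toReal * ω i = 1 := fun i => mul_inv_cancel₀ (hμpos i).ne'
  have hωμ' : ∀ i, ENNReal.ofReal (ω i) * μ (U i) ≤ 1 := fun i => by
    rw [← ENNReal.ofReal_toReal (hU'.measure_lt_top i).ne, ← ENNReal.ofReal_mul (hω i).le,
      mul_comm, hωμ, ENNReal.ofReal_one]
  have hL := memKernelAlgebra_avgKernel (μ := μ) hU' S.weight hC hω hωμ'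
  choose g hg using fun i => S.exists_atom hU' hΓ hosc hω hωμ hχ hx i
  obtain ⟨k, hk0, hsyn⟩ := S.exists_synthesis hU' hΓ hosc hω hωμ hx hg
  choose Λ hΛ using fun i => exists_coefficient (Y := Y) hU' hι hγ hγ1 i
  refine ⟨g, hg, ?_⟩
  let B : BKSpace I := seqSpace hU' Y hω hU.measure_ne_zero hχ
  -- the coefficients form a sequence in `B`
  have hcoef : ∀ F : Y.carrier, ∃ a : B.carrier, B.coord a = (fun i => (A : ℂ)⁻¹ * Λ i F) ∧
      ‖a‖ ≤ A⁻¹ * (kernelNorm μ m fun x y => (avgKernel hU' ω x y : ℂ)).toReal * ‖F‖ := by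
    intro F
    obtain ⟨F₁, hF₁, hF₁n⟩ := Y.exists_abs F
    have h1 := ae_stepFun_coefficient_le S.module hU' hω hι hγ1 hL F F₁ hF₁
    obtain ⟨a, ha, han⟩ := seqSpace_exists_of_le hU' Y (hω := hω) (hμ := hU.measure_ne_zero)
      (hχ := hχ) h1
    refine ⟨(A : ℂ)⁻¹ • a, ?_, ?_⟩
    · rw [map_smul]
      ext i
      rw [Pi.smul_apply, smul_eq_mul, hΛ]
      exact congrArg _ (congrFun ha i)
    · rw [norm_smul, norm_inv, Complex.norm_real, Real.norm_of_nonneg hA.le, mul_assoc, ← hF₁n]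
      exact mul_le_mul_of_nonneg_left (han.trans (S.module.norm_op_le hL F₁))
        (inv_nonneg.2 hA.le)
  -- synthesis of the coefficients
  have hrec : ∀ F ∈ S.fixed, ∃ f : Co ψ (fun x => m x z) Y,
      (∀ h, HasSum (fun i => (A : ℂ)⁻¹ * Λ i F * (g i).1.1 h) (f.1.1 h)) ∧
      Co.toY ψ (fun x => m x z) Y f = F - S.module.op _ hE F := by
    intro F hF
    obtain ⟨a, ha, -⟩ := hcoef F
    obtain ⟨G, hG, -⟩ := seqSpace_exists_step hU' Y a
    obtain ⟨f, hf, -⟩ := hsyn _ G hG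
    have hf' : ∀ h, HasSum (fun i => (A : ℂ)⁻¹ * Λ i F * (g i).1.1 h) (f.1.1 h) := fun h => by
      have e : (fun i => (A : ℂ)⁻¹ * Λ i F * (g i).1.1 h)
          = fun i => B.coord a i * (g i).1.1 h := by rw [ha]
      rw [e]
      exact hf h
    refine ⟨f, hf', Y.ext_of_ae ?_⟩
    filter_upwards [Co.emb_toY_ae f, S.ae_hasSum_coefficient hU.countable hιm hE F] with w h1 h2
    rw [S.mem_fixed.1 hF] at h2
    rw [h1, extTransform_eq f.1 (S.mem_H1 w).1]
    refine (hf' ⟨ψ w, (S.mem_H1 w).1⟩).unique ?_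
    have e' : (fun i => (A : ℂ)⁻¹ * Λ i F * (g i).1.1 ⟨ψ w, (S.mem_H1 w).1⟩)
        = fun i => (∫ y in ι ⁻¹' {i}, γ y * Y.emb F y ∂μ) * frameKernel A ψ w (x i) := by
      funext i
      have e : (g i).1.1 ⟨ψ w, (S.mem_H1 w).1⟩ = A * frameKernel A ψ w (x i) := by
        rw [hg, ← transform_eq_frameKernel hA]
        rfl
      rw [e, hΛ]
      field_simp
    rw [e']
    exact h2
  -- F − E F is the transform of a coorbit element by `hrec`, hence is reproduced by R. So E
  -- preserves the range and 1 − E is inverted on it.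
  obtain ⟨W, -, hW⟩ := exists_inverse_sub_on S.fixed (S.module.op _ hE)
    (fun F hF => by
      obtain ⟨f, -, hf⟩ := hrec F hF
      have h1 := S.toY_mem_fixed f
      rw [hf] at h1
      have := S.fixed.sub_mem hF h1
      rwa [sub_sub_cancel] at this)
    ENNReal.toReal_nonneg hsmall (S.module.norm_op_le hE)
  let V : Co ψ (fun x => m x z) Y →L[ℂ] Y.carrier :=
    S.fixed.subtypeL.comp (W.comp (S.coEquiv.toContinuousLinearEquiv : _ →L[ℂ] S.fixed))
  have hV : ∀ f, V f - S.module.op _ hE (V f) = Co.toY ψ (fun x => m x z) Y f := fun f =>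
    hW (S.coEquiv f)
  have hVf : ∀ f, V f ∈ S.fixed := fun f => (W (S.coEquiv f)).2
  obtain ⟨M, hM⟩ := exists_ae_norm_frame_le S.frame S.weight S.kernel hΓ hU hosc
  have hcountable := hU.countable
  -- η i is the vector of H¹_v at which evaluating f gives Λ i (V f), which supplies the weak-*
  -- continuity of the coefficients. The factor A⁻¹ is real, so conjugate-linearity does not affect
  -- it.
  choose η hη using fun i => S.exists_H1_coefficient hM hU' hC hγ hγ1
    (measurable_comp_index hιm x) hE hsmall (hx i) (hιm i)
    (fun y hy => (show ι y = i from hy) ▸ hι y)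
  choose L hL' using fun i => Co.exists_weakStar_eval (Y := Y) ((A : ℂ)⁻¹ • η i)
  have hLV : ∀ i f, L i f = (A : ℂ)⁻¹ * Λ i (V f) := fun i f => by
    rw [hL', map_smulₛₗ, hη i f (V f) (hVf f) (hV f), hΛ]
    simp
  have hLV' : ∀ f, (fun i => L i f) = fun i => (A : ℂ)⁻¹ * Λ i (V f) := fun f =>
    funext fun i => hLV i f
  refine ⟨B, L, ?_, ?_, fun f => ?_⟩
  · set ℓ := A⁻¹ * (kernelNorm μ m fun x y => (avgKernel hU' ω x y : ℂ)).toReal with hℓ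
    have hℓ0 : 0 ≤ ℓ := mul_nonneg (inv_nonneg.2 hA.le) ENNReal.toReal_nonneg
    refine ⟨ℓ * ‖V‖ + 1, by positivity, fun f => ?_⟩
    obtain ⟨a, ha, han⟩ := hcoef (V f)
    refine ⟨a, ha.trans (hLV' f).symm, han.trans ?_⟩
    have h1 := mul_le_mul_of_nonneg_left (V.le_opNorm f) hℓ0
    have h2 : 0 ≤ ‖f‖ := norm_nonneg f
    calc _ ≤ ℓ * (‖V‖ * ‖f‖) := h1
      _ ≤ _ := by rw [add_mul, mul_assoc]; linarith
  · refine ⟨k + 1, by positivity, fun a => ?_⟩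
    obtain ⟨G, hG, hGn⟩ := seqSpace_exists_step hU' Y a
    obtain ⟨f, hf, hfn⟩ := hsyn _ G hG
    refine ⟨f, hasSum_weakStar fun h => hf h, hfn.trans ?_⟩
    rw [hGn, add_mul]
    have h2 : 0 ≤ ‖a‖ := norm_nonneg a
    have h3 : k * ‖a‖ ≤ k * ‖a‖ + 1 * ‖a‖ := by linarith
    exact h3
  · obtain ⟨f', h1, h2⟩ := hrec (V f) (hVf f)
    rw [hV] at h2
    rw [S.toY_injective h2] at h1
    refine hasSum_weakStar fun h => ?_
    have e : (fun i => ((L i f • g i : Co ψ (fun x => m x z) Y)).1.1 h)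
        = fun i => (A : ℂ)⁻¹ * Λ i (V f) * (g i).1.1 h := by
      funext i
      rw [← hLV]
      rfl
    rw [e]
    exact h1 h

end IsCoorbitSetting

end AtomicDecomposition

end GenCoorbit

/-! ### The discretization theorem. -/

open GenCoorbit in
theorem theorem3
    {X : Type*} [TopologicalSpace X] [T2Space X] [LocallyCompactSpace X] [SigmaCompactSpace X]
    [MeasurableSpace X] [BorelSpace X] (μ : Measure X) [μ.Regular]
    {H : Type*} [NormedAddCommGroup H] [InnerProductSpace ℂ H] [CompleteSpace H]
    [TopologicalSpace.SeparableSpace H]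
    -- the tight frame, the weight `m`, the point `z` that defines `v = m(·, z)`, and `Y`
    (A : ℝ) (ψ : X → H) (hψ : IsContinuousTightFrame μ A ψ)
    (m : X → X → ℝ) (hm : IsAdmissibleWeight m) (z : X)
    (Y : SolidBanachSpace μ) (hY : Y.IsKernelModule m)
    (hK : MemKernelAlgebra μ m (frameKernel A ψ))
    (hKY : ∀ F : Y.carrier, ∃ c : ℝ, ∀ᵐ x ∂μ,
      ‖kernelApply μ (frameKernel A ψ) (Y.emb F) x‖ ≤ c * m x z)
    -- the phase function and the covering
    (Γ : X → X → ℂ) (hΓ : ∀ x y, ‖Γ x y‖ = 1)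
    {I : Type*} (U : I → Set X) (hU : IsModerateAdmissibleCovering μ U)
    (C : ℝ) (hC : ∀ i, ∀ x ∈ U i, ∀ y ∈ U i, m x y ≤ C)
    (hosc : MemKernelAlgebra μ m (fun x y => (osc A ψ U Γ x y : ℂ)))
    (hsmall :
      (kernelNorm μ m (fun x y => (osc A ψ U Γ x y : ℂ))).toReal *
        ((kernelNorm μ m (frameKernel A ψ)).toReal +
          max (C * (kernelNorm μ m (frameKernel A ψ)).toReal)
            ((kernelNorm μ m (frameKernel A ψ)).toReal +
              (kernelNorm μ m (fun x y => (osc A ψ U Γ x y : ℂ))).toReal)) < 1) :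
    -- every `ψ_x` lies in `H¹_v`, so that `V f (x) = f(ψ_x)` is defined at every `x`
    (∀ x, ψ x ∈ H1 μ ψ (fun x => m x z)) ∧
    -- `Co(Ψ, Y)` is a Banach space
    (∀ f : Co ψ (fun x => m x z) Y, ‖f‖ = 0 → f = 0) ∧
    CompleteSpace (Co ψ (fun x => m x z) Y) ∧
    -- for every choice `x_i ∈ U_i`
    ∀ x : I → X, (∀ i, x i ∈ U i) →
      -- `(ψ_{x_i})` is an atomic decomposition for `Co(Ψ, Y)`
      (∃ g : I → Co ψ (fun x => m x z) Y,
        (∀ i (h : H1 μ ψ (fun x => m x z)), (g i).1.1 h = inner ℂ (h : H) (ψ (x i))) ∧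
        IsAtomicDecomposition (Co.weakStar ψ (fun x => m x z) Y) g) ∧
      -- `(ψ_{x_i})`, acting by `f ↦ f(ψ_{x_i})`, is a Banach frame for `Co(Ψ, Y)`
      (∃ g : I → (Co ψ (fun x => m x z) Y →L[ℂ] ℂ),
        (∀ i f, g i f = extTransform μ ψ (fun x => m x z) f.1 (x i)) ∧
        IsBanachFrame g) := by
  have hcountable := hU.countable
  have hU' := hU.toIsAdmissibleCovering
  obtain ⟨c, -, hH⟩ := exists_H1norm_frame_le hψ hm z hK hΓ hU hC hosc
  have S : IsCoorbitSetting A ψ m z Y c := ⟨hψ, hm, hY, hK, hKY, hH⟩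
  have hχ := fun i => exists_emb_eq_indicator (Y := Y) hm hY hU' hC i
  refine ⟨fun x => (hH x).1, S.eq_zero_of_norm_eq_zero, S.completeSpace_co, fun x hx => ?_⟩
  set k := (kernelNorm μ m (fun x y => (osc A ψ U Γ x y : ℂ))).toReal
  set r := (kernelNorm μ m (frameKernel A ψ)).toReal
  have hk0 : 0 ≤ k := ENNReal.toReal_nonneg
  have hr0 : 0 ≤ r := ENNReal.toReal_nonneg
  -- The second entry of the maximum gives k² + 2rk < 1. From this k < 1 serves the atoms and rk < 1
  -- the Banach frame.
  have hbound : k * (r + (r + k)) < 1 :=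
    (mul_le_mul_of_nonneg_left (add_le_add le_rfl (le_max_right _ _)) hk0).trans_lt hsmall
  have h₁ : k < 1 := by nlinarith
  have h₂ : r * k < 1 := by nlinarith
  obtain ⟨ι, hι, hιm⟩ := exists_measurable_index hU.measurableSet hU'.exists_mem
  obtain ⟨γ, hγ, hγ1, hE, hE₁, hE₂⟩ := exists_phase_small hψ hm hK hΓ hU' hosc h₁ h₂
    (measurable_comp_index hιm x) fun y => ⟨ι y, hι y, hx (ι y)⟩
  choose g hg using fun i => S.exists_sampling (x i)
  exact ⟨S.isAtomicDecomposition hU hC hΓ hosc hχ hx hι hιm hγ hγ1 hE hE₁,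
    g, hg, S.isBanachFrame hU hΓ hosc hχ hx hι hιm hγ hγ1 hE hE₂ hg⟩
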